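/- Let $(\xi_n)_{n\in\mathbb Z}$ be a (strictly) stationary Markov chain on a probability space $(\Omega,\mathcal F,\mathbb P)$ with values in a measurable space $S$, marginal law $\pi$ and transition probability kernel $Q(x,A)$, and let $(Qg)(x)=\int_S g(s)\,Q(x,\mathrm ds)$ be the transition operator on $L^2_0(\pi)$, the measurable real functions $g$ with $\int g^2\,\mathrm d\pi<\infty$ and $\int g\,\mathrm d\pi=0$. Assume that $Q$ is self-adjoint on $L^2_0(\pi)$. Let $g\in L^2_0(\pi)$, $X_n=g(\xi_n)$, $S_n=X_1+\dots+X_n$. Let $\nu$ be the transition spectral measure of $g$, i.e. the finite measure on $[-1,1]$ with $\langle g,Q^ng\rangle=\int_{-1}^1\lambda^n\,\nu(\mathrm d\lambda)$ for all $n\ge 0$. Let $F$ be the spectral distribution of $(X_n)$, i.e. the finite measure on $[0,2\pi]$ with $\mathrm{cov}(X_0,X_n)=\int_0^{2\pi}e^{in\theta}F(\mathrm d\theta)$ for all $n\in\mathbb Z$, and write $F(x)=F([0,x])$. Assume that $\nu$ has no atoms at $\pm1$. Then $F$ is absolutely continuous with respect to Lebesgue measure on $[0,2\pi]$, with density $$f(t)=\frac1{2\pi}\int_{-1}^1\frac{1-\lambda^2}{1+\lambda^2-2\lambda\cos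 t}\,\nu(\mathrm d\lambda),$$ where the integral converges for every $t$ that is not a multiple of $\pi$, and $f$ is integrable on $[0,2\pi]$. Moreover, let $\alpha\in[1,2)$, $C(\alpha)=\dfrac{\Gamma(1+\alpha)\sin(\alpha\pi/2)}{\pi(2-\alpha)}$, and let $h:(0,\infty)\to(0,\infty)$ be continuous and slowly varying at infinity, i.e. $h(st)/h(t)\to1$ as $t\to\infty$ for every $s>0$. Then the following are equivalent: (i) $\mathrm{var}(S_n)\sim n^{\alpha}h(n)$ as $n\to\infty$; (ii) $F(x)\sim\frac12C(\alpha)x^{2-\alpha}h(1/x)$ as $x\to0^+$. If in addition $h(t)\to\infty$ as $t\to\infty$, then (i) and (ii) are each also equivalent to (iii) $\displaystyle\int_0^1\frac{r(y)\,\mathrm dy}{x^2+y^2}\sim\frac\pi2C(\alpha)x^{1-\alpha}h(1/x)+O(1)$ as $x\to0^+$, where $r(y)=\nu\big((1-y,1)\big)$. (That is, the left side is asymptotically equivalent to the first term plus some function which is bounded near $0$.) -/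

import Mathlib

open MeasureTheory ProbabilityTheory Filter Topology Asymptotics

noncomputable section

namespace ReversibleChain

/-- The sigma-algebra `F_n` generated by `ξ_i`, `i ≤ n`. -/
def past {Ω S : Type*} [MeasurableSpace S] (ξ : ℤ → Ω → S) (n : ℤ) : MeasurableSpace Ω :=
  ⨆ i : Set.Iic n, MeasurableSpace.comap (ξ i) inferInstance

/-- `(ξ_n)_{n ∈ ℤ}` is a strictly stationary Markov chain under `P` with transition kernel `Q`:
`Q(ξ_n, A)` is a version of `P(ξ_{n+1} ∈ A | F_n)`. -/
structure IsStationaryMarkovChain {Ω S : Type*} [MeasurableSpace Ω] [MeasurableSpace S]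
    (P : Measure Ω) (Q : Kernel S S) (ξ : ℤ → Ω → S) : Prop where
  measurable : ∀ n, Measurable (ξ n)
  stationary : ∀ k : ℤ, P.map (fun ω n => ξ (n + k) ω) = P.map (fun ω n => ξ n ω)
  markov : ∀ (n : ℤ) (A : Set S), MeasurableSet A →
    P[(ξ (n + 1) ⁻¹' A).indicator (fun _ => (1 : ℝ)) | past ξ n]
      =ᵐ[P] fun ω => (Q (ξ n ω)).real A

/-- Membership in `L²₀(π)`: measurable, square integrable, with zero mean. -/
structure MemL20 {S : Type*} [MeasurableSpace S] (π : Measure S) (g : S → ℝ) : Prop where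
  measurable : Measurable g
  memLp : MemLp g 2 π
  mean_zero : ∫ s, g s ∂π = 0

/-- The transition operator `(Q g)(x) = ∫ g(s) Q(x, ds)`. -/
def transOp {S : Type*} [MeasurableSpace S] (Q : Kernel S S) (g : S → ℝ) : S → ℝ :=
  fun x => ∫ s, g s ∂(Q x)

/-- The transition operator is self-adjoint on `L²₀(π)`. (For `π` stationary it is an everywhere
defined contraction there, so self-adjointness is the symmetry of the form `⟨Q f, g⟩`.) -/
def IsSelfAdjointOn {S : Type*} [MeasurableSpace S] (Q : Kernel S S) (π : Measure S) : Prop :=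
  ∀ f g : S → ℝ, MemL20 π f → MemL20 π g →
    ∫ x, transOp Q f x * g x ∂π = ∫ x, f x * transOp Q g x ∂π

/-- `ν` is the transition spectral measure of the self-adjoint transition operator `Q` with
respect to `g`: the (unique) finite measure carried by `[-1, 1]` with
`⟨g, Q^n g⟩ = ∫ λ^n ν(dλ)` for all `n ≥ 0`. -/
structure IsTransitionSpectralMeasure {S : Type*} [MeasurableSpace S] (Q : Kernel S S)
    (π : Measure S) (g : S → ℝ) (ν : Measure ℝ) : Prop where
  finite : IsFiniteMeasure ν
  support : ν (Set.Icc (-1) 1)ᶜ = 0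
  moments : ∀ n : ℕ, ∫ x, g x * ((transOp Q)^[n] g) x ∂π = ∫ l, l ^ n ∂ν

/-- `F` is the spectral distribution (viewed as a measure on `[0, 2π]`) of the weakly stationary
real sequence `X`: `cov(X_0, X_n) = ∫ e^{inθ} F(dθ)` for all `n ∈ ℤ`. -/
structure IsSpectralDistribution {Ω : Type*} [MeasurableSpace Ω] (P : Measure Ω)
    (X : ℤ → Ω → ℝ) (F : Measure ℝ) : Prop where
  finite : IsFiniteMeasure F
  support : F (Set.Icc 0 (2 * Real.pi))ᶜ = 0
  herglotz : ∀ n : ℤ,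
    ((cov[X 0, X n; P] : ℝ) : ℂ) = ∫ θ : ℝ, Complex.exp (Complex.I * (n : ℂ) * (θ : ℂ)) ∂F

/-- The distribution function `F(x) = F([0, x])`. -/
def distFun (F : Measure ℝ) (x : ℝ) : ℝ := F.real (Set.Icc 0 x)

/-- The partial sum `S_n = X_1 + ⋯ + X_n`. -/
def partialSum {Ω : Type*} (X : ℤ → Ω → ℝ) (n : ℕ) : Ω → ℝ :=
  fun ω => ∑ i ∈ Finset.Icc 1 n, X (i : ℤ) ω

/-- The integrand `(1 - λ²) / (1 + λ² - 2 λ cos t)`. -/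
def poisson (t l : ℝ) : ℝ := (1 - l ^ 2) / (1 + l ^ 2 - 2 * l * Real.cos t)

/-- The function `f(t) = (1/2π) ∫_{-1}^{1} (1 - λ²) / (1 + λ² - 2 λ cos t) ν(dλ)`. -/
def density (ν : Measure ℝ) (t : ℝ) : ℝ :=
  1 / (2 * Real.pi) * ∫ l in Set.Icc (-1 : ℝ) 1, poisson t l ∂ν

/-- `C(α) = Γ(1 + α) sin(απ/2) / (π (2 - α))`. -/
def cConst (α : ℝ) : ℝ :=
  Real.Gamma (1 + α) * Real.sin (α * Real.pi / 2) / (Real.pi * (2 - α))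

/-- `h : (0, ∞) → (0, ∞)` is continuous and slowly varying at infinity. -/
structure SlowlyVarying (h : ℝ → ℝ) : Prop where
  pos : ∀ t, 0 < t → 0 < h t
  continuousOn : ContinuousOn h (Set.Ioi 0)
  ratio : ∀ s, 0 < s → Tendsto (fun t => h (s * t) / h t) atTop (𝓝 1)

/-- `var(S_n) ~ n^α h(n)` as `n → ∞`. -/
def VarianceAsymp {Ω : Type*} [MeasurableSpace Ω] (P : Measure Ω) (X : ℤ → Ω → ℝ)
    (α : ℝ) (h : ℝ → ℝ) : Prop :=
  (fun n : ℕ => Var[partialSum X n; P]) ~[atTop] (fun n : ℕ => (n : ℝ) ^ α * h n)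

/-- `F(x) ~ (1/2) C(α) x^{2-α} h(1/x)` as `x → 0+`. -/
def SpectralAsymp (F : Measure ℝ) (α : ℝ) (h : ℝ → ℝ) : Prop :=
  distFun F ~[𝓝[>] 0] (fun x => 1 / 2 * cConst α * x ^ (2 - α) * h (1 / x))

/-- `r(y) = ν(1 - y, 1)`. -/
def rFun (ν : Measure ℝ) (y : ℝ) : ℝ := ν.real (Set.Ioo (1 - y) 1)

/-- `∫_0^1 r(y) dy / (x² + y²) ~ (π/2) C(α) x^{1-α} h(1/x) + O(1)` as `x → 0+`. -/
def TransitionAsymp (ν : Measure ℝ) (α : ℝ) (h : ℝ → ℝ) : Prop :=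
  ∃ e : ℝ → ℝ, e =O[𝓝[>] 0] (fun _ => (1 : ℝ)) ∧
    (fun x => ∫ y in (0 : ℝ)..1, rFun ν y / (x ^ 2 + y ^ 2)) ~[𝓝[>] 0]
      (fun x => Real.pi / 2 * cConst α * x ^ (1 - α) * h (1 / x) + e x)

end ReversibleChain

end

/-! Everything is reduced to integrals against ν. The Markov property gives cov(X_i, X_j) = ∫
λ^|i-j| dν (`IsStationaryMarkovChain.covariance_eq`). By Poisson's formula the measure with density
f has these numbers as Fourier coefficients, and uniqueness on the circle identifies it with F
(`eq_withDensity_density`). Summing the covariances writes Var S_n as the integral of an explicit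
kernel (`variance_eq_integral_varKernel`), and integrating the Poisson kernel gives πF(x) = ∫
arctan((1+λ)/(1-λ) tan(x/2)) dν (`distFun_eq_integral_arctan`).

With u = -log λ on (0, 1), the two kernels are K_n(u) = 2(e^{-nu} - 1 + nu)/u² and arctan(x/u), up
to errors O(n) and O(x) that also absorb λ ≤ 0. If 1/(1-λ) is not ν-integrable, the main terms
dominate these errors. If it is, then Var S_n / n and F(x)/x converge to σ and σ/(2π) with σ = ∫
(1+λ)/(1-λ) dν, and for ν ≠ 0 either asymptotic relation holds exactly when α = 1 and h → σ; for ν =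
0 both fail.

The Tauberian core is `varMain_iff_arctanMain`. After rescaling there is a sequence of measures on
(0, ∞) for which one family of integrals converges, and the limit of another is wanted. Instead of
identifying a limit measure, the sequence is compared with an explicit model having the known
limits: a multiple of u^{1-α} du when α > 1, point masses escaping to infinity when α = 1. Following
Karamata, the given data yield all moments of a variable w(u) in (0, 1) relative to a positive
weight, and Weierstrass approximation extends the comparison to every function whose quotient by the
weight has limits at 0 and ∞. From K_k, second differences in k give moments of e^{-u}
(`close_arctan_of_expKernel`). From arctan(s/u), concavity in s allows differentiation, and divided
differences of the Cauchy kernel give moments of 1/(1+u²) (`close_expKernel_of_arctan`). The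
constant C(α) enters only through the model.

For (iii), Fubini turns the integral of r into arctan integrals; it differs from πF(x)/x by O(1),
which is negligible once h → ∞ (`spectralAsymp_iff_transitionAsymp`). -/

namespace ReversibleChain

/-! ### Covariances of the chain -/

section Markov

variable {Ω S : Type*} [MeasurableSpace Ω] [MeasurableSpace S]
  {P : Measure Ω} {Q : Kernel S S} {ξ : ℤ → Ω → S}

lemma measurable_past (n i : ℤ) (h : i ≤ n) : Measurable[past ξ n] (ξ i) := by
  have h1 : MeasurableSpace.comap (ξ i) inferInstance ≤ past ξ n :=
    le_iSup (fun j : Set.Iic n => MeasurableSpace.comap (ξ j) inferInstance) ⟨i, h⟩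
  exact measurable_iff_comap_le.mpr h1

lemma past_le (hξ : ∀ n, Measurable (ξ n)) (n : ℤ) : past ξ n ≤ (inferInstance : MeasurableSpace Ω) :=
  iSup_le fun i => (hξ i).comap_le

/-- On rectangles this is the defining property of conditional expectation, applied to an event of
the past up to k. The extra coordinate at time i is kept so that products of functions at times i
and k + 1 can be integrated. -/
lemma IsStationaryMarkovChain.map_pair_succ [IsProbabilityMeasure P] [IsMarkovKernel Q]
    (hξ : IsStationaryMarkovChain P Q ξ) {i k : ℤ} (hik : i ≤ k) :
    P.map (fun ω => ((ξ i ω, ξ k ω), ξ (k + 1) ω)) =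
      (P.map (fun ω => (ξ i ω, ξ k ω))) ⊗ₘ (Q.comap Prod.snd measurable_snd) := by
  have hm := hξ.measurable
  have hZ : Measurable (fun ω => (ξ i ω, ξ k ω)) := (hm i).prodMk (hm k)
  have hZp : Measurable[past ξ k] (fun ω => (ξ i ω, ξ k ω)) :=
    (measurable_past k i hik).prodMk (measurable_past k k le_rfl)
  have : IsProbabilityMeasure (P.map (fun ω => (ξ i ω, ξ k ω))) :=
    Measure.isProbabilityMeasure_map hZ.aemeasurable
  have : IsProbabilityMeasure (P.map (fun ω => ((ξ i ω, ξ k ω), ξ (k + 1) ω))) :=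
    Measure.isProbabilityMeasure_map (hZ.prodMk (hm _)).aemeasurable
  refine Measure.ext_prod fun {s t} hs ht => ?_
  rw [Measure.compProd_apply_prod hs ht, Measure.map_apply (hZ.prodMk (hm _)) (hs.prod ht),
    setLIntegral_map hs (Kernel.measurable_coe _ ht) hZ]
  have hA : MeasurableSet (ξ (k + 1) ⁻¹' t) := hm _ ht
  have hB : MeasurableSet[past ξ k] ((fun ω => (ξ i ω, ξ k ω)) ⁻¹' s) := hZp hs
  have hle := past_le hm k
  have h1 : ∫ ω in (fun ω => (ξ i ω, ξ k ω)) ⁻¹' s,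
      (P[(ξ (k + 1) ⁻¹' t).indicator (fun _ => (1 : ℝ)) | past ξ k]) ω ∂P
      = ∫ ω in (fun ω => (ξ i ω, ξ k ω)) ⁻¹' s,
      (ξ (k + 1) ⁻¹' t).indicator (fun _ => (1 : ℝ)) ω ∂P :=
    setIntegral_condExp hle ((integrable_const 1).indicator hA) hB
  rw [setIntegral_congr_ae (g := fun ω => (Q (ξ k ω)).real t) (hle _ hB)
    ((hξ.markov k t ht).mono fun x hx _ => hx), integral_indicator_const _ hA] at h1
  simp only [smul_eq_mul, mul_one, measureReal_restrict_apply hA] at h1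
  have hset : (fun ω => ((ξ i ω, ξ k ω), ξ (k + 1) ω)) ⁻¹' s ×ˢ t =
      ξ (k + 1) ⁻¹' t ∩ (fun ω => (ξ i ω, ξ k ω)) ⁻¹' s := by
    ext ω; simp [and_comm]
  rw [hset, ← ofReal_measureReal (μ := P), ← h1,
    ofReal_integral_eq_lintegral_ofReal]
  · refine lintegral_congr fun ω => ?_
    simp [Kernel.comap_apply]
  · refine Integrable.of_bound (C := 1) ?_ ?_
    · exact (((Kernel.measurable_coe Q ht).ennreal_toReal).comp (hm k)).aestronglyMeasurable
    · exact Eventually.of_forall fun ω => by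
        rw [Real.norm_of_nonneg measureReal_nonneg]; exact measureReal_le_one
  · exact Eventually.of_forall fun ω => measureReal_nonneg

lemma measurable_transOp [IsMarkovKernel Q] {f : S → ℝ} (hf : Measurable f) :
    Measurable (transOp Q f) :=
  (StronglyMeasurable.integral_kernel (κ := Q) hf.stronglyMeasurable).measurable

/-- Disintegration of the joint law along the last step. Returning integrability lets the step be
iterated without proving that `transOp` preserves L². -/
lemma IsStationaryMarkovChain.integral_mul_succ [IsProbabilityMeasure P] [IsMarkovKernel Q]
    (hξ : IsStationaryMarkovChain P Q ξ) {i k : ℤ} (hik : i ≤ k) {g f : S → ℝ}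
    (hg : Measurable g) (hf : Measurable f)
    (hint : Integrable (fun ω => g (ξ i ω) * f (ξ (k + 1) ω)) P) :
    Integrable (fun ω => g (ξ i ω) * transOp Q f (ξ k ω)) P ∧
    ∫ ω, g (ξ i ω) * f (ξ (k + 1) ω) ∂P = ∫ ω, g (ξ i ω) * transOp Q f (ξ k ω) ∂P := by
  have hm := hξ.measurable
  have hZ : Measurable (fun ω => (ξ i ω, ξ k ω)) := (hm i).prodMk (hm k)
  have : IsProbabilityMeasure (P.map (fun ω => (ξ i ω, ξ k ω))) :=
    Measure.isProbabilityMeasure_map hZ.aemeasurable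
  have hG : Measurable (fun p : (S × S) × S => g p.1.1 * f p.2) := by fun_prop
  have hH : Measurable (fun p : S × S => g p.1 * transOp Q f p.2) :=
    (hg.comp measurable_fst).mul ((measurable_transOp hf).comp measurable_snd)
  have hI : Integrable (fun p : (S × S) × S => g p.1.1 * f p.2)
      (P.map (fun ω => ((ξ i ω, ξ k ω), ξ (k + 1) ω))) :=
    (integrable_map_measure hG.aestronglyMeasurable (hZ.prodMk (hm _)).aemeasurable).mpr hint
  have e1 : ∫ ω, g (ξ i ω) * f (ξ (k + 1) ω) ∂P = ∫ p, g p.1.1 * f p.2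
      ∂(P.map (fun ω => ((ξ i ω, ξ k ω), ξ (k + 1) ω))) :=
    (integral_map (hZ.prodMk (hm _)).aemeasurable hG.aestronglyMeasurable).symm
  have e2 : ∀ x : S × S, ∫ z, g x.1 * f z ∂((Q.comap Prod.snd (measurable_snd : Measurable (Prod.snd : S × S → S))) x)
      = g x.1 * transOp Q f x.2 := fun x => by
    rw [integral_const_mul, Kernel.comap_apply, transOp]
  rw [hξ.map_pair_succ hik] at hI e1
  have hI2 := Integrable.integral_compProd (a := ()) hI
  rw [e1, Measure.integral_compProd hI]
  simp only [Kernel.prodMkLeft_apply, Kernel.const_apply, e2] at hI2 ⊢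
  refine ⟨?_, integral_map hZ.aemeasurable hH.aestronglyMeasurable⟩
  exact (integrable_map_measure hH.aestronglyMeasurable hZ.aemeasurable).mp hI2

lemma IsStationaryMarkovChain.integral_mul_add [IsProbabilityMeasure P] [IsMarkovKernel Q]
    (hξ : IsStationaryMarkovChain P Q ξ) (i : ℤ) (n : ℕ) {g f : S → ℝ}
    (hg : Measurable g) (hf : Measurable f)
    (hint : Integrable (fun ω => g (ξ i ω) * f (ξ (i + n) ω)) P) :
    ∫ ω, g (ξ i ω) * f (ξ (i + n) ω) ∂P = ∫ ω, g (ξ i ω) * (transOp Q)^[n] f (ξ i ω) ∂P := by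
  induction n generalizing f with
  | zero => simp
  | succ n ih =>
    push_cast at hint ⊢
    rw [← add_assoc] at hint ⊢
    obtain ⟨h1, h2⟩ := hξ.integral_mul_succ (i := i) (k := i + n) (by omega) hg hf hint
    rw [h2, ih (measurable_transOp hf) h1, Function.iterate_succ_apply]

lemma IsStationaryMarkovChain.map_eq (hξ : IsStationaryMarkovChain P Q ξ) (i : ℤ) :
    P.map (ξ i) = P.map (ξ 0) := by
  have hm := hξ.measurable
  have h := congrArg (fun μ => Measure.map (fun f : ℤ → S => f 0) μ) (hξ.stationary i)
  rw [Measure.map_map (measurable_pi_apply 0) (by fun_prop),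
    Measure.map_map (measurable_pi_apply 0) (by fun_prop)] at h
  simpa [Function.comp_def] using h

lemma iterate_measurable [IsMarkovKernel Q] {g : S → ℝ} (hg : Measurable g) (n : ℕ) :
    Measurable ((transOp Q)^[n] g) := by
  induction n with
  | zero => exact hg
  | succ n ih => rw [Function.iterate_succ_apply']; exact measurable_transOp ih

lemma IsStationaryMarkovChain.memLp (hξ : IsStationaryMarkovChain P Q ξ) {g : S → ℝ}
    (hg : MemL20 (P.map (ξ 0)) g) (i : ℤ) : MemLp (fun ω => g (ξ i ω)) 2 P := by
  have h := hg.memLp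
  rw [← hξ.map_eq i] at h
  exact (memLp_map_measure_iff hg.measurable.aestronglyMeasurable
    (hξ.measurable i).aemeasurable).mp h

lemma IsStationaryMarkovChain.integral_eq_zero (hξ : IsStationaryMarkovChain P Q ξ) {g : S → ℝ}
    (hg : MemL20 (P.map (ξ 0)) g) (i : ℤ) : ∫ ω, g (ξ i ω) ∂P = 0 := by
  have h := hg.mean_zero
  rw [← hξ.map_eq i, integral_map (hξ.measurable i).aemeasurable
    hg.measurable.aestronglyMeasurable] at h
  exact h

lemma IsStationaryMarkovChain.covariance_eq [IsProbabilityMeasure P] [IsMarkovKernel Q]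
    (hξ : IsStationaryMarkovChain P Q ξ) {g : S → ℝ} (hg : MemL20 (P.map (ξ 0)) g)
    {ν : Measure ℝ} (hν : IsTransitionSpectralMeasure Q (P.map (ξ 0)) g ν) (i j : ℤ) :
    cov[fun ω => g (ξ i ω), fun ω => g (ξ j ω); P] = ∫ l, l ^ (i - j).natAbs ∂ν := by
  wlog hij : i ≤ j generalizing i j with H
  · rw [covariance_comm, H j i (by omega), show (j - i).natAbs = (i - j).natAbs by omega]
  obtain ⟨n, rfl⟩ := Int.exists_add_of_le hij
  rw [covariance_eq_sub (hξ.memLp hg _) (hξ.memLp hg _)]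
  simp only [Pi.mul_apply, hξ.integral_eq_zero hg, mul_zero, sub_zero]
  rw [hξ.integral_mul_add i n hg.measurable hg.measurable
    ((hξ.memLp hg i).integrable_mul (hξ.memLp hg (i + n))),
    show (i - (i + n)).natAbs = n by omega, ← hν.moments n, ← hξ.map_eq i,
    integral_map (hξ.measurable i).aemeasurable]
  exact (hg.measurable.mul (iterate_measurable hg.measurable n)).aestronglyMeasurable

end Markov

/-! ### Uniqueness of Fourier coefficients of measures -/

section CircleUniqueness

/-- The continuous functions with equal integrals form a closed subspace, and it contains the
Fourier monomials, whose span is dense. -/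
lemma addCircle_measure_ext {T : ℝ} [Fact (0 < T)] {μ₁ μ₂ : Measure (AddCircle T)}
    [IsFiniteMeasure μ₁] [IsFiniteMeasure μ₂]
    (h : ∀ n : ℤ, ∫ x, fourier n x ∂μ₁ = ∫ x, fourier n x ∂μ₂) : μ₁ = μ₂ := by
  have hint : ∀ (μ : Measure (AddCircle T)) [IsFiniteMeasure μ] (f : C(AddCircle T, ℂ)),
      Integrable (fun x => f x) μ := fun μ _ f =>
    Integrable.of_bound f.continuous.aestronglyMeasurable ‖f‖
      (Eventually.of_forall fun x => f.norm_coe_le_norm x)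
  have hlip : ∀ (μ : Measure (AddCircle T)) [IsFiniteMeasure μ],
      Continuous fun f : C(AddCircle T, ℂ) => ∫ x, f x ∂μ := fun μ _ => by
    refine continuous_iff_continuousAt.mpr fun f₀ => ?_
    refine tendsto_integral_filter_of_norm_le_const
      (Eventually.of_forall fun f => f.continuous.aestronglyMeasurable)
      ⟨‖f₀‖ + 1, ?_⟩ (Eventually.of_forall fun x => ?_)
    · filter_upwards [Metric.ball_mem_nhds f₀ one_pos] with f hf
      refine Eventually.of_forall fun x => (f.norm_coe_le_norm x).trans ?_
      have := norm_sub_norm_le f f₀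
      rw [Metric.mem_ball, dist_eq_norm] at hf
      linarith
    · exact (continuous_eval_const x).tendsto f₀
  let K : Submodule ℂ C(AddCircle T, ℂ) :=
    { carrier := {f | ∫ x, f x ∂μ₁ = ∫ x, f x ∂μ₂}
      add_mem' := fun {f g} hf hg => by
        simp only [Set.mem_ofPred_eq, ContinuousMap.add_apply] at *
        rw [integral_add (hint _ f) (hint _ g), integral_add (hint _ f) (hint _ g), hf, hg]
      zero_mem' := by simp
      smul_mem' := fun c f hf => by
        simp only [Set.mem_ofPred_eq, ContinuousMap.smul_apply] at *
        rw [integral_smul, integral_smul, hf] }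
  have hK : IsClosed (K : Set C(AddCircle T, ℂ)) := isClosed_eq (hlip μ₁) (hlip μ₂)
  have hspan : Submodule.span ℂ (Set.range (@fourier T)) ≤ K :=
    Submodule.span_le.mpr (by rintro _ ⟨n, rfl⟩; exact h n)
  have htop : K = ⊤ := by
    rw [eq_top_iff, ← span_fourier_closure_eq_top]
    exact Submodule.topologicalClosure_minimal _ hspan hK
  refine ext_of_forall_integral_eq_of_IsFiniteMeasure fun f => ?_
  have hf : (⟨fun x => (f x : ℂ), by fun_prop⟩ : C(AddCircle T, ℂ)) ∈ K := by
    rw [htop]; trivial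
  have hf' : ∫ x, (f x : ℂ) ∂μ₁ = ∫ x, (f x : ℂ) ∂μ₂ := hf
  rw [integral_complex_ofReal, integral_complex_ofReal] at hf'
  exact_mod_cast hf'

/-- Fourier coefficients only see the image on the circle, where 0 and 2π are glued, so mass could
move between the endpoints. It suffices that one of the measures has no mass there. -/
lemma measure_ext_of_fourier {μ₁ μ₂ : Measure ℝ} [IsFiniteMeasure μ₁] [IsFiniteMeasure μ₂]
    (h₁ : μ₁ (Set.Icc 0 (2 * Real.pi))ᶜ = 0) (h₂ : μ₂ (Set.Icc 0 (2 * Real.pi))ᶜ = 0)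
    (hz : μ₂ {0} = 0) (hp : μ₂ {2 * Real.pi} = 0)
    (h : ∀ n : ℤ, ∫ θ : ℝ, Complex.exp (Complex.I * (n : ℂ) * (θ : ℂ)) ∂μ₁ =
      ∫ θ : ℝ, Complex.exp (Complex.I * (n : ℂ) * (θ : ℂ)) ∂μ₂) : μ₁ = μ₂ := by
  have : Fact (0 < 2 * Real.pi) := ⟨Real.two_pi_pos⟩
  have hmk : Measurable (fun x : ℝ => (x : AddCircle (2 * Real.pi))) := AddCircle.measurable_mk'
  have hf : ∀ (n : ℤ) (x : ℝ), fourier n (x : AddCircle (2 * Real.pi)) =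
      Complex.exp (Complex.I * (n : ℂ) * (x : ℂ)) := fun n x => by
    rw [fourier_coe_apply]
    congr 1
    have : (Real.pi : ℂ) ≠ 0 := by exact_mod_cast Real.pi_ne_zero
    push_cast
    field_simp
  have hmap : μ₁.map (fun x : ℝ => (x : AddCircle (2 * Real.pi))) =
      μ₂.map (fun x : ℝ => (x : AddCircle (2 * Real.pi))) := by
    have := Measure.isFiniteMeasure_map μ₁ (fun x : ℝ => (x : AddCircle (2 * Real.pi)))
    have := Measure.isFiniteMeasure_map μ₂ (fun x : ℝ => (x : AddCircle (2 * Real.pi)))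
    refine addCircle_measure_ext fun n => ?_
    rw [integral_map hmk.aemeasurable (fourier n).continuous.aestronglyMeasurable,
      integral_map hmk.aemeasurable (fourier n).continuous.aestronglyMeasurable]
    simp only [hf]
    exact h n
  -- The images agree, so the point 0 of the circle, whose preimage in [0, 2π] is {0, 2π}, is null
  -- for both.
  have hz₁ : μ₁ {0} = 0 := by
    have hpre : (fun x : ℝ => (x : AddCircle (2 * Real.pi))) ⁻¹' {0} ⊆
        ({0} ∪ {2 * Real.pi}) ∪ (Set.Icc 0 (2 * Real.pi))ᶜ := by
      intro x hx
      simp only [Set.mem_preimage, Set.mem_singleton_iff, AddCircle.coe_eq_zero_iff] at hx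
      obtain ⟨n, rfl⟩ := hx
      by_cases h0 : (n • (2 * Real.pi)) ∈ Set.Icc 0 (2 * Real.pi)
      · left
        rw [zsmul_eq_mul] at h0 ⊢
        have hpi := Real.two_pi_pos
        have h1 : (0 : ℝ) ≤ n := by
          by_contra hc
          push Not at hc
          nlinarith [h0.1]
        have h2 : (n : ℝ) ≤ 1 := by
          by_contra hc
          push Not at hc
          nlinarith [h0.2]
        have h1' : 0 ≤ n := by exact_mod_cast h1
        have h2' : n ≤ 1 := by exact_mod_cast h2
        have : n = 0 ∨ n = 1 := by omega
        rcases this with rfl | rfl <;> simp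
      · exact Or.inr h0
    have h0 : μ₂.map (fun x : ℝ => (x : AddCircle (2 * Real.pi))) {0} = 0 := by
      rw [Measure.map_apply hmk (measurableSet_singleton _)]
      exact measure_mono_null hpre (measure_union_null (measure_union_null hz hp) h₂)
    rw [← hmap, Measure.map_apply hmk (measurableSet_singleton _)] at h0
    exact measure_mono_null (by intro x hx; simp_all) h0
  -- The section of the quotient map with values in (0, 2π]; it recovers a measure on [0, 2π]
  -- without an atom at 0 from its image.
  let q : AddCircle (2 * Real.pi) → ℝ := fun x => (AddCircle.measurableEquivIoc (2 * Real.pi) 0 x : ℝ)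
  have hq : Measurable q :=
    measurable_subtype_coe.comp (AddCircle.measurableEquivIoc (2 * Real.pi) 0).measurable
  have key : ∀ μ : Measure ℝ, μ (Set.Icc 0 (2 * Real.pi))ᶜ = 0 → μ {0} = 0 →
      (μ.map (fun x : ℝ => (x : AddCircle (2 * Real.pi)))).map q = μ := by
    intro μ hμ hμ0
    rw [Measure.map_map hq hmk]
    have hae : ∀ᵐ x ∂μ, (q ∘ fun x : ℝ => (x : AddCircle (2 * Real.pi))) x = id x := by
      have h1 : ∀ᵐ x ∂μ, x ∈ Set.Icc 0 (2 * Real.pi) := by rw [ae_iff]; exact hμ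
      have h2 : ∀ᵐ x ∂μ, x ≠ 0 := by rw [ae_iff]; simpa using hμ0
      filter_upwards [h1, h2] with x hx hx0
      have hx' : x ∈ Set.Ioc (0 : ℝ) (0 + 2 * Real.pi) :=
        ⟨lt_of_le_of_ne hx.1 (Ne.symm hx0), by simpa using hx.2⟩
      simp only [Function.comp_apply, id, q]
      exact congrArg Subtype.val (AddCircle.equivIoc_coe_eq (p := 2 * Real.pi) hx')
    rw [Measure.map_congr hae, Measure.map_id]
  rw [← key μ₁ h₁ hz₁, ← key μ₂ h₂ hz, hmap]

end CircleUniqueness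

/-! ### The Poisson kernel and integrability of the density -/

section Poisson

lemma poisson_denom_eq (t l : ℝ) :
    1 + l ^ 2 - 2 * l * Real.cos t = (l - Real.cos t) ^ 2 + Real.sin t ^ 2 := by
  have := Real.sin_sq_add_cos_sq t
  nlinarith

lemma poisson_denom_pos (t : ℝ) {l : ℝ} (hl : l ∈ Set.Ioo (-1 : ℝ) 1) :
    0 < 1 + l ^ 2 - 2 * l * Real.cos t := by
  have h1 := Real.neg_one_le_cos t
  have h2 := Real.cos_le_one t
  obtain ⟨h3, h4⟩ := hl
  rcases le_total 0 l with h | h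
  · nlinarith
  · nlinarith

lemma poisson_nonneg (t : ℝ) {l : ℝ} (hl : l ∈ Set.Ioo (-1 : ℝ) 1) : 0 ≤ poisson t l := by
  refine div_nonneg ?_ (poisson_denom_pos t hl).le
  nlinarith [hl.1, hl.2]

lemma continuous_poisson {l : ℝ} (hl : l ∈ Set.Ioo (-1 : ℝ) 1) :
    Continuous (fun t => poisson t l) := by
  unfold poisson
  exact Continuous.div (by fun_prop) (by fun_prop) fun t => (poisson_denom_pos t hl).ne'

lemma measurable_poisson : Measurable (fun p : ℝ × ℝ => poisson p.1 p.2) := by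
  unfold poisson; fun_prop

lemma integrableOn_poisson {ν : Measure ℝ} [IsFiniteMeasure ν] {t : ℝ} (ht : Real.sin t ≠ 0) :
    IntegrableOn (poisson t) (Set.Icc (-1) 1) ν := by
  refine ContinuousOn.integrableOn_compact isCompact_Icc ?_
  unfold poisson
  refine ContinuousOn.div (by fun_prop) (by fun_prop) fun l _ => ?_
  rw [poisson_denom_eq]
  positivity

/-- Since 1 + l² - 2l cos t = |e^{it} - l|², `poisson t l` is the Poisson kernel of the disc at the
real point l, and this is Poisson's formula for z ↦ z^n. -/
lemma integral_poisson_pow {l : ℝ} (hl : l ∈ Set.Ioo (-1 : ℝ) 1) (n : ℕ) :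
    ∫ t in (0 : ℝ)..2 * Real.pi, poisson t l • Complex.exp (Complex.I * (n : ℂ) * (t : ℂ)) =
      ((2 * Real.pi * l ^ n : ℝ) : ℂ) := by
  have hd : DiffContOnCl ℂ (fun z : ℂ => z ^ n) (Metric.ball 0 1) :=
    (differentiable_id.pow n).diffContOnCl
  have hw : (l : ℂ) ∈ Metric.ball (0 : ℂ) 1 := by
    rw [mem_ball_zero_iff, Complex.norm_real, Real.norm_eq_abs, abs_lt]; exact hl
  have h := hd.circleAverage_poissonKernel_smul' hw
  rw [Real.circleAverage_def, inv_smul_eq_iff₀ Real.two_pi_pos.ne'] at h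
  rw [show ((2 * Real.pi * l ^ n : ℝ) : ℂ) = (2 * Real.pi : ℝ) • ((l : ℂ) ^ n) by
    rw [Complex.real_smul]; push_cast; ring, ← h]
  refine intervalIntegral.integral_congr fun t _ => ?_
  simp only [circleMap, sub_zero, zero_add, Complex.ofReal_one, one_mul]
  congr 1
  · rw [poisson, Complex.norm_exp_ofReal_mul_I, Complex.norm_real, Real.norm_eq_abs, sq_abs, one_pow]
    congr 1
    rw [← Complex.normSq_eq_norm_sq, Complex.normSq_apply, Complex.exp_mul_I]
    simp only [Complex.sub_re, Complex.add_re, Complex.mul_re, Complex.I_re, Complex.I_im,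
      Complex.sub_im, Complex.add_im, Complex.mul_im, Complex.ofReal_re, Complex.ofReal_im,
      ← Complex.ofReal_cos, ← Complex.ofReal_sin]
    have := Real.sin_sq_add_cos_sq t
    nlinarith
  · rw [← Complex.exp_nat_mul]
    congr 1; ring

lemma integral_poisson_fourier {l : ℝ} (hl : l ∈ Set.Ioo (-1 : ℝ) 1) (n : ℤ) :
    ∫ t in (0 : ℝ)..2 * Real.pi, poisson t l • Complex.exp (Complex.I * (n : ℂ) * (t : ℂ)) =
      ((2 * Real.pi * l ^ n.natAbs : ℝ) : ℂ) := by
  obtain ⟨m, rfl | rfl⟩ := n.eq_nat_or_neg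
  · rw [Int.natAbs_natCast]
    exact_mod_cast integral_poisson_pow hl m
  · have h1 := congrArg (starRingEnd ℂ) (integral_poisson_pow hl m)
    rw [Complex.conj_ofReal] at h1
    rw [Int.natAbs_neg, Int.natAbs_natCast, ← h1,
      intervalIntegral.integral_of_le Real.two_pi_pos.le,
      intervalIntegral.integral_of_le Real.two_pi_pos.le, ← integral_conj]
    refine integral_congr_ae (Eventually.of_forall fun t => ?_)
    simp only [Complex.real_smul, map_mul, Complex.conj_ofReal, ← Complex.exp_conj, Complex.conj_I,
      Complex.conj_natCast]
    push_cast
    ring_nf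

lemma integral_poisson {l : ℝ} (hl : l ∈ Set.Ioo (-1 : ℝ) 1) :
    ∫ t in (0 : ℝ)..2 * Real.pi, poisson t l = 2 * Real.pi := by
  have h := integral_poisson_pow hl 0
  simp only [Nat.cast_zero, mul_zero, zero_mul, Complex.exp_zero, Complex.real_smul, mul_one,
    pow_zero] at h
  rw [intervalIntegral.integral_ofReal] at h
  exact_mod_cast h

variable {ν : Measure ℝ}

lemma ae_mem_Ioo_of_no_atoms (hs : ν (Set.Icc (-1) 1)ᶜ = 0) (h1 : ν {1} = 0) (h2 : ν {-1} = 0) :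
    ∀ᵐ l ∂ν, l ∈ Set.Ioo (-1 : ℝ) 1 := by
  have e1 : ∀ᵐ x ∂ν, x ∈ Set.Icc (-1 : ℝ) 1 := by rw [ae_iff]; exact hs
  have e2 : ∀ᵐ x ∂ν, x ≠ 1 := by rw [ae_iff]; simpa using h1
  have e3 : ∀ᵐ x ∂ν, x ≠ -1 := by rw [ae_iff]; simpa using h2
  filter_upwards [e1, e2, e3] with x a b c
  exact ⟨lt_of_le_of_ne a.1 (Ne.symm c), lt_of_le_of_ne a.2 b⟩

lemma density_eq (hν : ∀ᵐ l ∂ν, l ∈ Set.Ioo (-1 : ℝ) 1) (t : ℝ) :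
    density ν t = 1 / (2 * Real.pi) * ∫ l, poisson t l ∂ν := by
  have h : ∀ᵐ l ∂ν, l ∈ Set.Icc (-1 : ℝ) 1 := hν.mono fun l hl => ⟨hl.1.le, hl.2.le⟩
  rw [density, Measure.restrict_eq_self_of_ae_mem h]

lemma density_nonneg (hν : ∀ᵐ l ∂ν, l ∈ Set.Ioo (-1 : ℝ) 1) (t : ℝ) : 0 ≤ density ν t := by
  rw [density_eq hν]
  have := integral_nonneg_of_ae (hν.mono fun l hl => poisson_nonneg t hl)
  have := Real.pi_pos
  positivity

/-- The kernel is nonnegative with total mass 2π in t for every l, so integrating in t first needs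
only that ν is finite. -/
lemma integrable_poisson_prod [IsFiniteMeasure ν] (hν : ∀ᵐ l ∂ν, l ∈ Set.Ioo (-1 : ℝ) 1) :
    Integrable (fun p : ℝ × ℝ => poisson p.1 p.2)
      ((volume.restrict (Set.Icc 0 (2 * Real.pi))).prod ν) := by
  rw [integrable_prod_iff' measurable_poisson.aestronglyMeasurable]
  constructor
  · filter_upwards [hν] with l hl
    exact (continuous_poisson hl).integrableOn_Icc
  · refine (integrable_const (2 * Real.pi)).congr ?_
    filter_upwards [hν] with l hl
    rw [integral_Icc_eq_integral_Ioc, ← intervalIntegral.integral_of_le Real.two_pi_pos.le]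
    simp only [Real.norm_of_nonneg (poisson_nonneg _ hl)]
    exact (integral_poisson hl).symm

lemma integrableOn_density [IsFiniteMeasure ν] (hν : ∀ᵐ l ∂ν, l ∈ Set.Ioo (-1 : ℝ) 1) :
    IntegrableOn (density ν) (Set.Icc 0 (2 * Real.pi)) := by
  have := (integrable_poisson_prod hν).integral_prod_left.const_mul (1 / (2 * Real.pi))
  exact this.congr (Eventually.of_forall fun t => (density_eq hν t).symm)

/-- Fubini's theorem for integrals against the density. -/
lemma integral_density_smul [IsFiniteMeasure ν] (hν : ∀ᵐ l ∂ν, l ∈ Set.Ioo (-1 : ℝ) 1)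
    {E : Type*} [NormedAddCommGroup E] [NormedSpace ℝ E] [CompleteSpace E]
    {φ : ℝ → E} (hφ : StronglyMeasurable φ) {M : ℝ} (hM : ∀ t, ‖φ t‖ ≤ M) :
    ∫ t in Set.Icc 0 (2 * Real.pi), density ν t • φ t =
      (1 / (2 * Real.pi)) • ∫ l, (∫ t in Set.Icc 0 (2 * Real.pi), poisson t l • φ t) ∂ν := by
  have hI : Integrable (fun p : ℝ × ℝ => poisson p.1 p.2 • φ p.1)
      ((volume.restrict (Set.Icc 0 (2 * Real.pi))).prod ν) :=
    (integrable_poisson_prod hν).smul_bdd M (hφ.comp_measurable measurable_fst).aestronglyMeasurable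
      (Eventually.of_forall fun p => hM p.1)
  rw [← integral_integral_swap (f := fun t l => poisson t l • φ t) hI, ← integral_smul]
  refine integral_congr_ae (Eventually.of_forall fun t => ?_)
  simp only
  rw [integral_smul_const, density_eq hν, mul_smul]

end Poisson

/-! ### The spectral density and the distribution function -/

section SpectralDensity

variable {ν F : Measure ℝ}

lemma eq_withDensity_density [IsFiniteMeasure ν] [IsFiniteMeasure F]
    (hν : ∀ᵐ l ∂ν, l ∈ Set.Ioo (-1 : ℝ) 1) (hF : F (Set.Icc 0 (2 * Real.pi))ᶜ = 0)
    (h : ∀ n : ℤ, ((∫ l, l ^ n.natAbs ∂ν : ℝ) : ℂ) =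
      ∫ θ : ℝ, Complex.exp (Complex.I * (n : ℂ) * (θ : ℂ)) ∂F) :
    F = (volume.restrict (Set.Icc 0 (2 * Real.pi))).withDensity
      (fun t => ENNReal.ofReal (density ν t)) := by
  have hI := integrableOn_density hν
  have : IsFiniteMeasure ((volume.restrict (Set.Icc 0 (2 * Real.pi))).withDensity
      (fun t => ENNReal.ofReal (density ν t))) := isFiniteMeasure_withDensity_ofReal hI.2
  have hac := withDensity_absolutelyContinuous (volume.restrict (Set.Icc 0 (2 * Real.pi)))
    (fun t => ENNReal.ofReal (density ν t))
  refine measure_ext_of_fourier hF (hac ?_) (hac ?_) (hac ?_) fun n => ?_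
  · rw [Measure.restrict_apply measurableSet_Icc.compl]; simp
  · exact measure_singleton _
  · exact measure_singleton _
  · rw [← h n]
    have e1 : ∫ θ : ℝ, Complex.exp (Complex.I * (n : ℂ) * (θ : ℂ))
        ∂((volume.restrict (Set.Icc 0 (2 * Real.pi))).withDensity
          (fun t => ENNReal.ofReal (density ν t))) =
        ∫ θ in Set.Icc 0 (2 * Real.pi),
          density ν θ • Complex.exp (Complex.I * (n : ℂ) * (θ : ℂ)) := by
      rw [integral_withDensity_eq_integral_toReal_smul₀ hI.aemeasurable.ennreal_ofReal
        (Eventually.of_forall fun _ => ENNReal.ofReal_lt_top)]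
      simp only [ENNReal.toReal_ofReal (density_nonneg hν _)]
    rw [e1, integral_density_smul hν (M := 1) (by fun_prop)]
    · have e2 : ∀ᵐ l ∂ν, ∫ t in Set.Icc 0 (2 * Real.pi),
          poisson t l • Complex.exp (Complex.I * (n : ℂ) * (t : ℂ)) =
            ((2 * Real.pi * l ^ n.natAbs : ℝ) : ℂ) := by
        filter_upwards [hν] with l hl
        rw [← integral_poisson_fourier hl n, integral_Icc_eq_integral_Ioc,
          ← intervalIntegral.integral_of_le Real.two_pi_pos.le]
      rw [integral_congr_ae e2, integral_complex_ofReal, integral_const_mul, Complex.real_smul,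
        ← Complex.ofReal_mul]
      have := Real.pi_ne_zero
      congr 1
      field_simp
    · intro t
      rw [show Complex.I * (n : ℂ) * (t : ℂ) = ((n * t : ℝ) : ℂ) * Complex.I by push_cast; ring,
        Complex.norm_exp_ofReal_mul_I]

/-- The half-angle substitution gives this primitive, valid where tan(t/2) has no pole. The identity
behind it is (1-l)² cos²(t/2) + (1+l)² sin²(t/2) = 1 + l² - 2l cos t. -/
lemma hasDerivAt_arctan_tan {l : ℝ} (hl : l ∈ Set.Ioo (-1 : ℝ) 1) {t : ℝ}
    (ht : t ∈ Set.Ioo (-Real.pi) Real.pi) :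
    HasDerivAt (fun t => 2 * Real.arctan ((1 + l) / (1 - l) * Real.tan (t / 2))) (poisson t l) t := by
  have hc : 0 < Real.cos (t / 2) :=
    Real.cos_pos_of_mem_Ioo ⟨by linarith [ht.1], by linarith [ht.2]⟩
  have h1 : HasDerivAt (fun t : ℝ => t / 2) (1 / 2) t := (hasDerivAt_id t).div_const 2
  have h2 := (((Real.hasDerivAt_tan hc.ne').comp t h1).const_mul ((1 + l) / (1 - l))).arctan.const_mul 2
  refine h2.congr_deriv ?_
  have hl1 : 0 < 1 - l := by linarith [hl.2]
  have hD := poisson_denom_pos t hl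
  have ht2 : t = 2 * (t / 2) := by ring
  have hcos : Real.cos t = 2 * Real.cos (t / 2) ^ 2 - 1 := by
    conv_lhs => rw [ht2]
    exact Real.cos_two_mul _
  have hs := Real.sin_sq (t / 2)
  rw [hcos] at hD
  rw [poisson, hcos, Function.comp_apply, Real.tan_eq_sin_div_cos]
  set c := Real.cos (t / 2)
  set s := Real.sin (t / 2)
  have hE : (1 - l) ^ 2 * c ^ 2 + (1 + l) ^ 2 * s ^ 2 = 1 + l ^ 2 - 2 * l * (2 * c ^ 2 - 1) := by
    rw [hs]; ring
  have e : 1 + ((1 + l) / (1 - l) * (s / c)) ^ 2 =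
      (1 + l ^ 2 - 2 * l * (2 * c ^ 2 - 1)) / ((1 - l) ^ 2 * c ^ 2) := by
    rw [← hE]; field_simp
  rw [e]
  field_simp
  ring

lemma integral_poisson_zero_to {l : ℝ} (hl : l ∈ Set.Ioo (-1 : ℝ) 1) {x : ℝ}
    (hx : x ∈ Set.Ico 0 Real.pi) :
    ∫ t in (0 : ℝ)..x, poisson t l = 2 * Real.arctan ((1 + l) / (1 - l) * Real.tan (x / 2)) := by
  have hpi := Real.pi_pos
  rw [intervalIntegral.integral_eq_sub_of_hasDerivAt (fun t ht => hasDerivAt_arctan_tan hl ?_)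
    ((continuous_poisson hl).intervalIntegrable _ _)]
  · simp
  · rw [Set.uIcc_of_le hx.1] at ht
    exact ⟨by linarith [ht.1], by linarith [ht.2, hx.2]⟩

lemma distFun_eq_integral_arctan [IsFiniteMeasure ν] (hν : ∀ᵐ l ∂ν, l ∈ Set.Ioo (-1 : ℝ) 1)
    (hF : F = (volume.restrict (Set.Icc 0 (2 * Real.pi))).withDensity
      (fun t => ENNReal.ofReal (density ν t))) {x : ℝ} (hx : x ∈ Set.Ico 0 Real.pi) :
    distFun F x = 1 / Real.pi * ∫ l, Real.arctan ((1 + l) / (1 - l) * Real.tan (x / 2)) ∂ν := by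
  have hpi := Real.pi_pos
  have hI := integrableOn_density hν
  have hsub : Set.Icc 0 x ∩ Set.Icc 0 (2 * Real.pi) = Set.Icc 0 x :=
    Set.inter_eq_left.mpr (Set.Icc_subset_Icc_right (by linarith [hx.2]))
  have hsub' : Set.Icc 0 (2 * Real.pi) ∩ Set.Icc 0 x = Set.Icc 0 x := by
    rw [Set.inter_comm]; exact hsub
  have e1 : distFun F x = ∫ t in Set.Icc 0 x, density ν t := by
    rw [distFun, hF, measureReal_def, withDensity_apply _ measurableSet_Icc,
      Measure.restrict_restrict measurableSet_Icc, hsub,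
      integral_eq_lintegral_of_nonneg_ae (Eventually.of_forall fun t => density_nonneg hν t)]
    rw [← hsub']
    exact (hI.mono_set Set.inter_subset_left).aestronglyMeasurable
  -- The indicator of [0, x] serves as the bounded test function in `integral_density_smul`.
  have ind : ∀ f : ℝ → ℝ, ∫ t in Set.Icc 0 (2 * Real.pi),
      f t • (Set.Icc 0 x).indicator (fun _ => (1 : ℝ)) t = ∫ t in Set.Icc 0 x, f t := by
    intro f
    have : ∀ t, f t • (Set.Icc 0 x).indicator (fun _ => (1 : ℝ)) t = (Set.Icc 0 x).indicator f t := by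
      intro t; by_cases h : t ∈ Set.Icc 0 x <;> simp [h]
    simp only [this]
    rw [setIntegral_indicator measurableSet_Icc, hsub']
  rw [e1, ← ind, integral_density_smul hν (M := 1)
    (stronglyMeasurable_const.indicator measurableSet_Icc)]
  · simp only [ind]
    have e2 : ∀ᵐ l ∂ν, ∫ t in Set.Icc 0 x, poisson t l =
        2 * Real.arctan ((1 + l) / (1 - l) * Real.tan (x / 2)) := by
      filter_upwards [hν] with l hl
      rw [integral_Icc_eq_integral_Ioc, ← intervalIntegral.integral_of_le hx.1,
        integral_poisson_zero_to hl hx]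
    rw [integral_congr_ae e2, integral_const_mul, smul_eq_mul, ← mul_assoc]
    congr 1
    field_simp
  · intro t
    refine (norm_indicator_le_norm_self _ _).trans (by simp)

end SpectralDensity

/-! ### The variance as an integral against the spectral measure -/

section Variance

/-- The kernel of the representation of `Var S_n` as an integral against the transition spectral
measure. -/
noncomputable def varKernel (n : ℕ) (l : ℝ) : ℝ :=
  n * ((1 + l) / (1 - l)) - 2 * l * (1 - l ^ n) / (1 - l) ^ 2

lemma sum_pow_succ_eq {l : ℝ} (hl : l ≠ 1) (n : ℕ) :
    ∑ i ∈ Finset.Icc 1 n, l ^ (n + 1 - i) = l * (1 - l ^ n) / (1 - l) := by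
  have h : 1 - l ≠ 0 := sub_ne_zero.mpr hl.symm
  induction n with
  | zero => simp
  | succ n ih =>
    rw [Finset.sum_Icc_succ_top (by omega)]
    have : ∑ i ∈ Finset.Icc 1 n, l ^ (n + 1 + 1 - i) = l * ∑ i ∈ Finset.Icc 1 n, l ^ (n + 1 - i) := by
      rw [Finset.mul_sum]
      refine Finset.sum_congr rfl fun i hi => ?_
      rw [Finset.mem_Icc] at hi
      rw [← pow_succ']
      congr 1; omega
    rw [this, ih, show n + 1 + 1 - (n + 1) = 1 by omega]
    field_simp
    ring

/-- Passing from n to n + 1 adds a row, a column and a diagonal entry 1; row and column are the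
geometric sum of `sum_pow_succ_eq`. -/
lemma sum_pow_dist_eq_varKernel {l : ℝ} (hl : l ≠ 1) (n : ℕ) :
    ∑ i ∈ Finset.Icc 1 n, ∑ j ∈ Finset.Icc 1 n, l ^ ((i : ℤ) - (j : ℤ)).natAbs = varKernel n l := by
  have h : 1 - l ≠ 0 := sub_ne_zero.mpr hl.symm
  induction n with
  | zero => simp [varKernel]
  | succ n ih =>
    rw [Finset.sum_Icc_succ_top (by omega)]
    simp only [Finset.sum_Icc_succ_top (show 1 ≤ n + 1 by omega)]
    rw [Finset.sum_add_distrib, ih]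
    have e1 : ∑ i ∈ Finset.Icc 1 n, l ^ ((i : ℤ) - ((n + 1 : ℕ) : ℤ)).natAbs =
        l * (1 - l ^ n) / (1 - l) := by
      rw [← sum_pow_succ_eq hl]
      refine Finset.sum_congr rfl fun i hi => ?_
      rw [Finset.mem_Icc] at hi
      congr 1; omega
    have e2 : ∑ i ∈ Finset.Icc 1 n, l ^ (((n + 1 : ℕ) : ℤ) - (i : ℤ)).natAbs =
        l * (1 - l ^ n) / (1 - l) := by
      rw [← sum_pow_succ_eq hl]
      refine Finset.sum_congr rfl fun i hi => ?_
      rw [Finset.mem_Icc] at hi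
      congr 1; omega
    rw [e1, e2, sub_self, Int.natAbs_zero, varKernel, varKernel]
    push_cast
    field_simp
    ring

lemma variance_eq_integral_varKernel {Ω : Type*} [MeasurableSpace Ω] {P : Measure Ω}
    [IsProbabilityMeasure P] {X : ℤ → Ω → ℝ} (hX : ∀ i, MemLp (X i) 2 P) {ν : Measure ℝ}
    [IsFiniteMeasure ν] (hν : ∀ᵐ l ∂ν, l ∈ Set.Ioo (-1 : ℝ) 1)
    (h : ∀ i j, cov[X i, X j; P] = ∫ l, l ^ (i - j).natAbs ∂ν) (n : ℕ) :
    Var[partialSum X n; P] = ∫ l, varKernel n l ∂ν := by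
  have hS : partialSum X n = ∑ i ∈ Finset.Icc 1 n, X (i : ℤ) := by
    ext ω; simp [partialSum]
  have hI : ∀ m : ℕ, Integrable (fun l : ℝ => l ^ m) ν := fun m =>
    Integrable.of_bound (C := 1) (by fun_prop) (by
      filter_upwards [hν] with l hl
      rw [norm_pow]
      exact pow_le_one₀ (norm_nonneg _) (abs_le.mpr ⟨hl.1.le, hl.2.le⟩))
  rw [hS, variance_sum' (X := fun i : ℕ => X i) (fun i _ => hX i)]
  simp only [h]
  rw [← integral_congr_ae (hν.mono fun l hl => sum_pow_dist_eq_varKernel hl.2.ne n),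
    integral_finsetSum _ fun i _ => integrable_finsetSum _ fun j _ => hI _]
  exact Finset.sum_congr rfl fun i _ => (integral_finsetSum _ fun j _ => hI _).symm

end Variance

/-! ### Uniform convergence for slowly varying functions -/

section SlowVariation

/-- The uniform convergence theorem, in additive form. -/
lemma uniform_of_additive_slowly_varying {f : ℝ → ℝ} (hf : Continuous f)
    (h : ∀ u, Tendsto (fun x => f (x + u) - f x) atTop (𝓝 0)) {ε : ℝ} (hε : 0 < ε) :
    ∃ M, ∀ x ≥ M, ∀ u ∈ Set.Icc (0 : ℝ) 1, |f (x + u) - f x| ≤ 3 * ε := by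
  -- Baire category: these closed sets cover the line, so one of them contains a ball.
  let E : ℕ → Set ℝ := fun m => {u | ∀ x : ℝ, (m : ℝ) ≤ x → |f (x + u) - f x| ≤ ε}
  have hE : ∀ m, IsClosed (E m) := fun m => by
    have : E m = ⋂ x : ℝ, ⋂ _ : (m : ℝ) ≤ x, {u | |f (x + u) - f x| ≤ ε} := by
      ext u; simp [E]
    rw [this]
    exact isClosed_iInter fun x => isClosed_iInter fun _ =>
      isClosed_le (by fun_prop) continuous_const
  have hev : ∀ u, ∀ᶠ x in atTop, |f (x + u) - f x| ≤ ε := fun u => by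
    have := (h u).abs
    rw [abs_zero] at this
    exact this.eventually_le_const hε
  have hU : ⋃ m, E m = Set.univ := by
    refine Set.eq_univ_of_forall fun u => ?_
    obtain ⟨a, ha⟩ := eventually_atTop.mp (hev u)
    obtain ⟨m, hm⟩ := exists_nat_ge a
    exact Set.mem_iUnion.mpr ⟨m, fun x hx => ha x (hm.trans hx)⟩
  obtain ⟨m, a, ha⟩ := nonempty_interior_of_iUnion_of_closed hE hU
  obtain ⟨d, hd, hball⟩ := Metric.mem_nhds_iff.mp (mem_interior_iff_mem_nhds.mp ha)
  -- Both a and a + u lie in the ball; comparing them from the base point x - a costs ε each.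
  have hshort : ∀ x, m + a ≤ x → ∀ u, 0 ≤ u → u < d → |f (x + u) - f x| ≤ 2 * ε := by
    intro x hx u hu0 hud
    have e1 : a + u ∈ E m := hball (by
      rw [Metric.mem_ball, Real.dist_eq, add_sub_cancel_left, abs_of_nonneg hu0]; exact hud)
    have e2 : a ∈ E m := hball (Metric.mem_ball_self hd)
    have f1 := e1 (x - a) (by linarith)
    have f2 := e2 (x - a) (by linarith)
    rw [show x - a + (a + u) = x + u by ring] at f1
    rw [sub_add_cancel] at f2
    rw [abs_le] at *
    constructor <;> linarith [f1.1, f1.2, f2.1, f2.2]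
  obtain ⟨N, hN⟩ := exists_nat_gt (1 / (d / 2))
  -- The interval [0, 1] is reached by one of finitely many multiples of d/2, at cost ε, followed by
  -- one short step, at cost 2ε.
  have hfin : ∀ᶠ x in atTop, ∀ k ∈ Finset.range (N + 1), |f (x + k * (d / 2)) - f x| ≤ ε :=
    (Filter.eventually_all_finset _).mpr fun k _ => hev _
  obtain ⟨M₀, hM₀⟩ := eventually_atTop.mp hfin
  refine ⟨max M₀ (m + a), fun x hx u hu => ?_⟩
  have hd2 : 0 < d / 2 := by linarith
  set k := ⌊u / (d / 2)⌋₊ with hk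
  have hk1 : (k : ℝ) * (d / 2) ≤ u :=
    (le_div_iff₀ hd2).mp (Nat.floor_le (div_nonneg hu.1 hd2.le))
  have hk2 : u < (k + 1) * (d / 2) := (div_lt_iff₀ hd2).mp (Nat.lt_floor_add_one _)
  have hkN : k ∈ Finset.range (N + 1) := by
    rw [Finset.mem_range, Nat.lt_succ_iff]
    have : (k : ℝ) ≤ N := by
      refine le_trans (Nat.floor_le (div_nonneg hu.1 hd2.le)) (le_trans ?_ hN.le)
      gcongr; exact hu.2
    exact_mod_cast this
  have g1 := hM₀ x (le_trans (le_max_left _ _) hx) k hkN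
  have hkd : 0 ≤ (k : ℝ) * (d / 2) := by positivity
  have g2 := hshort (x + k * (d / 2)) (by linarith [le_trans (le_max_right M₀ (m + a)) hx])
    (u - k * (d / 2)) (by linarith) (by linarith)
  rw [show x + k * (d / 2) + (u - k * (d / 2)) = x + u by ring] at g2
  rw [abs_le] at *
  constructor <;> linarith [g1.1, g1.2, g2.1, g2.2]

/-- The ratio a/b may vary with i, so pointwise slow variation is not enough. The uniform
convergence theorem is applied to log ∘ h ∘ exp; a ratio in [1, 2] is a shift of at most log 2 < 1.
-/
lemma SlowlyVarying.tendsto_ratio {h : ℝ → ℝ} (hh : SlowlyVarying h) {ι : Type*} {L : Filter ι}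
    {a b : ι → ℝ} (hb : Tendsto b L atTop) (hab : ∀ᶠ i in L, b i ≤ a i ∧ a i ≤ 2 * b i) :
    Tendsto (fun i => h (a i) / h (b i)) L (𝓝 1) := by
  let f : ℝ → ℝ := fun x => Real.log (h (Real.exp x))
  have hf : Continuous f := by
    refine Continuous.log ?_ fun x => (hh.pos _ (Real.exp_pos x)).ne'
    exact hh.continuousOn.comp_continuous Real.continuous_exp fun x => Real.exp_pos x
  have hlim : ∀ u, Tendsto (fun x => f (x + u) - f x) atTop (𝓝 0) := fun u => by
    have h1 := ((hh.ratio _ (Real.exp_pos u)).comp Real.tendsto_exp_atTop).log one_ne_zero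
    rw [Real.log_one] at h1
    refine h1.congr fun x => ?_
    simp only [f, Function.comp_apply]
    rw [Real.log_div (hh.pos _ (by positivity)).ne' (hh.pos _ (Real.exp_pos x)).ne', Real.exp_add,
      mul_comm]
  have key : Tendsto (fun i => Real.log (h (a i)) - Real.log (h (b i))) L (𝓝 0) := by
    rw [Metric.tendsto_nhds]
    intro ε hε
    obtain ⟨M, hM⟩ := uniform_of_additive_slowly_varying hf hlim (ε := ε / 6) (by positivity)
    filter_upwards [hab, hb.eventually_ge_atTop (Real.exp M)] with i hi hbi
    have hb0 : 0 < b i := (Real.exp_pos M).trans_le hbi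
    have ha0 : 0 < a i := hb0.trans_le hi.1
    have := hM (Real.log (b i)) ((Real.le_log_iff_exp_le hb0).mpr hbi)
      (Real.log (a i) - Real.log (b i))
      ⟨sub_nonneg.mpr (Real.log_le_log hb0 hi.1), by
        have h2 := Real.log_le_log ha0 hi.2
        rw [Real.log_mul two_ne_zero hb0.ne'] at h2
        linarith [Real.log_two_lt_d9]⟩
    simp only [f, add_sub_cancel, Real.exp_log hb0, Real.exp_log ha0] at this
    rw [Real.dist_eq, sub_zero]
    linarith
  have hexp := (Real.continuous_exp.tendsto 0).comp key
  rw [Real.exp_zero] at hexp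
  refine hexp.congr' ?_
  filter_upwards [hab, hb.eventually_gt_atTop 0] with i hi hbi
  rw [Function.comp_apply, Real.exp_sub, Real.exp_log (hh.pos _ (hbi.trans_le hi.1)),
    Real.exp_log (hh.pos _ hbi)]

lemma SlowlyVarying.tendsto_ratio_floor {h : ℝ → ℝ} (hh : SlowlyVarying h) :
    Tendsto (fun t : ℝ => h t / h (⌊t⌋₊ : ℝ)) atTop (𝓝 1) := by
  refine hh.tendsto_ratio (b := fun t : ℝ => (⌊t⌋₊ : ℝ))
    (tendsto_natCast_atTop_atTop.comp tendsto_nat_floor_atTop) ?_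
  filter_upwards [eventually_ge_atTop 1] with t ht
  have h1 : (1 : ℝ) ≤ (⌊t⌋₊ : ℝ) := by exact_mod_cast Nat.one_le_floor_iff t |>.mpr ht
  have h2 := Nat.lt_floor_add_one t
  exact ⟨Nat.floor_le (by linarith), by linarith⟩

lemma SlowlyVarying.tendsto_ratio_nat_succ {h : ℝ → ℝ} (hh : SlowlyVarying h) :
    Tendsto (fun n : ℕ => h (n + 1) / h n) atTop (𝓝 1) := by
  refine hh.tendsto_ratio tendsto_natCast_atTop_atTop ?_
  filter_upwards [eventually_ge_atTop 1] with n hn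
  have : (1 : ℝ) ≤ n := by exact_mod_cast hn
  constructor <;> linarith

end SlowVariation

/-! ### Comparing two families of measures through moments -/

section Close

variable {ι : Type*} {L : Filter ι} {ρ ρ' : ι → Measure ℝ}

/-- The integrals of `Φ` against two families of measures are asymptotically equal. -/
structure Close (L : Filter ι) (ρ ρ' : ι → Measure ℝ) (Φ : ℝ → ℝ) : Prop where
  left : ∀ i, Integrable Φ (ρ i)
  right : ∀ i, Integrable Φ (ρ' i)
  lim : Tendsto (fun i => ∫ u, Φ u ∂(ρ i) - ∫ u, Φ u ∂(ρ' i)) L (𝓝 0)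

/-- The integrals of `G` against a family of measures are bounded along `L`. -/
structure MassBounded (L : Filter ι) (ρ : ι → Measure ℝ) (G : ℝ → ℝ) : Prop where
  int : ∀ i, Integrable G (ρ i)
  bdd : ∃ M : ℝ, ∀ᶠ i in L, ∫ u, G u ∂(ρ i) ≤ M

lemma Close.add {Φ Ψ : ℝ → ℝ} (h : Close L ρ ρ' Φ) (h' : Close L ρ ρ' Ψ) :
    Close L ρ ρ' (fun u => Φ u + Ψ u) := by
  refine ⟨fun i => (h.left i).add (h'.left i), fun i => (h.right i).add (h'.right i), ?_⟩
  have := h.lim.add h'.lim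
  rw [add_zero] at this
  refine this.congr fun i => ?_
  rw [integral_add (h.left i) (h'.left i), integral_add (h.right i) (h'.right i)]
  ring

lemma Close.const_mul {Φ : ℝ → ℝ} (h : Close L ρ ρ' Φ) (c : ℝ) :
    Close L ρ ρ' (fun u => c * Φ u) := by
  refine ⟨fun i => (h.left i).const_mul c, fun i => (h.right i).const_mul c, ?_⟩
  have := h.lim.const_mul c
  rw [mul_zero] at this
  refine this.congr fun i => ?_
  rw [integral_const_mul, integral_const_mul]
  ring

lemma Close.sum {κ : Type*} (s : Finset κ) {Φ : κ → ℝ → ℝ} (h : ∀ k ∈ s, Close L ρ ρ' (Φ k)) :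
    Close L ρ ρ' (fun u => ∑ k ∈ s, Φ k u) := by
  classical
  induction s using Finset.induction_on with
  | empty => exact ⟨fun i => by simp, fun i => by simp, by simp [tendsto_const_nhds]⟩
  | insert a s ha ih =>
    simp only [Finset.sum_insert ha]
    exact (h a (Finset.mem_insert_self _ _)).add
      (ih fun k hk => h k (Finset.mem_insert_of_mem hk))

lemma Close.congr (hρ : ∀ i, ∀ᵐ u ∂(ρ i), 0 < u) (hρ' : ∀ i, ∀ᵐ u ∂(ρ' i), 0 < u)
    {Φ Ψ : ℝ → ℝ} (h : Close L ρ ρ' Φ) (e : ∀ u, 0 < u → Φ u = Ψ u) : Close L ρ ρ' Ψ := by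
  have h1 : ∀ i, Φ =ᵐ[ρ i] Ψ := fun i => (hρ i).mono e
  have h2 : ∀ i, Φ =ᵐ[ρ' i] Ψ := fun i => (hρ' i).mono e
  refine ⟨fun i => (h.left i).congr (h1 i), fun i => (h.right i).congr (h2 i),
    h.lim.congr fun i => ?_⟩
  rw [integral_congr_ae (h1 i), integral_congr_ae (h2 i)]

lemma Close.of_tendsto {Φ : ℝ → ℝ} {θ : ℝ} (h1 : ∀ i, Integrable Φ (ρ i))
    (h2 : ∀ i, Integrable Φ (ρ' i)) (t1 : Tendsto (fun i => ∫ u, Φ u ∂(ρ i)) L (𝓝 θ))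
    (t2 : Tendsto (fun i => ∫ u, Φ u ∂(ρ' i)) L (𝓝 θ)) : Close L ρ ρ' Φ :=
  ⟨h1, h2, by simpa using t1.sub t2⟩

lemma MassBounded.of_tendsto {G : ℝ → ℝ} {θ : ℝ} (h1 : ∀ i, Integrable G (ρ i))
    (t1 : Tendsto (fun i => ∫ u, G u ∂(ρ i)) L (𝓝 θ)) : MassBounded L ρ G :=
  ⟨h1, θ + 1, t1.eventually_le_const (lt_add_one θ)⟩

lemma MassBounded.mono (hρ : ∀ i, ∀ᵐ u ∂(ρ i), 0 < u) {G H : ℝ → ℝ} (h : MassBounded L ρ H)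
    (hm : Measurable G) (hG : ∀ u, 0 < u → 0 ≤ G u) (hGH : ∀ u, 0 < u → G u ≤ H u) :
    MassBounded L ρ G := by
  have hi : ∀ i, Integrable G (ρ i) := fun i => (h.int i).mono' hm.aestronglyMeasurable
    ((hρ i).mono fun u hu => by rw [Real.norm_of_nonneg (hG u hu)]; exact hGH u hu)
  obtain ⟨M, hM⟩ := h.bdd
  exact ⟨hi, M, hM.mono fun i h' => (integral_mono_ae (hi i) (h.int i) ((hρ i).mono hGH)).trans h'⟩

/-- Approximation, relative to a weight `G` of bounded mass. -/
lemma Close.of_approx (hρ : ∀ i, ∀ᵐ u ∂(ρ i), 0 < u) (hρ' : ∀ i, ∀ᵐ u ∂(ρ' i), 0 < u)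
    {G : ℝ → ℝ} (hG : MassBounded L ρ G) (hG' : MassBounded L ρ' G)
    {Φ : ℝ → ℝ} (hm : Measurable Φ)
    (happ : ∀ ε > 0, ∃ Ψ, Close L ρ ρ' Ψ ∧ ∀ u, 0 < u → |Φ u - Ψ u| ≤ ε * G u) :
    Close L ρ ρ' Φ := by
  have hint : ∀ (μ : Measure ℝ) (Ψ : ℝ → ℝ) (ε : ℝ), (∀ᵐ u ∂μ, 0 < u) → Integrable G μ →
      Integrable Ψ μ → (∀ u, 0 < u → |Φ u - Ψ u| ≤ ε * G u) →
      Integrable Φ μ ∧ |∫ u, Φ u ∂μ - ∫ u, Ψ u ∂μ| ≤ ε * ∫ u, G u ∂μ := by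
    intro μ Ψ ε hμ hGμ hΨ hb
    have h1 : Integrable (fun u => Φ u - Ψ u) μ :=
      (hGμ.const_mul ε).mono' (hm.aestronglyMeasurable.sub hΨ.aestronglyMeasurable)
        (hμ.mono fun u hu => hb u hu)
    have h2 : Integrable Φ μ := (h1.add hΨ).congr (Eventually.of_forall fun u => by simp)
    refine ⟨h2, ?_⟩
    rw [← integral_sub h2 hΨ, ← integral_const_mul]
    exact norm_integral_le_of_norm_le (f := fun u => Φ u - Ψ u) (hGμ.const_mul ε)
      (hμ.mono fun u hu => hb u hu)
  -- One approximant with any fixed accuracy settles integrability.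
  obtain ⟨Ψ₁, c1, b1⟩ := happ 1 one_pos
  obtain ⟨M, hM⟩ := hG.bdd
  obtain ⟨M', hM'⟩ := hG'.bdd
  refine ⟨fun i => (hint _ _ _ (hρ i) (hG.int i) (c1.left i) b1).1,
    fun i => (hint _ _ _ (hρ' i) (hG'.int i) (c1.right i) b1).1, ?_⟩
  rw [Metric.tendsto_nhds]
  intro ε hε
  -- The summand 1 makes B positive and strictly larger than the two mass bounds together.
  set B := |M| + |M'| + 1 with hB
  have hBpos : 0 < B := by positivity
  obtain ⟨Ψ, c, b⟩ := happ (ε / (2 * B)) (by positivity)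
  have hlim := (Metric.tendsto_nhds.mp c.lim) (ε / 2) (by positivity)
  filter_upwards [hlim, hM, hM'] with i h1 h2 h3
  have k1 := (hint _ _ _ (hρ i) (hG.int i) (c.left i) b).2
  have k2 := (hint _ _ _ (hρ' i) (hG'.int i) (c.right i) b).2
  rw [Real.dist_eq, sub_zero] at h1 ⊢
  have k3 : ε / (2 * B) * ∫ u, G u ∂(ρ i) ≤ ε / (2 * B) * |M| :=
    mul_le_mul_of_nonneg_left (h2.trans (le_abs_self M)) (by positivity)
  have k4 : ε / (2 * B) * ∫ u, G u ∂(ρ' i) ≤ ε / (2 * B) * |M'| :=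
    mul_le_mul_of_nonneg_left (h3.trans (le_abs_self M')) (by positivity)
  have k5 : ε / (2 * B) * |M| + ε / (2 * B) * |M'| < ε / 2 := by
    rw [← mul_add, div_mul_eq_mul_div, div_lt_iff₀ (by positivity)]
    have : |M| + |M'| < B := by rw [hB]; linarith
    nlinarith
  rw [abs_lt] at h1 ⊢
  rw [abs_le] at k1 k2
  constructor <;> linarith [k1.1, k1.2, k2.1, k2.2, h1.1, h1.2]

/-- Weierstrass' theorem for moments: convergence of the moments of `w` relative to the weight `G`
implies convergence for all functions of `w` that are continuous on `[0, 1]`. -/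
lemma Close.of_moments (hρ : ∀ i, ∀ᵐ u ∂(ρ i), 0 < u) (hρ' : ∀ i, ∀ᵐ u ∂(ρ' i), 0 < u)
    {G w : ℝ → ℝ} (hG : MassBounded L ρ G) (hG' : MassBounded L ρ' G)
    (hG0 : ∀ u, 0 < u → 0 ≤ G u) (hw : ∀ u, 0 < u → w u ∈ Set.Icc (0 : ℝ) 1)
    (hmom : ∀ k : ℕ, Close L ρ ρ' (fun u => G u * w u ^ k))
    {Φ ψ : ℝ → ℝ} (hm : Measurable Φ) (hψ : ContinuousOn ψ (Set.Icc 0 1))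
    (hΦ : ∀ u, 0 < u → Φ u = G u * ψ (w u)) : Close L ρ ρ' Φ := by
  refine Close.of_approx hρ hρ' hG hG' hm fun ε hε => ?_
  obtain ⟨p, hp⟩ := exists_polynomial_near_of_continuousOn 0 1 ψ hψ ε hε
  refine ⟨fun u => ∑ k ∈ Finset.range (p.natDegree + 1), p.coeff k * (G u * w u ^ k),
    Close.sum _ fun k _ => (hmom k).const_mul _, fun u hu => ?_⟩
  have : ∑ k ∈ Finset.range (p.natDegree + 1), p.coeff k * (G u * w u ^ k) =
      G u * p.eval (w u) := by
    rw [Polynomial.eval_eq_sum_range, Finset.mul_sum]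
    exact Finset.sum_congr rfl fun k _ => by ring
  simp only [this]
  rw [hΦ u hu, ← mul_sub, abs_mul, abs_of_nonneg (hG0 u hu), mul_comm, abs_sub_comm]
  exact mul_le_mul_of_nonneg_right (hp _ (hw u hu)).le (hG0 u hu)

/-- The same for a function whose quotient by the weight has limits at the two ends. -/
lemma Close.of_moments_of_limits (hρ : ∀ i, ∀ᵐ u ∂(ρ i), 0 < u) (hρ' : ∀ i, ∀ᵐ u ∂(ρ' i), 0 < u)
    {G w v : ℝ → ℝ} (hG : MassBounded L ρ G) (hG' : MassBounded L ρ' G)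
    (hG0 : ∀ u, 0 < u → 0 < G u) (hw : ∀ u, 0 < u → w u ∈ Set.Ioo (0 : ℝ) 1)
    (hmom : ∀ k : ℕ, Close L ρ ρ' (fun u => G u * w u ^ k))
    (hvw : ∀ u, 0 < u → v (w u) = u) (hv : ContinuousOn v (Set.Ioo 0 1))
    (hv0 : Tendsto v (𝓝[>] 0) atTop) (hv1 : Tendsto v (𝓝[<] 1) (𝓝[>] 0))
    (hvpos : ∀ z ∈ Set.Ioo (0 : ℝ) 1, 0 < v z)
    {Φ : ℝ → ℝ} (hm : Measurable Φ)
    (hΦc : ContinuousOn (fun u => Φ u / G u) (Set.Ioi 0)) {a b : ℝ}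
    (ha : Tendsto (fun u => Φ u / G u) (𝓝[>] 0) (𝓝 a))
    (hb : Tendsto (fun u => Φ u / G u) atTop (𝓝 b)) : Close L ρ ρ' Φ := by
  -- In the variable z = w(u) the quotient is continuous on (0, 1) and extends to [0, 1] by its
  -- limits. The orientation is reversed: z → 0 is u → ∞.
  have hc : ContinuousOn ((fun u => Φ u / G u) ∘ v) (Set.Ioo 0 1) :=
    hΦc.comp hv fun z hz => hvpos z hz
  have hE := continuousOn_Icc_extendFrom_Ioo hc (hb.comp hv0) (ha.comp hv1)
  refine Close.of_moments hρ hρ' hG hG' (fun u hu => (hG0 u hu).le)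
    (fun u hu => Set.Ioo_subset_Icc_self (hw u hu)) hmom hm hE fun u hu => ?_
  rw [extendFrom_extends hc _ (hw u hu), Function.comp_apply, hvw u hu,
    mul_div_cancel₀ _ (hG0 u hu).ne']

end Close

/-! ### The limiting kernels and their behaviour at 0 and infinity -/

section Kernels

/-- The scaling limit of the variance kernel. -/
noncomputable def expKernel (s u : ℝ) : ℝ := 2 * (Real.exp (-(s * u)) - 1 + s * u) / u ^ 2

/-- The weight produced by second differences of `expKernel`. -/
noncomputable def expWeight (u : ℝ) : ℝ := 2 * (1 - Real.exp (-u)) ^ 2 / u ^ 2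

lemma measurable_expKernel (s : ℝ) : Measurable (expKernel s) := by
  unfold expKernel; fun_prop

lemma measurable_expWeight : Measurable expWeight := by
  unfold expWeight; fun_prop

lemma expKernel_nonneg (s u : ℝ) : 0 ≤ expKernel s u := by
  have := Real.add_one_le_exp (-(s * u))
  unfold expKernel
  have : 0 ≤ Real.exp (-(s * u)) - 1 + s * u := by linarith
  positivity

/-- The second difference in k removes the affine part of the numerator and leaves e^{-ku}(1 -
e^{-u})². Integer values of the parameter thus suffice to produce all moments of e^{-u}. -/
lemma expKernel_second_difference (k : ℕ) (u : ℝ) :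
    expKernel ((k + 2 : ℕ) : ℝ) u + (-2) * expKernel ((k + 1 : ℕ) : ℝ) u + expKernel (k : ℝ) u =
      expWeight u * Real.exp (-u) ^ k := by
  have h : ∀ m : ℕ, Real.exp (-((m : ℝ) * u)) = Real.exp (-u) ^ m := fun m => by
    rw [← Real.exp_nat_mul]; congr 1; ring
  simp only [expKernel, expWeight, h]
  push_cast
  ring

lemma expWeight_pos {u : ℝ} (hu : 0 < u) : 0 < expWeight u := by
  have : Real.exp (-u) < 1 := by rw [Real.exp_lt_one_iff]; linarith
  have : 0 < 1 - Real.exp (-u) := by linarith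
  unfold expWeight
  positivity

/-- The case k = 0 of the second difference, with the nonnegative middle term dropped. -/
lemma expWeight_le (u : ℝ) : expWeight u ≤ expKernel 2 u := by
  have h := expKernel_second_difference 0 u
  have h0 : expKernel ((0 : ℕ) : ℝ) u = 0 := by simp [expKernel]
  rw [h0, pow_zero, mul_one] at h
  rw [← h]
  have := expKernel_nonneg ((0 + 1 : ℕ) : ℝ) u
  have e : ((0 + 2 : ℕ) : ℝ) = 2 := by norm_num
  rw [e]
  linarith

/-- The cubic term is kept because the slope of `expKernel 1` at 0 depends on it. -/
lemma abs_exp_neg_taylor_le {u : ℝ} (h0 : 0 ≤ u) (h1 : u ≤ 1) :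
    |Real.exp (-u) - 1 + u - u ^ 2 / 2 + u ^ 3 / 6| ≤ u ^ 4 := by
  have h := Real.exp_bound (x := -u) (by rw [abs_neg, abs_of_nonneg h0]; exact h1) (n := 4)
    (by norm_num)
  simp only [Finset.sum_range_succ, Finset.sum_range_zero, Nat.factorial] at h
  rw [abs_neg, abs_of_nonneg h0] at h
  have h4 : 0 ≤ u ^ 4 := by positivity
  norm_num at h
  have e : Real.exp (-u) - 1 + u - u ^ 2 / 2 + u ^ 3 / 6 =
      Real.exp (-u) - (1 + -u + u ^ 2 / 2 + (-u) ^ 3 / 6) := by ring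
  rw [e]
  refine h.trans ?_
  linarith

/-- Mean value theorem: the derivative u/(x² + u²) of x ↦ arctan(x/u) decreases for x ≥ 0. -/
lemma arctan_sub_bounds {s s' : ℝ} (hs : 0 ≤ s) (h : s < s') {u : ℝ} (hu : 0 < u) :
    (s' - s) * (u / (s' ^ 2 + u ^ 2)) ≤ Real.arctan (s' / u) - Real.arctan (s / u) ∧
    Real.arctan (s' / u) - Real.arctan (s / u) ≤ (s' - s) * (u / (s ^ 2 + u ^ 2)) := by
  have hd : ∀ x : ℝ, HasDerivAt (fun x => Real.arctan (x / u)) (u / (x ^ 2 + u ^ 2)) x := by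
    intro x
    have := ((hasDerivAt_id x).div_const u).arctan
    refine this.congr_deriv ?_
    simp only [id]
    field_simp
    rw [add_comm]
  obtain ⟨c, hc, e⟩ := exists_hasDerivAt_eq_slope (fun x => Real.arctan (x / u)) _ h
    (fun x _ => (hd x).continuousAt.continuousWithinAt) fun x _ => hd x
  have hpos : 0 < s' - s := by linarith
  rw [eq_div_iff hpos.ne'] at e
  rw [← e, mul_comm _ (s' - s)]
  have hc0 : 0 < c := hs.trans_lt hc.1
  constructor
  · refine mul_le_mul_of_nonneg_left ?_ hpos.le
    have : c ≤ s' := hc.2.le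
    gcongr
  · refine mul_le_mul_of_nonneg_left ?_ hpos.le
    have : s ≤ c := hc.1.le
    gcongr

lemma arctan_bounds {t : ℝ} (ht : 0 < t) :
    t / (1 + t ^ 2) ≤ Real.arctan t ∧ Real.arctan t ≤ t := by
  have h := arctan_sub_bounds le_rfl ht one_pos
  simp only [div_one, Real.arctan_zero, sub_zero, one_pow] at h
  refine ⟨le_trans (le_of_eq ?_) h.1, h.2.trans (le_of_eq ?_)⟩
  · rw [add_comm]; ring
  · norm_num

lemma tendsto_expKernel_one_zero : Tendsto (expKernel 1) (𝓝[>] 0) (𝓝 1) := by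
  have hb : ∀ᶠ u : ℝ in 𝓝[>] 0, |expKernel 1 u - 1| ≤ 3 * u := by
    filter_upwards [Ioo_mem_nhdsGT one_pos] with u hu
    have h := abs_exp_neg_taylor_le hu.1.le hu.2.le
    have hu2 : 0 < u ^ 2 := pow_pos hu.1 2
    have hne : u ≠ 0 := hu.1.ne'
    have e : expKernel 1 u - 1 =
        2 * (Real.exp (-u) - 1 + u - u ^ 2 / 2 + u ^ 3 / 6) / u ^ 2 - u / 3 := by
      rw [expKernel, one_mul]; field_simp; ring
    rw [e]
    have h2 : |2 * (Real.exp (-u) - 1 + u - u ^ 2 / 2 + u ^ 3 / 6) / u ^ 2| ≤ 2 * u ^ 2 := by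
      rw [abs_div, abs_of_pos hu2, div_le_iff₀ hu2, abs_mul, abs_two]
      nlinarith
    rw [abs_le] at h2 ⊢
    have := hu.1
    have := hu.2
    constructor <;> nlinarith [h2.1, h2.2]
  rw [tendsto_iff_norm_sub_tendsto_zero]
  refine squeeze_zero' (Eventually.of_forall fun _ => norm_nonneg _) hb ?_
  have : Tendsto (fun u : ℝ => 3 * u) (𝓝 0) (𝓝 (3 * 0)) := tendsto_id.const_mul 3
  rw [mul_zero] at this
  exact this.mono_left nhdsWithin_le_nhds

lemma tendsto_slope_expKernel_one_zero :
    Tendsto (fun u => (expKernel 1 u - 1) / u) (𝓝[>] 0) (𝓝 (-(1 / 3))) := by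
  have hb : ∀ᶠ u : ℝ in 𝓝[>] 0, |(expKernel 1 u - 1) / u - -(1 / 3)| ≤ 2 * u := by
    filter_upwards [Ioo_mem_nhdsGT one_pos] with u hu
    have h := abs_exp_neg_taylor_le hu.1.le hu.2.le
    have hu0 := hu.1
    have hu3 : 0 < u ^ 3 := pow_pos hu.1 3
    have e : (expKernel 1 u - 1) / u - -(1 / 3) =
        2 * (Real.exp (-u) - 1 + u - u ^ 2 / 2 + u ^ 3 / 6) / u ^ 3 := by
      rw [expKernel, one_mul]; field_simp; ring
    rw [e, abs_div, abs_of_pos hu3, div_le_iff₀ hu3, abs_mul, abs_two]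
    nlinarith
  rw [tendsto_iff_norm_sub_tendsto_zero]
  refine squeeze_zero' (Eventually.of_forall fun _ => norm_nonneg _) hb ?_
  have : Tendsto (fun u : ℝ => 2 * u) (𝓝 0) (𝓝 (2 * 0)) := tendsto_id.const_mul 2
  rw [mul_zero] at this
  exact this.mono_left nhdsWithin_le_nhds

lemma tendsto_one_sub_exp_neg_div : Tendsto (fun u => (1 - Real.exp (-u)) / u) (𝓝[>] 0) (𝓝 1) := by
  have h := tendsto_expKernel_one_zero
  have h2 : Tendsto (fun u : ℝ => 1 - u / 2 * expKernel 1 u) (𝓝[>] 0) (𝓝 (1 - 0 / 2 * 1)) :=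
    (((tendsto_id.mono_left nhdsWithin_le_nhds).div_const 2).mul h).const_sub 1
  rw [zero_div, zero_mul, sub_zero] at h2
  refine h2.congr' ?_
  filter_upwards [self_mem_nhdsWithin] with u hu
  have : (0 : ℝ) < u := hu
  rw [expKernel, one_mul]; field_simp; ring

lemma tendsto_exp_neg_atTop : Tendsto (fun u : ℝ => Real.exp (-u)) atTop (𝓝 0) :=
  Real.tendsto_exp_atBot.comp tendsto_neg_atTop_atBot

lemma tendsto_mul_arctan_inv : Tendsto (fun u : ℝ => u * Real.arctan (1 / u)) atTop (𝓝 1) := by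
  have h1 : Tendsto (fun u : ℝ => 1 / (1 + (1 / u) ^ 2)) atTop (𝓝 (1 / (1 + 0 ^ 2))) := by
    refine Tendsto.div tendsto_const_nhds ?_ (by norm_num)
    exact ((tendsto_const_nhds.div_atTop tendsto_id).pow 2).const_add 1
  rw [show (1 : ℝ) / (1 + 0 ^ 2) = 1 by norm_num] at h1
  refine tendsto_of_tendsto_of_tendsto_of_le_of_le' h1 tendsto_const_nhds ?_ ?_
  · filter_upwards [eventually_gt_atTop 0] with u hu
    have h := (arctan_bounds (one_div_pos.mpr hu)).1
    calc 1 / (1 + (1 / u) ^ 2) = u * (1 / u / (1 + (1 / u) ^ 2)) := by field_simp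
      _ ≤ _ := mul_le_mul_of_nonneg_left h hu.le
  · filter_upwards [eventually_gt_atTop 0] with u hu
    calc u * Real.arctan (1 / u) ≤ u * (1 / u) :=
          mul_le_mul_of_nonneg_left (arctan_bounds (one_div_pos.mpr hu)).2 hu.le
      _ = 1 := by field_simp

lemma tendsto_sq_mul_arctan_inv_sub :
    Tendsto (fun u : ℝ => u ^ 2 * Real.arctan (1 / u) - u) atTop (𝓝 0) := by
  have h1 : Tendsto (fun u : ℝ => -(1 / u)) atTop (𝓝 (-0)) :=
    (tendsto_const_nhds.div_atTop tendsto_id).neg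
  rw [neg_zero] at h1
  refine tendsto_of_tendsto_of_tendsto_of_le_of_le' h1 tendsto_const_nhds ?_ ?_
  · filter_upwards [eventually_gt_atTop 0] with u hu
    have h := mul_le_mul_of_nonneg_left (arctan_bounds (one_div_pos.mpr hu)).1 (sq_nonneg u)
    have e : u ^ 2 * (1 / u / (1 + (1 / u) ^ 2)) = u - u / (u ^ 2 + 1) := by
      field_simp; ring
    have e2 : u / (u ^ 2 + 1) ≤ 1 / u := by
      rw [div_le_div_iff₀ (by positivity) hu]; nlinarith
    linarith
  · filter_upwards [eventually_gt_atTop 0] with u hu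
    have h := mul_le_mul_of_nonneg_left (arctan_bounds (one_div_pos.mpr hu)).2 (sq_nonneg u)
    have e : u ^ 2 * (1 / u) = u := by field_simp
    linarith

lemma tendsto_arctan_inv_zero : Tendsto (fun u : ℝ => Real.arctan (1 / u)) (𝓝[>] 0)
    (𝓝 (Real.pi / 2)) := by
  have := (Real.tendsto_arctan_atTop.mono_right nhdsWithin_le_nhds).comp tendsto_inv_nhdsGT_zero
  simpa [Function.comp_def] using this

lemma tendsto_arctan_div_zero : Tendsto (fun u : ℝ => Real.arctan u / u) (𝓝[>] 0) (𝓝 1) := by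
  have h := tendsto_mul_arctan_inv.comp tendsto_inv_nhdsGT_zero
  refine h.congr fun u => ?_
  simp only [Function.comp_apply, one_div, inv_inv]
  rw [mul_comm, div_eq_mul_inv]

end Kernels

/-! ### From the variance functionals to the spectral functional -/

section Tauberian

variable {ι : Type*} {L : Filter ι} {ρ ρ' : ι → Measure ℝ}

/-- Convergence of the variance functionals determines the spectral functional. -/
lemma close_arctan_of_expKernel (hρ : ∀ i, ∀ᵐ u ∂(ρ i), 0 < u) (hρ' : ∀ i, ∀ᵐ u ∂(ρ' i), 0 < u)
    {θ : ℕ → ℝ}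
    (hi : ∀ (k : ℕ) i, Integrable (expKernel k) (ρ i))
    (hi' : ∀ (k : ℕ) i, Integrable (expKernel k) (ρ' i))
    (ht : ∀ k : ℕ, Tendsto (fun i => ∫ u, expKernel k u ∂(ρ i)) L (𝓝 (θ k)))
    (ht' : ∀ k : ℕ, Tendsto (fun i => ∫ u, expKernel k u ∂(ρ' i)) L (𝓝 (θ k))) :
    Close L ρ ρ' (fun u => Real.arctan (1 / u)) := by
  have hK : ∀ k : ℕ, Close L ρ ρ' (expKernel k) := fun k =>
    Close.of_tendsto (hi k) (hi' k) (ht k) (ht' k)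
  have hmass : ∀ u, 0 < u → expWeight u ≤ expKernel ((2 : ℕ) : ℝ) u := fun u _ => by
    exact_mod_cast expWeight_le u
  have hG : MassBounded L ρ expWeight := MassBounded.mono hρ
    (MassBounded.of_tendsto (hi 2) (ht 2)) measurable_expWeight
    (fun u hu => (expWeight_pos hu).le) hmass
  have hG' : MassBounded L ρ' expWeight := MassBounded.mono hρ'
    (MassBounded.of_tendsto (hi' 2) (ht' 2)) measurable_expWeight
    (fun u hu => (expWeight_pos hu).le) hmass
  have hmom : ∀ k : ℕ, Close L ρ ρ' (fun u => expWeight u * Real.exp (-u) ^ k) := fun k =>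
    (((hK (k + 2)).add ((hK (k + 1)).const_mul (-2))).add (hK k)).congr hρ hρ'
      fun u _ => expKernel_second_difference k u
  -- At infinity arctan(1/u) decays like 1/u but the weight like 2/u². Half of `expKernel 1`,
  -- already known to be close, has the same leading term, and the remainder is of order 1/u².
  have hrest : Close L ρ ρ' (fun u => Real.arctan (1 / u) - expKernel 1 u / 2) := by
    have hm : Measurable (fun u => Real.arctan (1 / u) - expKernel 1 u / 2) := by
      have := measurable_expKernel 1
      fun_prop
    refine Close.of_moments_of_limits (v := fun z => -Real.log z) (a := (Real.pi / 2 - 1 / 2) / 2)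
      (b := 1 / 2) hρ hρ' hG hG'
      (fun u hu => expWeight_pos hu) (fun u hu => ⟨Real.exp_pos _, ?_⟩) hmom
      (fun u _ => by simp) ?_ ?_ ?_ ?_ hm ?_ ?_ ?_
    · rw [Real.exp_lt_one_iff]; linarith
    · exact (Real.continuousOn_log.mono fun z hz => ne_of_gt hz.1).neg
    · exact tendsto_neg_atBot_atTop.comp Real.tendsto_log_nhdsGT_zero
    · refine tendsto_nhdsWithin_iff.mpr ⟨?_, ?_⟩
      · have : Tendsto (fun z => -Real.log z) (𝓝 1) (𝓝 (-Real.log 1)) :=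
          (Real.continuousAt_log one_ne_zero).tendsto.neg
        rw [Real.log_one, neg_zero] at this
        exact this.mono_left nhdsWithin_le_nhds
      · filter_upwards [Ioo_mem_nhdsLT one_pos] with z hz
        exact neg_pos.mpr (Real.log_neg hz.1 hz.2)
    · exact fun z hz => neg_pos.mpr (Real.log_neg hz.1 hz.2)
    · refine ContinuousOn.div ?_ ?_ fun u hu => (expWeight_pos hu).ne'
      · refine ContinuousOn.sub ?_ (ContinuousOn.div_const ?_ 2)
        · exact Real.continuous_arctan.comp_continuousOn
            (continuousOn_const.div continuousOn_id fun u hu => ne_of_gt hu)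
        · unfold expKernel
          exact ContinuousOn.div (by fun_prop) (by fun_prop) fun u hu => (pow_pos hu 2).ne'
      · unfold expWeight
        exact ContinuousOn.div (by fun_prop) (by fun_prop) fun u hu => (pow_pos hu 2).ne'
    · refine Tendsto.div (tendsto_arctan_inv_zero.sub (tendsto_expKernel_one_zero.div_const 2)) ?_
        two_ne_zero
      have := (tendsto_one_sub_exp_neg_div.pow 2).const_mul 2
      rw [one_pow, mul_one] at this
      refine this.congr fun u => ?_
      rw [expWeight, div_pow, mul_div_assoc]
    · have h1 : Tendsto (fun u : ℝ => (u ^ 2 * Real.arctan (1 / u) - u + (1 - Real.exp (-u))) /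
          (2 * (1 - Real.exp (-u)) ^ 2)) atTop (𝓝 ((0 + (1 - 0)) / (2 * (1 - 0) ^ 2))) := by
        refine Tendsto.div (tendsto_sq_mul_arctan_inv_sub.add (tendsto_exp_neg_atTop.const_sub 1))
          (((tendsto_exp_neg_atTop.const_sub 1).pow 2).const_mul 2) (by norm_num)
      rw [show ((0 : ℝ) + (1 - 0)) / (2 * (1 - 0) ^ 2) = 1 / 2 by norm_num] at h1
      refine h1.congr' ?_
      filter_upwards [eventually_gt_atTop 0] with u hu
      have hne : 1 - Real.exp (-u) ≠ 0 := by
        have : Real.exp (-u) < 1 := by rw [Real.exp_lt_one_iff]; linarith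
        linarith
      rw [expKernel, expWeight, one_mul]
      field_simp
      ring
  have h1 : Close L ρ ρ' (expKernel 1) := by exact_mod_cast hK 1
  exact (hrest.add (h1.const_mul (1 / 2))).congr hρ hρ' fun u _ => by ring

end Tauberian

/-! ### From the spectral functionals to the variance functional -/

section MonotoneDensity

/-- If `a` is squeezed between the difference quotients of functions converging to a
differentiable function, then it converges to the derivative. -/
lemma tendsto_of_secant_bounds {ι : Type*} {L : Filter ι} {f : ι → ℝ → ℝ} {θ : ℝ → ℝ} {s θ' : ℝ}
    (hs : 0 < s) (hf : ∀ x > 0, Tendsto (fun i => f i x) L (𝓝 (θ x))) (hθ : HasDerivAt θ θ' s)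
    {a : ι → ℝ} (hup : ∀ i, ∀ x > 0, x < s → (s - x) * a i ≤ f i s - f i x)
    (hlow : ∀ i, ∀ x, s < x → f i x - f i s ≤ (x - s) * a i) :
    Tendsto a L (𝓝 θ') := by
  have hsl := hasDerivAt_iff_tendsto_slope.mp hθ
  have hq : ∀ x > 0, Tendsto (fun i => slope (f i) s x) L (𝓝 (slope θ s x)) := fun x hx => by
    simp only [slope_def_field]
    exact ((hf x hx).sub (hf s hs)).div_const _
  rw [tendsto_order]
  constructor
  · intro c hc
    have h1 : ∀ᶠ x in 𝓝[>] s, c < slope θ s x :=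
      (hsl.mono_left (nhdsWithin_mono _ fun x hx => ne_of_gt hx)).eventually_const_lt hc
    obtain ⟨x, hx, hxs⟩ := (h1.and self_mem_nhdsWithin).exists
    have hxs' : s < x := hxs
    filter_upwards [(hq x (hs.trans hxs')).eventually_const_lt hx] with i hi
    refine hi.trans_le ?_
    rw [slope_def_field, div_le_iff₀ (by linarith), mul_comm]
    exact hlow i x hxs'
  · intro c hc
    have h1 : ∀ᶠ x in 𝓝[<] s, slope θ s x < c :=
      (hsl.mono_left (nhdsWithin_mono _ fun x hx => ne_of_lt hx)).eventually_lt_const hc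
    obtain ⟨x, hx, hxs⟩ := (h1.and (Ioo_mem_nhdsLT hs)).exists
    filter_upwards [(hq x hxs.1).eventually_lt_const hx] with i hi
    refine lt_of_le_of_lt ?_ hi
    have := hup i x hxs.1 hxs.2
    have hsx : 0 < s - x := by linarith [hxs.2]
    rw [slope_comm, slope_def_field, le_div_iff₀ hsx, mul_comm]
    exact this

variable {ι : Type*} {L : Filter ι} {ρ ρ' : ι → Measure ℝ}

/-- The kernel is at most 2/s times the increment of x ↦ arctan(x/u) over [s/2, s]. -/
lemma integrable_cauchyKernel {μ : Measure ℝ} (hμ : ∀ᵐ u ∂μ, 0 < u)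
    (hi : ∀ s > 0, Integrable (fun u => Real.arctan (s / u)) μ) {s : ℝ} (hs : 0 < s) :
    Integrable (fun u => u / (s ^ 2 + u ^ 2)) μ := by
  refine (((hi s hs).sub (hi (s / 2) (by positivity))).const_mul (2 / s)).mono'
    (Measurable.aestronglyMeasurable (by fun_prop)) ?_
  filter_upwards [hμ] with u hu
  rw [Real.norm_of_nonneg (by positivity)]
  have h := (arctan_sub_bounds (s := s / 2) (s' := s) (by positivity) (by linarith) hu).1
  have h2 := mul_le_mul_of_nonneg_left h (show 0 ≤ 2 / s by positivity)
  refine le_trans (le_of_eq ?_) h2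
  field_simp
  ring

/-- Each s ↦ ∫ arctan(s/u) is concave, so pointwise convergence to a differentiable limit forces
convergence of the derivatives. -/
lemma tendsto_cauchyKernel (hρ : ∀ i, ∀ᵐ u ∂(ρ i), 0 < u) {θ : ℝ → ℝ}
    (hi : ∀ s > 0, ∀ i, Integrable (fun u => Real.arctan (s / u)) (ρ i))
    (ht : ∀ s > 0, Tendsto (fun i => ∫ u, Real.arctan (s / u) ∂(ρ i)) L (𝓝 (θ s)))
    {s θ' : ℝ} (hs : 0 < s) (hθ : HasDerivAt θ θ' s) :
    Tendsto (fun i => ∫ u, u / (s ^ 2 + u ^ 2) ∂(ρ i)) L (𝓝 θ') := by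
  have hJ : ∀ i, Integrable (fun u => u / (s ^ 2 + u ^ 2)) (ρ i) := fun i =>
    integrable_cauchyKernel (hρ i) (fun s hs => hi s hs i) hs
  refine tendsto_of_secant_bounds hs ht hθ (fun i x hx hxs => ?_) (fun i x hxs => ?_)
  · rw [← integral_const_mul, ← integral_sub (hi s hs i) (hi x hx i)]
    refine integral_mono_ae ((hJ i).const_mul _) ((hi s hs i).sub (hi x hx i)) ?_
    filter_upwards [hρ i] with u hu
    exact (arctan_sub_bounds hx.le hxs hu).1
  · rw [← integral_const_mul, ← integral_sub (hi x (hs.trans hxs) i) (hi s hs i)]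
    refine integral_mono_ae ((hi x (hs.trans hxs) i).sub (hi s hs i)) ((hJ i).const_mul _) ?_
    filter_upwards [hρ i] with u hu
    exact (arctan_sub_bounds hs.le hxs hu).2

/-- The divided difference (1/(1+u²) - 1/(1+a+u²))/a equals 1/((1+u²)(1+a+u²)), which tends to one
further power of 1/(1+u²) as a → 0. The induction carries the shifted kernels along with the
moments. -/
lemma close_cauchy_moments (hρ : ∀ i, ∀ᵐ u ∂(ρ i), 0 < u) (hρ' : ∀ i, ∀ᵐ u ∂(ρ' i), 0 < u)
    (hG : MassBounded L ρ fun u => u / (1 + u ^ 2))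
    (hG' : MassBounded L ρ' fun u => u / (1 + u ^ 2))
    (h : ∀ a : ℝ, 0 ≤ a → Close L ρ ρ' fun u => u / (1 + a + u ^ 2)) (k : ℕ) :
    Close L ρ ρ' (fun u => u / (1 + u ^ 2) * (1 / (1 + u ^ 2)) ^ k) := by
  suffices H : Close L ρ ρ' (fun u => u / (1 + u ^ 2) * (1 / (1 + u ^ 2)) ^ k) ∧
      ∀ a > 0, Close L ρ ρ' (fun u => u / (1 + a + u ^ 2) * (1 / (1 + u ^ 2)) ^ k) from H.1
  induction k with
  | zero =>
    simp only [pow_zero, mul_one]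
    exact ⟨by simpa using h 0 le_rfl, fun a ha => h a ha.le⟩
  | succ k ih =>
    obtain ⟨h1, h2⟩ := ih
    have h3 : ∀ a > 0,
        Close L ρ ρ' (fun u => u / (1 + a + u ^ 2) * (1 / (1 + u ^ 2)) ^ (k + 1)) := by
      intro a ha
      refine ((h1.const_mul (1 / a)).add ((h2 a ha).const_mul (-(1 / a)))).congr hρ hρ'
        fun u hu => ?_
      have e : 1 / a * (u / (1 + u ^ 2)) + -(1 / a) * (u / (1 + a + u ^ 2)) =
          u / (1 + a + u ^ 2) * (1 / (1 + u ^ 2)) := by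
        have : 1 + u ^ 2 ≠ 0 := by positivity
        have : 1 + a + u ^ 2 ≠ 0 := by positivity
        field_simp
        ring
      linear_combination (1 / (1 + u ^ 2)) ^ k * e
    -- Taking the shift a = ε makes the error at most ε times the weight.
    refine ⟨Close.of_approx hρ hρ' hG hG' (by fun_prop) fun ε hε => ⟨_, h3 ε hε, fun u hu => ?_⟩, h3⟩
    have hp : 0 < 1 + u ^ 2 := by positivity
    have hw0 : 0 ≤ (1 / (1 + u ^ 2)) ^ (k + 1) := by positivity
    have hw1 : (1 / (1 + u ^ 2)) ^ (k + 1) ≤ 1 :=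
      pow_le_one₀ (by positivity) (by rw [div_le_one hp]; nlinarith)
    have e : u / (1 + u ^ 2) - u / (1 + ε + u ^ 2) = ε / (1 + ε + u ^ 2) * (u / (1 + u ^ 2)) := by
      have : 1 + ε + u ^ 2 ≠ 0 := by positivity
      field_simp
      ring
    rw [← sub_mul, e, abs_of_nonneg (by positivity)]
    have e2 : ε / (1 + ε + u ^ 2) ≤ ε := by
      rw [div_le_iff₀ (by positivity)]; nlinarith [sq_nonneg u, mul_pos hε hε]
    have hG0 : 0 ≤ u / (1 + u ^ 2) := by positivity
    calc ε / (1 + ε + u ^ 2) * (u / (1 + u ^ 2)) * (1 / (1 + u ^ 2)) ^ (k + 1)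
        ≤ ε / (1 + ε + u ^ 2) * (u / (1 + u ^ 2)) * 1 :=
          mul_le_mul_of_nonneg_left hw1 (by positivity)
      _ ≤ ε * (u / (1 + u ^ 2)) := by
          rw [mul_one]; exact mul_le_mul_of_nonneg_right e2 hG0

/-- Convergence of the spectral functionals determines the variance functional. -/
lemma close_expKernel_of_arctan (hρ : ∀ i, ∀ᵐ u ∂(ρ i), 0 < u) (hρ' : ∀ i, ∀ᵐ u ∂(ρ' i), 0 < u)
    {θ θ' : ℝ → ℝ} (hθ : ∀ s > 0, HasDerivAt θ (θ' s) s)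
    (hi : ∀ s > 0, ∀ i, Integrable (fun u => Real.arctan (s / u)) (ρ i))
    (hi' : ∀ s > 0, ∀ i, Integrable (fun u => Real.arctan (s / u)) (ρ' i))
    (ht : ∀ s > 0, Tendsto (fun i => ∫ u, Real.arctan (s / u) ∂(ρ i)) L (𝓝 (θ s)))
    (ht' : ∀ s > 0, Tendsto (fun i => ∫ u, Real.arctan (s / u) ∂(ρ' i)) L (𝓝 (θ s))) :
    Close L ρ ρ' (expKernel 1) := by
  have hJ : ∀ a : ℝ, 0 ≤ a → Close L ρ ρ' fun u => u / (1 + a + u ^ 2) := fun a ha => by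
    have hs : 0 < √(1 + a) := Real.sqrt_pos.mpr (by linarith)
    have h := Close.of_tendsto
      (fun i => integrable_cauchyKernel (hρ i) (fun s hs => hi s hs i) hs)
      (fun i => integrable_cauchyKernel (hρ' i) (fun s hs => hi' s hs i) hs)
      (tendsto_cauchyKernel hρ hi ht hs (hθ _ hs)) (tendsto_cauchyKernel hρ' hi' ht' hs (hθ _ hs))
    simpa only [Real.sq_sqrt (show 0 ≤ 1 + a by linarith)] using h
  have hG : MassBounded L ρ fun u => u / (1 + u ^ 2) := by
    have := MassBounded.of_tendsto
      (fun i => integrable_cauchyKernel (hρ i) (fun s hs => hi s hs i) one_pos)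
      (tendsto_cauchyKernel hρ hi ht one_pos (hθ _ one_pos))
    simpa only [one_pow] using this
  have hG' : MassBounded L ρ' fun u => u / (1 + u ^ 2) := by
    have := MassBounded.of_tendsto
      (fun i => integrable_cauchyKernel (hρ' i) (fun s hs => hi' s hs i) one_pos)
      (tendsto_cauchyKernel hρ' hi' ht' one_pos (hθ _ one_pos))
    simpa only [one_pow] using this
  have hA : Close L ρ ρ' (fun u => Real.arctan (1 / u)) :=
    Close.of_tendsto (hi 1 one_pos) (hi' 1 one_pos) (ht 1 one_pos) (ht' 1 one_pos)
  have hpi := Real.pi_pos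
  -- The weight u/(1+u²) vanishes at 0 while `expKernel 1` tends to 1. The factor 2/π makes the
  -- arctangent, known to be close, cancel this limit; at infinity everything is already of order
  -- 1/u.
  have hrest : Close L ρ ρ' (fun u => expKernel 1 u - 2 / Real.pi * Real.arctan (1 / u)) := by
    have hm : Measurable (fun u => expKernel 1 u - 2 / Real.pi * Real.arctan (1 / u)) := by
      have := measurable_expKernel 1
      fun_prop
    refine Close.of_moments_of_limits (w := fun u => 1 / (1 + u ^ 2))
      (v := fun z => √(1 / z - 1)) (a := (-(1 / 3) + 2 / Real.pi * 1) * (1 + 0 ^ 2))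
      (b := (2 - 2 / Real.pi * 1) * (1 + 0 ^ 2)) hρ hρ' hG hG'
      (fun u hu => by positivity) (fun u hu => ⟨by positivity, ?_⟩)
      (close_cauchy_moments hρ hρ' hG hG' hJ) (fun u hu => ?_) ?_ ?_ ?_ ?_ hm ?_ ?_ ?_
    · rw [div_lt_one (by positivity)]; nlinarith
    · rw [one_div_one_div, add_sub_cancel_left, Real.sqrt_sq hu.le]
    · exact (ContinuousOn.sub (continuousOn_const.div continuousOn_id fun z hz => ne_of_gt hz.1)
        continuousOn_const).sqrt
    · refine Real.tendsto_sqrt_atTop.comp ?_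
      simp only [one_div]
      exact tendsto_atTop_add_const_right _ (-1) tendsto_inv_nhdsGT_zero
    · refine tendsto_nhdsWithin_iff.mpr ⟨?_, ?_⟩
      · have : Tendsto (fun z : ℝ => √(1 / z - 1)) (𝓝 1) (𝓝 √(1 / 1 - 1)) :=
          ((tendsto_const_nhds.div tendsto_id one_ne_zero).sub_const 1).sqrt
        rw [div_one, sub_self, Real.sqrt_zero] at this
        exact this.mono_left nhdsWithin_le_nhds
      · filter_upwards [Ioo_mem_nhdsLT one_pos] with z hz
        refine Real.sqrt_pos.mpr ?_
        rw [sub_pos, lt_div_iff₀ hz.1, one_mul]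
        exact hz.2
    · intro z hz
      refine Real.sqrt_pos.mpr ?_
      rw [sub_pos, lt_div_iff₀ hz.1, one_mul]
      exact hz.2
    · refine ContinuousOn.div ?_ ?_ fun u hu => ?_
      · refine ContinuousOn.sub ?_ (continuousOn_const.mul ?_)
        · unfold expKernel
          exact ContinuousOn.div (by fun_prop) (by fun_prop) fun u hu => (pow_pos hu 2).ne'
        · exact Real.continuous_arctan.comp_continuousOn
            (continuousOn_const.div continuousOn_id fun u hu => ne_of_gt hu)
      · exact ContinuousOn.div (by fun_prop) (by fun_prop) fun u hu => by positivity
      · have : (0 : ℝ) < u := hu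
        positivity
    · have h1 : Tendsto (fun u : ℝ => 1 + u ^ 2) (𝓝[>] 0) (𝓝 (1 + 0 ^ 2)) :=
        ((tendsto_id.mono_left nhdsWithin_le_nhds).pow 2).const_add 1
      refine (((tendsto_slope_expKernel_one_zero.add
        (tendsto_arctan_div_zero.const_mul (2 / Real.pi))).mul h1).congr' ?_)
      filter_upwards [self_mem_nhdsWithin] with u hu
      have hu' : (0 : ℝ) < u := hu
      rw [one_div u, Real.arctan_inv_of_pos hu']
      field_simp
      ring
    · have h1 : Tendsto (fun u : ℝ => 1 + (1 / u) ^ 2) atTop (𝓝 (1 + 0 ^ 2)) :=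
        ((tendsto_const_nhds.div_atTop tendsto_id).pow 2).const_add 1
      have h2 : Tendsto (fun u : ℝ => u * expKernel 1 u) atTop (𝓝 2) := by
        have h3 : Tendsto (fun u : ℝ => 2 * ((Real.exp (-u) - 1) * (1 / u) + 1)) atTop
            (𝓝 (2 * ((0 - 1) * 0 + 1))) :=
          (((tendsto_exp_neg_atTop.sub_const 1).mul
            (tendsto_const_nhds.div_atTop tendsto_id)).add_const 1).const_mul 2
        rw [show (2 : ℝ) * ((0 - 1) * 0 + 1) = 2 by norm_num] at h3
        refine h3.congr' ?_
        filter_upwards [eventually_gt_atTop 0] with u hu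
        rw [expKernel, one_mul]
        field_simp
      refine (((h2.sub (tendsto_mul_arctan_inv.const_mul (2 / Real.pi))).mul h1).congr' ?_)
      filter_upwards [eventually_gt_atTop 0] with u hu
      field_simp
      ring
  exact (hrest.add (hA.const_mul (2 / Real.pi))).congr hρ hρ' fun u _ => by ring

end MonotoneDensity

/-! ### Integrals of the kernels against powers -/

section PowerIntegrals

/-- Tonelli's theorem for a nonnegative kernel, with integrability of the marginal. -/
lemma tonelli_kernel {s t : Set ℝ} (hs : MeasurableSet s) (ht : MeasurableSet t) {f : ℝ → ℝ → ℝ}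
    (hf : Measurable (Function.uncurry f)) (hf0 : ∀ x ∈ s, ∀ u ∈ t, 0 ≤ f x u)
    (hint : ∀ x ∈ s, IntegrableOn (f x) t) {B : ℝ → ℝ} (hB : ∀ x ∈ s, ∫ u in t, f x u = B x)
    (hBint : IntegrableOn B s) :
    IntegrableOn (fun u => ∫ x in s, f x u) t ∧
      ∫ u in t, (∫ x in s, f x u) = ∫ x in s, B x := by
  have hI : Integrable (Function.uncurry f) ((volume.restrict s).prod (volume.restrict t)) := by
    rw [integrable_prod_iff hf.aestronglyMeasurable]
    constructor
    · filter_upwards [ae_restrict_mem hs] with x hx using hint x hx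
    · refine hBint.congr ?_
      filter_upwards [ae_restrict_mem hs] with x hx
      rw [← hB x hx]
      refine setIntegral_congr_fun ht fun u hu => ?_
      exact (Real.norm_of_nonneg (hf0 x hx u hu)).symm
  refine ⟨hI.integral_prod_right, ?_⟩
  rw [← integral_integral_swap hI]
  exact setIntegral_congr_fun hs fun x hx => hB x hx

lemma integral_exp_kernel {u : ℝ} (hu : 0 < u) :
    ∫ t in Set.Ioc (0 : ℝ) 1, 2 * (1 - t) * Real.exp (-(t * u)) = expKernel 1 u := by
  rw [← intervalIntegral.integral_of_le zero_le_one]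
  have hd : ∀ t ∈ Set.uIcc (0 : ℝ) 1, HasDerivAt
      (fun t => 2 * (-((1 - t) * Real.exp (-(t * u)) / u) + Real.exp (-(t * u)) / u ^ 2))
      (2 * (1 - t) * Real.exp (-(t * u))) t := by
    intro t _
    have he : HasDerivAt (fun t => Real.exp (-(t * u))) (Real.exp (-(t * u)) * -(1 * u)) t :=
      (((hasDerivAt_id t).mul_const u).neg).exp
    have h1 : HasDerivAt (fun t : ℝ => 1 - t) (-1) t := (hasDerivAt_id t).const_sub 1
    refine ((((h1.mul he).div_const u).neg.add (he.div_const (u ^ 2))).const_mul 2).congr_deriv ?_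
    field_simp
    ring
  rw [intervalIntegral.integral_eq_sub_of_hasDerivAt hd
    (Continuous.intervalIntegrable (by fun_prop) _ _), expKernel]
  simp only [zero_mul, neg_zero, Real.exp_zero, one_mul]
  field_simp
  ring

lemma integrableOn_rpow_mul_exp {a r : ℝ} (ha : 0 < a) (hr : 0 < r) :
    IntegrableOn (fun t : ℝ => t ^ (a - 1) * Real.exp (-(r * t))) (Set.Ioi 0) := by
  -- The integral of a non-integrable function is 0 by convention, so a nonzero value proves
  -- integrability.
  refine Integrable.of_integral_ne_zero ?_
  rw [Real.integral_rpow_mul_exp_neg_mul_Ioi ha hr]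
  have := Real.Gamma_pos_of_pos ha
  positivity

/-- The kernel is ∫₀¹ 2(1-t)e^{-tu} dt. Tonelli leaves the Gamma integral Γ(2-α)t^{α-2}, where α < 2
is needed, and then ∫₀¹ (t^{α-2} - t^{α-1}) dt, where α > 1 is needed. -/
lemma integral_expKernel_mul_rpow {α : ℝ} (h1 : 1 < α) (h2 : α < 2) :
    IntegrableOn (fun u => expKernel 1 u * u ^ (1 - α)) (Set.Ioi 0) ∧
    ∫ u in Set.Ioi (0 : ℝ), expKernel 1 u * u ^ (1 - α) =
      2 * Real.Gamma (2 - α) / (α * (α - 1)) := by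
  have hB0 : IntegrableOn (fun t : ℝ => 2 * Real.Gamma (2 - α) * (t ^ (α - 2) - t ^ (α - 1)))
      (Set.Ioc 0 1) := by
    rw [← intervalIntegrable_iff_integrableOn_Ioc_of_le zero_le_one]
    exact ((intervalIntegral.intervalIntegrable_rpow' (by linarith)).sub
      (intervalIntegral.intervalIntegrable_rpow' (by linarith))).const_mul _
  have key := tonelli_kernel (s := Set.Ioc 0 1) (t := Set.Ioi 0)
    (f := fun t u => 2 * (1 - t) * Real.exp (-(t * u)) * u ^ (1 - α))
    (B := fun t => 2 * Real.Gamma (2 - α) * (t ^ (α - 2) - t ^ (α - 1)))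
    measurableSet_Ioc measurableSet_Ioi ?_ ?_ ?_ ?_ hB0
  · have e : ∀ u ∈ Set.Ioi (0 : ℝ), ∫ t in Set.Ioc (0 : ℝ) 1,
        2 * (1 - t) * Real.exp (-(t * u)) * u ^ (1 - α) = expKernel 1 u * u ^ (1 - α) :=
      fun u hu => by rw [integral_mul_const, integral_exp_kernel hu]
    refine ⟨key.1.congr_fun e measurableSet_Ioi, ?_⟩
    rw [← setIntegral_congr_fun measurableSet_Ioi e, key.2,
      ← intervalIntegral.integral_of_le zero_le_one, intervalIntegral.integral_const_mul,
      intervalIntegral.integral_sub (intervalIntegral.intervalIntegrable_rpow' (by linarith))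
        (intervalIntegral.intervalIntegrable_rpow' (by linarith)),
      integral_rpow (Or.inl (by linarith)), integral_rpow (Or.inl (by linarith)),
      Real.one_rpow, Real.one_rpow, Real.zero_rpow (by linarith), Real.zero_rpow (by linarith)]
    have : α - 1 ≠ 0 := by linarith
    have : α ≠ 0 := by linarith
    rw [show α - 2 + 1 = α - 1 by ring, show α - 1 + 1 = α by ring]
    field_simp
    ring
  · unfold Function.uncurry; fun_prop
  · intro t ht u hu
    have : 0 ≤ 1 - t := by linarith [ht.2]
    have := Real.rpow_nonneg (le_of_lt hu) (1 - α)
    positivity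
  · intro t ht
    have := (integrableOn_rpow_mul_exp (a := 2 - α) (by linarith) ht.1).const_mul (2 * (1 - t))
    refine this.congr (Eventually.of_forall fun u => ?_)
    simp only [show 2 - α - 1 = 1 - α by ring]
    ring
  · intro t ht
    have h := Real.integral_rpow_mul_exp_neg_mul_Ioi (a := 2 - α) (by linarith) ht.1
    simp only [show 2 - α - 1 = 1 - α by ring] at h
    have e : ∀ u : ℝ, 2 * (1 - t) * Real.exp (-(t * u)) * u ^ (1 - α) =
        2 * (1 - t) * (u ^ (1 - α) * Real.exp (-(t * u))) := fun u => by ring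
    simp only [e]
    rw [integral_const_mul, h, one_div, Real.inv_rpow ht.1.le, ← Real.rpow_neg ht.1.le,
      show -(2 - α) = α - 2 by ring, show α - 1 = (α - 2) + 1 by ring, Real.rpow_add ht.1,
      Real.rpow_one]
    ring

/-- Write 1/(1+u²) as ∫₀^∞ e^{-x(1+u²)} dx, integrate in u first, and finish with the reflection
formula for Γ. -/
lemma integral_rpow_div_one_add_sq {p : ℝ} (h0 : 0 < p) (h1 : p < 1) :
    IntegrableOn (fun u : ℝ => u ^ p / (1 + u ^ 2)) (Set.Ioi 0) ∧
    ∫ u in Set.Ioi (0 : ℝ), u ^ p / (1 + u ^ 2) = Real.pi / (2 * Real.sin (Real.pi * ((1 - p) / 2))) := by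
  have hB0 : IntegrableOn (fun x : ℝ => 1 / 2 * Real.Gamma ((p + 1) / 2) *
      (x ^ ((1 - p) / 2 - 1) * Real.exp (-(1 * x)))) (Set.Ioi 0) :=
    (integrableOn_rpow_mul_exp (by linarith) one_pos).const_mul _
  have hin : ∀ x ∈ Set.Ioi (0 : ℝ), ∫ u in Set.Ioi (0 : ℝ), u ^ p * Real.exp (-(x * (1 + u ^ 2))) =
      1 / 2 * Real.Gamma ((p + 1) / 2) * (x ^ ((1 - p) / 2 - 1) * Real.exp (-(1 * x))) := by
    intro x hx
    have h := integral_rpow_mul_exp_neg_mul_rpow (p := 2) (q := p) (b := x) two_pos (by linarith) hx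
    have e : ∀ u ∈ Set.Ioi (0 : ℝ), u ^ p * Real.exp (-(x * (1 + u ^ 2))) =
        Real.exp (-x) * (u ^ p * Real.exp (-x * u ^ (2 : ℝ))) := fun u _ => by
      rw [Real.rpow_two, mul_left_comm, ← Real.exp_add]; ring_nf
    rw [setIntegral_congr_fun measurableSet_Ioi e, integral_const_mul, h,
      show -(p + 1) / 2 = (1 - p) / 2 - 1 by ring, one_mul]
    ring
  have key := tonelli_kernel (s := Set.Ioi 0) (t := Set.Ioi 0)
    (f := fun x u => u ^ p * Real.exp (-(x * (1 + u ^ 2)))) measurableSet_Ioi measurableSet_Ioi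
    (by unfold Function.uncurry; fun_prop)
    (fun x _ u hu => mul_nonneg (Real.rpow_nonneg (le_of_lt hu) p) (Real.exp_pos _).le)
    (fun x hx => ?_) hin hB0
  · have e : ∀ u ∈ Set.Ioi (0 : ℝ), ∫ x in Set.Ioi (0 : ℝ), u ^ p * Real.exp (-(x * (1 + u ^ 2))) =
        u ^ p / (1 + u ^ 2) := fun u _ => by
      have hu : (0 : ℝ) < 1 + u ^ 2 := by positivity
      have h := Real.integral_rpow_mul_exp_neg_mul_Ioi one_pos hu
      simp only [sub_self, Real.rpow_zero, one_mul, Real.rpow_one, Real.Gamma_one, mul_one] at h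
      simp only [mul_comm _ (1 + u ^ 2)]
      rw [integral_const_mul, h]
      ring
    refine ⟨key.1.congr_fun e measurableSet_Ioi, ?_⟩
    rw [← setIntegral_congr_fun measurableSet_Ioi e, key.2, integral_const_mul,
      Real.integral_rpow_mul_exp_neg_mul_Ioi (by linarith) one_pos]
    have hG := Real.Gamma_mul_Gamma_one_sub ((1 - p) / 2)
    rw [show 1 - (1 - p) / 2 = (p + 1) / 2 by ring] at hG
    rw [div_one, Real.one_rpow, one_mul, mul_assoc, mul_comm (Real.Gamma _), hG]
    ring
  · refine Integrable.of_integral_ne_zero ?_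
    rw [hin x hx]
    have := Real.Gamma_pos_of_pos (show 0 < (p + 1) / 2 by linarith)
    have := Real.rpow_pos_of_pos hx ((1 - p) / 2 - 1)
    positivity

lemma integral_arctan_kernel {u : ℝ} (hu : 0 < u) :
    ∫ t in Set.Ioc (0 : ℝ) 1, u / (t ^ 2 + u ^ 2) = Real.arctan (1 / u) := by
  rw [← intervalIntegral.integral_of_le zero_le_one]
  have hd : ∀ t ∈ Set.uIcc (0 : ℝ) 1, HasDerivAt (fun t => Real.arctan (t / u))
      (u / (t ^ 2 + u ^ 2)) t := by
    intro t _
    refine (((hasDerivAt_id t).div_const u).arctan).congr_deriv ?_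
    simp only [id]
    field_simp
    rw [add_comm]
  rw [intervalIntegral.integral_eq_sub_of_hasDerivAt hd
    (Continuous.intervalIntegrable (Continuous.div (by fun_prop) (by fun_prop)
      fun t => by positivity) _ _)]
  simp

/-- Here arctan(1/u) = ∫₀¹ u/(t² + u²) dt; after Tonelli the inner integral scales as a constant
times t^{1-α}. -/
lemma integral_arctan_mul_rpow {α : ℝ} (h1 : 1 < α) (h2 : α < 2) :
    IntegrableOn (fun u => Real.arctan (1 / u) * u ^ (1 - α)) (Set.Ioi 0) ∧
    ∫ u in Set.Ioi (0 : ℝ), Real.arctan (1 / u) * u ^ (1 - α) =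
      Real.pi / (2 * Real.sin (Real.pi * ((α - 1) / 2))) / (2 - α) := by
  obtain ⟨hJi, hJ⟩ := integral_rpow_div_one_add_sq (p := 2 - α) (by linarith) (by linarith)
  rw [show 1 - (2 - α) = α - 1 by ring] at hJ
  set J := Real.pi / (2 * Real.sin (Real.pi * ((α - 1) / 2)))
  have hB0 : IntegrableOn (fun t : ℝ => J * t ^ (1 - α)) (Set.Ioc 0 1) := by
    rw [← intervalIntegrable_iff_integrableOn_Ioc_of_le zero_le_one]
    exact (intervalIntegral.intervalIntegrable_rpow' (by linarith)).const_mul _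
  have hscale : ∀ t : ℝ, 0 < t → ∀ u ∈ Set.Ioi (0 : ℝ), u / (t ^ 2 + u ^ 2) * u ^ (1 - α) =
      t ^ (-α) * ((t⁻¹ * u) ^ (2 - α) / (1 + (t⁻¹ * u) ^ 2)) := by
    intro t ht u hu
    have hu' : (0 : ℝ) < u := hu
    rw [Real.mul_rpow (inv_pos.mpr ht).le hu'.le, Real.inv_rpow ht.le, ← Real.rpow_neg ht.le,
      show 2 - α = 1 + (1 - α) by ring, Real.rpow_add hu', Real.rpow_one,
      show -(1 + (1 - α)) = α + (-2 : ℝ) by ring, Real.rpow_add ht, Real.rpow_neg ht.le α,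
      Real.rpow_neg ht.le 2, Real.rpow_two]
    have := (Real.rpow_pos_of_pos ht α).ne'
    have : t ^ 2 + u ^ 2 ≠ 0 := by positivity
    field_simp
  have key := tonelli_kernel (s := Set.Ioc 0 1) (t := Set.Ioi 0)
    (f := fun t u => u / (t ^ 2 + u ^ 2) * u ^ (1 - α)) (B := fun t => J * t ^ (1 - α))
    measurableSet_Ioc measurableSet_Ioi (by unfold Function.uncurry; fun_prop)
    (fun t _ u hu => ?_) (fun t ht => ?_) (fun t ht => ?_) hB0
  · have e : ∀ u ∈ Set.Ioi (0 : ℝ), ∫ t in Set.Ioc (0 : ℝ) 1,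
        u / (t ^ 2 + u ^ 2) * u ^ (1 - α) = Real.arctan (1 / u) * u ^ (1 - α) :=
      fun u hu => by rw [integral_mul_const, integral_arctan_kernel hu]
    refine ⟨key.1.congr_fun e measurableSet_Ioi, ?_⟩
    rw [← setIntegral_congr_fun measurableSet_Ioi e, key.2,
      ← intervalIntegral.integral_of_le zero_le_one, intervalIntegral.integral_const_mul,
      integral_rpow (Or.inl (by linarith)), Real.one_rpow, Real.zero_rpow (by linarith),
      show 1 - α + 1 = 2 - α by ring]
    ring
  · have hu' : (0 : ℝ) < u := hu
    have := Real.rpow_nonneg hu'.le (1 - α)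
    positivity
  · refine IntegrableOn.congr_fun ?_ (fun u hu => (hscale t ht.1 u hu).symm) measurableSet_Ioi
    refine Integrable.const_mul ?_ _
    have := (integrableOn_Ioi_comp_mul_left_iff
      (fun u : ℝ => u ^ (2 - α) / (1 + u ^ 2)) 0 (inv_pos.mpr ht.1)).mpr (by simpa using hJi)
    exact this
  · rw [setIntegral_congr_fun measurableSet_Ioi (hscale t ht.1), integral_const_mul,
      integral_comp_mul_left_Ioi (fun u : ℝ => u ^ (2 - α) / (1 + u ^ 2)) 0 (inv_pos.mpr ht.1),
      mul_zero, hJ, inv_inv, smul_eq_mul, show 1 - α = -α + 1 by ring, Real.rpow_add ht.1,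
      Real.rpow_one]
    ring

lemma cConst_pos {α : ℝ} (h1 : 1 ≤ α) (h2 : α < 2) : 0 < cConst α := by
  have hpi := Real.pi_pos
  have hG := Real.Gamma_pos_of_pos (show 0 < 1 + α by linarith)
  have hs : 0 < Real.sin (α * Real.pi / 2) :=
    Real.sin_pos_of_pos_of_lt_pi (by positivity) (by nlinarith)
  have : 0 < 2 - α := by linarith
  unfold cConst
  positivity

lemma cConst_one : cConst 1 = 1 / Real.pi := by
  have : Real.Gamma (1 + 1) = 1 := by
    rw [show (1 : ℝ) + 1 = 2 by norm_num, Real.Gamma_two]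
  rw [cConst, this, one_mul, one_mul, Real.sin_pi_div_two]
  norm_num

/-- This is where C(α) comes from. It follows from Γ(α-1)Γ(2-α) = π / sin π(α-1), the double-angle
formula and two steps of the functional equation. -/
lemma power_constants_ratio {α : ℝ} (h1 : 1 < α) (h2 : α < 2) :
    Real.pi / (2 * Real.sin (Real.pi * ((α - 1) / 2))) / (2 - α) =
      2 * Real.Gamma (2 - α) / (α * (α - 1)) * (Real.pi / 2 * cConst α) := by
  have hpi := Real.pi_pos
  have e1 : Real.Gamma (1 + α) = α * ((α - 1) * Real.Gamma (α - 1)) := by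
    rw [add_comm, Real.Gamma_add_one (by linarith)]
    congr 1
    conv_lhs => rw [show α = α - 1 + 1 by ring]
    exact Real.Gamma_add_one (by linarith)
  have hG := Real.Gamma_mul_Gamma_one_sub (α - 1)
  rw [show 1 - (α - 1) = 2 - α by ring,
    show Real.pi * (α - 1) = 2 * (Real.pi * ((α - 1) / 2)) by ring, Real.sin_two_mul] at hG
  have e2 : Real.sin (α * Real.pi / 2) = Real.cos (Real.pi * ((α - 1) / 2)) := by
    rw [← Real.sin_add_pi_div_two]; congr 1; ring
  have hs : 0 < Real.sin (Real.pi * ((α - 1) / 2)) :=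
    Real.sin_pos_of_pos_of_lt_pi (by nlinarith) (by nlinarith)
  have hc : 0 < Real.cos (Real.pi * ((α - 1) / 2)) :=
    Real.cos_pos_of_mem_Ioo ⟨by nlinarith, by nlinarith⟩
  have h3 : 0 < α - 1 := by linarith
  have h4 : 0 < 2 - α := by linarith
  have h5 : 0 < α := by linarith
  rw [cConst, e1, e2]
  set S := Real.sin (Real.pi * ((α - 1) / 2))
  set C := Real.cos (Real.pi * ((α - 1) / 2))
  set G1 := Real.Gamma (α - 1)
  set G2 := Real.Gamma (2 - α)
  have hG' : G1 * G2 * (2 * S * C) = Real.pi := by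
    rw [hG]; field_simp
  field_simp
  linarith

end PowerIntegrals

/-! ### Model families and the abstract Tauberian theorem -/

section Model

lemma expKernel_scale {s u : ℝ} (hs : 0 < s) (hu : 0 < u) (α : ℝ) :
    expKernel s u * u ^ (1 - α) = s ^ (1 + α) * (expKernel 1 (s * u) * (s * u) ^ (1 - α)) := by
  have h := (Real.rpow_pos_of_pos hs α).ne'
  rw [expKernel, expKernel, Real.mul_rpow hs.le hu.le, Real.rpow_sub hs, Real.rpow_add hs,
    Real.rpow_one, one_mul]
  field_simp

lemma arctan_scale {s u : ℝ} (hs : 0 < s) (hu : 0 < u) (α : ℝ) :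
    Real.arctan (s / u) * u ^ (1 - α) =
      s ^ (1 - α) * (Real.arctan (1 / (s⁻¹ * u)) * (s⁻¹ * u) ^ (1 - α)) := by
  have h := (Real.rpow_pos_of_pos hs (1 - α)).ne'
  rw [Real.mul_rpow (inv_pos.mpr hs).le hu.le, Real.inv_rpow hs.le,
    show 1 / (s⁻¹ * u) = s / u by field_simp]
  field_simp

/-- The power measure on `(0, ∞)` with density `c u ^ (1 - α)`. -/
noncomputable def powerMeasure (c α : ℝ) : Measure ℝ :=
  (volume.restrict (Set.Ioi 0)).withDensity fun u => ENNReal.ofReal (c * u ^ (1 - α))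

lemma ae_pos_powerMeasure (c α : ℝ) : ∀ᵐ u ∂(powerMeasure c α), 0 < u :=
  (withDensity_absolutelyContinuous _ _).ae_le (ae_restrict_mem measurableSet_Ioi)

lemma powerMeasure_integral {c : ℝ} (hc : 0 ≤ c) (α : ℝ) {f : ℝ → ℝ}
    (hf : IntegrableOn (fun u => f u * u ^ (1 - α)) (Set.Ioi 0)) :
    Integrable f (powerMeasure c α) ∧
      ∫ u, f u ∂(powerMeasure c α) = c * ∫ u in Set.Ioi (0 : ℝ), f u * u ^ (1 - α) := by
  have hm : Measurable fun u : ℝ => ENNReal.ofReal (c * u ^ (1 - α)) := by fun_prop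
  have hlt : ∀ᵐ u : ℝ ∂(volume.restrict (Set.Ioi 0)), ENNReal.ofReal (c * u ^ (1 - α)) < ⊤ :=
    Eventually.of_forall fun _ => ENNReal.ofReal_lt_top
  have e : ∀ u ∈ Set.Ioi (0 : ℝ), (ENNReal.ofReal (c * u ^ (1 - α))).toReal • f u =
      c * (f u * u ^ (1 - α)) := fun u hu => by
    rw [ENNReal.toReal_ofReal (mul_nonneg hc (Real.rpow_nonneg (le_of_lt hu) _)), smul_eq_mul]
    ring
  constructor
  · rw [powerMeasure, integrable_withDensity_iff_integrable_smul' hm hlt]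
    exact IntegrableOn.congr_fun (hf.const_mul c) (fun u hu => (e u hu).symm) measurableSet_Ioi
  · rw [powerMeasure, integral_withDensity_eq_integral_toReal_smul hm hlt,
      setIntegral_congr_fun measurableSet_Ioi e, integral_const_mul]

lemma powerMeasure_expKernel {α : ℝ} (h1 : 1 < α) (h2 : α < 2) {c : ℝ} (hc : 0 ≤ c)
    {s : ℝ} (hs : 0 < s) : Integrable (expKernel s) (powerMeasure c α) ∧
      ∫ u, expKernel s u ∂(powerMeasure c α) =
        c * (2 * Real.Gamma (2 - α) / (α * (α - 1))) * s ^ α := by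
  obtain ⟨hi, hv⟩ := integral_expKernel_mul_rpow h1 h2
  have e : ∀ u ∈ Set.Ioi (0 : ℝ), expKernel s u * u ^ (1 - α) =
      s ^ (1 + α) * (expKernel 1 (s * u) * (s * u) ^ (1 - α)) := fun u hu => expKernel_scale hs hu α
  have hi2 : IntegrableOn (fun u => expKernel s u * u ^ (1 - α)) (Set.Ioi 0) := by
    refine IntegrableOn.congr_fun ?_ (fun u hu => (e u hu).symm) measurableSet_Ioi
    refine Integrable.const_mul ?_ _
    exact (integrableOn_Ioi_comp_mul_left_iff
      (fun u : ℝ => expKernel 1 u * u ^ (1 - α)) 0 hs).mpr (by simpa using hi)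
  obtain ⟨g1, g2⟩ := powerMeasure_integral hc α hi2
  refine ⟨g1, ?_⟩
  rw [g2, setIntegral_congr_fun measurableSet_Ioi e, integral_const_mul,
    integral_comp_mul_left_Ioi (fun u : ℝ => expKernel 1 u * u ^ (1 - α)) 0 hs, mul_zero, hv,
    smul_eq_mul, Real.rpow_add hs, Real.rpow_one]
  field_simp

lemma powerMeasure_arctan {α : ℝ} (h1 : 1 < α) (h2 : α < 2) {c : ℝ} (hc : 0 ≤ c)
    {s : ℝ} (hs : 0 < s) : Integrable (fun u => Real.arctan (s / u)) (powerMeasure c α) ∧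
      ∫ u, Real.arctan (s / u) ∂(powerMeasure c α) =
        c * (2 * Real.Gamma (2 - α) / (α * (α - 1))) * (Real.pi / 2 * cConst α * s ^ (2 - α)) := by
  obtain ⟨hi, hv⟩ := integral_arctan_mul_rpow h1 h2
  rw [power_constants_ratio h1 h2] at hv
  have e : ∀ u ∈ Set.Ioi (0 : ℝ), Real.arctan (s / u) * u ^ (1 - α) =
      s ^ (1 - α) * (Real.arctan (1 / (s⁻¹ * u)) * (s⁻¹ * u) ^ (1 - α)) :=
    fun u hu => arctan_scale hs hu α
  have hi2 : IntegrableOn (fun u => Real.arctan (s / u) * u ^ (1 - α)) (Set.Ioi 0) := by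
    refine IntegrableOn.congr_fun ?_ (fun u hu => (e u hu).symm) measurableSet_Ioi
    refine Integrable.const_mul ?_ _
    exact (integrableOn_Ioi_comp_mul_left_iff
      (fun u : ℝ => Real.arctan (1 / u) * u ^ (1 - α)) 0 (inv_pos.mpr hs)).mpr (by simpa using hi)
  obtain ⟨g1, g2⟩ := powerMeasure_integral hc α hi2
  refine ⟨g1, ?_⟩
  rw [g2, setIntegral_congr_fun measurableSet_Ioi e, integral_const_mul,
    integral_comp_mul_left_Ioi (fun u : ℝ => Real.arctan (1 / u) * u ^ (1 - α)) 0 (inv_pos.mpr hs),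
    mul_zero, hv, smul_eq_mul, inv_inv, show 2 - α = 1 + (1 - α) by ring, Real.rpow_add hs,
    Real.rpow_one]
  ring

/-- A family of measures whose functionals have the power asymptotics of index `α`. -/
structure IsModel (α : ℝ) (ρ : ℕ → Measure ℝ) : Prop where
  pos : ∀ i, ∀ᵐ u ∂(ρ i), 0 < u
  int_exp : ∀ (k : ℕ) i, Integrable (expKernel k) (ρ i)
  lim_exp : ∀ k : ℕ, Tendsto (fun i => ∫ u, expKernel k u ∂(ρ i)) atTop (𝓝 ((k : ℝ) ^ α))
  int_arctan : ∀ s > 0, ∀ i, Integrable (fun u => Real.arctan (s / u)) (ρ i)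
  lim_arctan : ∀ s > 0, Tendsto (fun i => ∫ u, Real.arctan (s / u) ∂(ρ i)) atTop
    (𝓝 (Real.pi / 2 * cConst α * s ^ (2 - α)))

lemma isModel_powerMeasure {α : ℝ} (h1 : 1 < α) (h2 : α < 2) :
    IsModel α fun _ => powerMeasure (2 * Real.Gamma (2 - α) / (α * (α - 1)))⁻¹ α := by
  have hG := Real.Gamma_pos_of_pos (show 0 < 2 - α by linarith)
  have h3 : 0 < α * (α - 1) := mul_pos (by linarith) (by linarith)
  have hI : 0 < 2 * Real.Gamma (2 - α) / (α * (α - 1)) := by positivity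
  have hc : 0 ≤ (2 * Real.Gamma (2 - α) / (α * (α - 1)))⁻¹ := (inv_pos.mpr hI).le
  have hcI : (2 * Real.Gamma (2 - α) / (α * (α - 1)))⁻¹ *
      (2 * Real.Gamma (2 - α) / (α * (α - 1))) = 1 := inv_mul_cancel₀ hI.ne'
  have h0 : expKernel 0 = fun _ => 0 := by ext u; simp [expKernel]
  refine ⟨fun _ => ae_pos_powerMeasure _ _, fun k _ => ?_, fun k => ?_,
    fun s hs _ => (powerMeasure_arctan h1 h2 hc hs).1, fun s hs => ?_⟩
  · rcases Nat.eq_zero_or_pos k with rfl | hk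
    · rw [Nat.cast_zero, h0]; exact integrable_zero _ _ _
    · exact (powerMeasure_expKernel h1 h2 hc (Nat.cast_pos.mpr hk)).1
  · rcases Nat.eq_zero_or_pos k with rfl | hk
    · rw [Nat.cast_zero, h0, Real.zero_rpow (by linarith)]; simp
    · rw [(powerMeasure_expKernel h1 h2 hc (Nat.cast_pos.mpr hk)).2, hcI, one_mul]
      exact tendsto_const_nhds
  · rw [(powerMeasure_arctan h1 h2 hc hs).2, hcI, one_mul]
    exact tendsto_const_nhds

/-- At α = 1 the power integrals diverge and the mass sits at infinity. For large u, `expKernel k u`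
is about 2k/u and arctan(s/u) about s/u, so weight u/2 at u = n + 1 gives the limits k and s/2. -/
lemma isModel_dirac :
    IsModel 1 fun n => ENNReal.ofReal (((n : ℝ) + 1) / 2) • Measure.dirac ((n : ℝ) + 1) := by
  have hn : ∀ n : ℕ, (0 : ℝ) < (n : ℝ) + 1 := fun n => by positivity
  have hint : ∀ (f : ℝ → ℝ) (n : ℕ),
      ∫ u, f u ∂(ENNReal.ofReal (((n : ℝ) + 1) / 2) • Measure.dirac ((n : ℝ) + 1)) =
        ((n : ℝ) + 1) / 2 * f ((n : ℝ) + 1) := fun f n => by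
    rw [integral_smul_measure, integral_dirac, ENNReal.toReal_ofReal (by positivity), smul_eq_mul]
  have hI : ∀ (f : ℝ → ℝ) (n : ℕ),
      Integrable f (ENNReal.ofReal (((n : ℝ) + 1) / 2) • Measure.dirac ((n : ℝ) + 1)) := fun f n =>
    (integrable_dirac (by finiteness)).smul_measure ENNReal.ofReal_ne_top
  have hT : Tendsto (fun n : ℕ => (n : ℝ) + 1) atTop atTop :=
    tendsto_atTop_add_const_right _ _ tendsto_natCast_atTop_atTop
  refine ⟨fun n => ?_, fun k n => hI _ n, fun k => ?_, fun s _ n => hI _ n, fun s hs => ?_⟩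
  · refine Measure.ae_smul_measure ?_ _
    rw [ae_dirac_iff measurableSet_Ioi]
    exact hn n
  · simp only [hint, Real.rpow_one]
    have h1 : Tendsto (fun n : ℕ => (k : ℝ) + (Real.exp (-(k * ((n : ℝ) + 1))) - 1) / ((n : ℝ) + 1))
        atTop (𝓝 (k + 0)) := by
      refine tendsto_const_nhds.add (squeeze_zero_norm (fun n => ?_)
        (tendsto_const_nhds (x := (1 : ℝ)) |>.div_atTop hT))
      rw [norm_div, Real.norm_of_nonneg (hn n).le]
      gcongr
      rw [Real.norm_eq_abs, abs_le]
      have := Real.exp_pos (-(k * ((n : ℝ) + 1)))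
      have : Real.exp (-(k * ((n : ℝ) + 1))) ≤ 1 := by
        rw [Real.exp_le_one_iff]
        have : 0 ≤ (k : ℝ) * ((n : ℝ) + 1) := by positivity
        linarith
      constructor <;> linarith
    rw [add_zero] at h1
    refine h1.congr fun n => ?_
    have := hn n
    rw [expKernel]
    field_simp
    ring
  · simp only [hint]
    have h1 := (tendsto_mul_arctan_inv.comp (hT.atTop_div_const hs)).const_mul (s / 2)
    rw [cConst_one, show (2 : ℝ) - 1 = 1 by norm_num, Real.rpow_one]
    have hpi := Real.pi_ne_zero
    rw [show Real.pi / 2 * (1 / Real.pi) * s = s / 2 * 1 by field_simp]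
    refine h1.congr fun n => ?_
    have := hn n
    rw [Function.comp_apply, one_div_div]
    field_simp

lemma exists_isModel {α : ℝ} (h1 : 1 ≤ α) (h2 : α < 2) : ∃ ρ, IsModel α ρ := by
  rcases h1.eq_or_lt with rfl | h1
  · exact ⟨_, isModel_dirac⟩
  · exact ⟨_, isModel_powerMeasure h1 h2⟩

variable {α : ℝ} {ρ : ℕ → Measure ℝ}

theorem tendsto_arctan_of_expKernel (h1 : 1 ≤ α) (h2 : α < 2) (hρ : ∀ i, ∀ᵐ u ∂(ρ i), 0 < u)
    (hi : ∀ (k : ℕ) i, Integrable (expKernel k) (ρ i))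
    (ht : ∀ k : ℕ, Tendsto (fun i => ∫ u, expKernel k u ∂(ρ i)) atTop (𝓝 ((k : ℝ) ^ α))) :
    Tendsto (fun i => ∫ u, Real.arctan (1 / u) ∂(ρ i)) atTop (𝓝 (Real.pi / 2 * cConst α)) := by
  obtain ⟨ρ', hM⟩ := exists_isModel h1 h2
  have h := (close_arctan_of_expKernel hρ hM.pos hi hM.int_exp ht hM.lim_exp).lim.add
    (hM.lim_arctan 1 one_pos)
  simpa using h

theorem tendsto_expKernel_of_arctan (h1 : 1 ≤ α) (h2 : α < 2) (hρ : ∀ i, ∀ᵐ u ∂(ρ i), 0 < u)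
    (hi : ∀ s > 0, ∀ i, Integrable (fun u => Real.arctan (s / u)) (ρ i))
    (ht : ∀ s > 0, Tendsto (fun i => ∫ u, Real.arctan (s / u) ∂(ρ i)) atTop
      (𝓝 (Real.pi / 2 * cConst α * s ^ (2 - α)))) :
    Tendsto (fun i => ∫ u, expKernel 1 u ∂(ρ i)) atTop (𝓝 1) := by
  obtain ⟨ρ', hM⟩ := exists_isModel h1 h2
  have hθ : ∀ s > 0, HasDerivAt (fun s : ℝ => Real.pi / 2 * cConst α * s ^ (2 - α))
      (Real.pi / 2 * cConst α * ((2 - α) * s ^ (2 - α - 1))) s := fun s hs =>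
    (Real.hasDerivAt_rpow_const (Or.inl hs.ne')).const_mul _
  have h := (close_expKernel_of_arctan hρ hM.pos (L := atTop) hθ hi hM.int_arctan ht
    hM.lim_arctan).lim.add (hM.lim_exp 1)
  simpa using h

end Model

/-! ### Pointwise comparison of the kernels -/

section Elementary

variable {l : ℝ}

lemma neg_log_pos (hl : l ∈ Set.Ioo (0 : ℝ) 1) : 0 < -Real.log l :=
  neg_pos.mpr (Real.log_neg hl.1 hl.2)

lemma one_sub_le_neg_log (hl : l ∈ Set.Ioo (0 : ℝ) 1) : 1 - l ≤ -Real.log l := by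
  linarith [Real.log_le_sub_one_of_pos hl.1]

lemma neg_log_mul_le (hl : l ∈ Set.Ioo (0 : ℝ) 1) : -Real.log l * l ≤ 1 - l := by
  have h := Real.one_sub_inv_le_log_of_pos hl.1
  have h2 : -Real.log l ≤ l⁻¹ - 1 := by linarith
  calc -Real.log l * l ≤ (l⁻¹ - 1) * l := mul_le_mul_of_nonneg_right h2 hl.1.le
    _ = 1 - l := by have := hl.1.ne'; field_simp

lemma two_mul_le_neg_log_mul (hl : l ∈ Set.Ioo (0 : ℝ) 1) :
    2 * (1 - l) ≤ -Real.log l * (1 + l) := by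
  have hl0 := hl.1
  have hx : 0 ≤ l⁻¹ - 1 := by
    have := (one_lt_inv₀ hl.1).mpr hl.2
    linarith
  have h := Real.le_log_one_add_of_nonneg hx
  rw [add_sub_cancel, Real.log_inv, div_le_iff₀ (by linarith)] at h
  have h2 := mul_le_mul_of_nonneg_right h hl0.le
  have e1 : 2 * (l⁻¹ - 1) * l = 2 * (1 - l) := by field_simp
  have e2 : -Real.log l * (l⁻¹ - 1 + 2) * l = -Real.log l * (1 + l) := by field_simp; ring
  linarith

/-- With y = -log l this is y/2 ≤ sinh(y/2), squared. -/
lemma mul_sq_neg_log_le (hl : l ∈ Set.Ioo (0 : ℝ) 1) : l * (-Real.log l) ^ 2 ≤ (1 - l) ^ 2 := by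
  set y := -Real.log l with hy
  have hy0 : 0 < y := neg_log_pos hl
  have hle : l = Real.exp (-(y / 2)) ^ 2 := by
    rw [← Real.exp_nat_mul]
    push_cast
    rw [show 2 * -(y / 2) = Real.log l by rw [hy]; ring, Real.exp_log hl.1]
  have hs := Real.self_le_sinh_iff.mpr (show 0 ≤ y / 2 by positivity)
  rw [Real.sinh_eq] at hs
  set E := Real.exp (-(y / 2)) with hE
  have hE0 : 0 < E := Real.exp_pos _
  have hmul : Real.exp (y / 2) * E = 1 := by rw [hE, ← Real.exp_add]; simp
  have h1 : E * y ≤ 1 - E ^ 2 := by nlinarith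
  rw [hle]
  have : 0 ≤ E * y := by positivity
  calc E ^ 2 * y ^ 2 = (E * y) ^ 2 := by ring
    _ ≤ (1 - E ^ 2) ^ 2 := by gcongr

/-- In y = -log l the first term is coth(y/2), and 2/y is its polar part at 0. In
`abs_inv_sq_sub_le` the pair is 1/(4 sinh²(y/2)) and 1/y². -/
lemma abs_ratio_sub_le (hl : l ∈ Set.Ioo (0 : ℝ) 1) :
    |(1 + l) / (1 - l) - 2 / (-Real.log l)| ≤ 1 := by
  have hy := neg_log_pos hl
  have h1 := one_sub_le_neg_log hl
  have h2 := neg_log_mul_le hl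
  set y := -Real.log l
  have h3 : 0 < 1 - l := by linarith [hl.2]
  have e : (1 + l) / (1 - l) - 2 / y = ((1 + l) * y - 2 * (1 - l)) / ((1 - l) * y) := by
    field_simp
  rw [e, abs_div, abs_of_pos (mul_pos h3 hy), div_le_one (mul_pos h3 hy), abs_le]
  constructor <;> nlinarith

lemma abs_inv_sq_sub_le (hl : l ∈ Set.Ioo (0 : ℝ) 1) :
    |l / (1 - l) ^ 2 - 1 / (-Real.log l) ^ 2| ≤ 1 := by
  have hy := neg_log_pos hl
  have h1 := two_mul_le_neg_log_mul hl
  have h2 := mul_sq_neg_log_le hl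
  set y := -Real.log l
  have h3 : 0 < 1 - l := by linarith [hl.2]
  have hp : 0 < (1 - l) ^ 2 * y ^ 2 := by positivity
  have e : l / (1 - l) ^ 2 - 1 / y ^ 2 = (l * y ^ 2 - (1 - l) ^ 2) / ((1 - l) ^ 2 * y ^ 2) := by
    field_simp
  rw [e, abs_div, abs_of_pos hp, div_le_one hp, abs_le]
  have h4 : (2 * (1 - l)) ^ 2 ≤ (y * (1 + l)) ^ 2 := by gcongr
  constructor
  · nlinarith
  · nlinarith

lemma expKernel_le {s u : ℝ} (hs : 0 ≤ s) (hu : 0 < u) : expKernel s u ≤ 2 * s ^ 2 := by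
  have hx : 0 ≤ s * u := by positivity
  have key : Real.exp (-(s * u)) - 1 + s * u ≤ (s * u) ^ 2 := by
    rcases le_total (s * u) 1 with h | h
    · have := Real.abs_exp_sub_one_sub_id_le (x := -(s * u)) (by rw [abs_neg, abs_of_nonneg hx]; exact h)
      have := (abs_le.mp this).2
      nlinarith
    · have : Real.exp (-(s * u)) ≤ 1 := by rw [Real.exp_le_one_iff]; linarith
      nlinarith
  rw [expKernel, div_le_iff₀ (by positivity)]
  nlinarith

/-- Since e^{n log l} = l^n exactly, only the two rational coefficients differ, each by at most 1.
The constant is shared with the case l ≤ 0. -/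
lemma varKernel_sub_expKernel_le (hl : l ∈ Set.Ioo (0 : ℝ) 1) (n : ℕ) :
    |varKernel n l - expKernel n (-Real.log l)| ≤ 4 * ((n : ℝ) + 1) := by
  have hy := neg_log_pos hl
  have ha := abs_ratio_sub_le hl
  have hb := abs_inv_sq_sub_le hl
  have hpow : Real.exp (-((n : ℝ) * (-Real.log l))) = l ^ n := by
    rw [mul_neg, neg_neg, Real.exp_nat_mul, Real.exp_log hl.1]
  have e : varKernel n l - expKernel n (-Real.log l) =
      n * ((1 + l) / (1 - l) - 2 / (-Real.log l)) -
        2 * (1 - l ^ n) * (l / (1 - l) ^ 2 - 1 / (-Real.log l) ^ 2) := by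
    rw [varKernel, expKernel, hpow]
    have : 1 - l ≠ 0 := by linarith [hl.2]
    have : Real.log l ≠ 0 := (Real.log_neg hl.1 hl.2).ne
    field_simp
    ring
  have hp0 : 0 ≤ l ^ n := pow_nonneg hl.1.le n
  have hp1 : l ^ n ≤ 1 := pow_le_one₀ hl.1.le hl.2.le
  have hn : (0 : ℝ) ≤ n := n.cast_nonneg
  rw [e]
  refine (abs_sub _ _).trans ?_
  rw [abs_mul, abs_mul, abs_of_nonneg hn, abs_of_nonneg (show 0 ≤ 2 * (1 - l ^ n) by linarith)]
  have := mul_le_mul_of_nonneg_left ha hn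
  have := mul_le_mul_of_nonneg_left hb (show 0 ≤ 2 * (1 - l ^ n) by linarith)
  linarith

lemma abs_varKernel_le_of_nonpos (h1 : -1 < l) (h2 : l ≤ 0) (n : ℕ) :
    |varKernel n l| ≤ 4 * ((n : ℝ) + 1) := by
  have hn : (0 : ℝ) ≤ n := n.cast_nonneg
  have h3 : 0 < 1 - l := by linarith
  have hr0 : 0 ≤ (1 + l) / (1 - l) := div_nonneg (by linarith) h3.le
  have hr1 : (1 + l) / (1 - l) ≤ 1 := by rw [div_le_one h3]; linarith
  have hp : |l ^ n| ≤ 1 := by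
    rw [abs_pow]; exact pow_le_one₀ (abs_nonneg _) (abs_le.mpr ⟨by linarith, by linarith⟩)
  have hp' : |1 - l ^ n| ≤ 2 := (abs_sub _ _).trans (by rw [abs_one]; linarith)
  have hl : |l| ≤ 1 := abs_le.mpr ⟨by linarith, by linarith⟩
  have hd : 1 ≤ (1 - l) ^ 2 := by nlinarith
  have h4 : |2 * l * (1 - l ^ n) / (1 - l) ^ 2| ≤ 4 := by
    rw [abs_div, abs_of_pos (by positivity : 0 < (1 - l) ^ 2), div_le_iff₀ (by positivity), abs_mul,
      abs_mul, abs_two]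
    have : |l| * |1 - l ^ n| ≤ 1 * 2 := mul_le_mul hl hp' (abs_nonneg _) zero_le_one
    nlinarith
  rw [varKernel]
  refine (abs_sub _ _).trans ?_
  rw [abs_mul, abs_of_nonneg hn, abs_of_nonneg hr0]
  nlinarith

lemma abs_arctan_sub_le {a b : ℝ} (ha : 0 ≤ a) (hb : 0 ≤ b) :
    |Real.arctan a - Real.arctan b| ≤ |a - b| := by
  wlog h : b ≤ a generalizing a b with H
  · rw [abs_sub_comm, abs_sub_comm a b]; exact H hb ha (le_of_not_ge h)
  rcases h.eq_or_lt with rfl | h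
  · simp
  · have := (arctan_sub_bounds hb h one_pos).2
    rw [div_one, div_one] at this
    rw [abs_of_nonneg (sub_nonneg.mpr (Real.arctan_strictMono.monotone h.le)), abs_of_pos (by linarith)]
    refine this.trans (mul_le_of_le_one_right (by linarith) ?_)
    rw [div_le_one (by positivity)]
    nlinarith

lemma tan_half_bounds {x : ℝ} (h0 : 0 < x) (h1 : x ≤ 1) :
    x ≤ 2 * Real.tan (x / 2) ∧ 2 * Real.tan (x / 2) - x ≤ 2 * x ^ 2 := by
  have hpi := Real.pi_gt_three
  refine ⟨by linarith [Real.le_tan (x := x / 2) (by linarith) (by linarith)], ?_⟩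
  have hc := Real.one_sub_sq_div_two_le_cos (x := x / 2)
  have hs := Real.sin_le (x := x / 2) (by linarith)
  have hc0 : 0 < Real.cos (x / 2) := by nlinarith
  have : Real.tan (x / 2) ≤ x / 2 + x ^ 2 := by
    rw [Real.tan_eq_sin_div_cos, div_le_iff₀ hc0]
    have hx2 : x ^ 2 ≤ 1 := by nlinarith
    nlinarith [mul_le_mul_of_nonneg_left hc (show 0 ≤ x / 2 + x ^ 2 by positivity),
      mul_nonneg h0.le (sub_nonneg.mpr hx2), mul_nonneg (sq_nonneg x) (sub_nonneg.mpr hx2)]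
  linarith

/-- Two replacements: (1+l)/(1-l) by 2/y costs at most tan(x/2), and 2 tan(x/2) by x costs at most
2x²y/(x²+y²) ≤ x. -/
lemma arctan_kernel_sub_le (hl : l ∈ Set.Ioo (0 : ℝ) 1) {x : ℝ} (h0 : 0 < x) (h1 : x ≤ 1) :
    |Real.arctan ((1 + l) / (1 - l) * Real.tan (x / 2)) - Real.arctan (x / (-Real.log l))| ≤
      3 * x := by
  obtain ⟨t1, t2⟩ := tan_half_bounds h0 h1
  have hy := neg_log_pos hl
  have ha := abs_ratio_sub_le hl
  set y := -Real.log l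
  set τ := Real.tan (x / 2)
  have hτ : 0 < τ := by linarith
  have h3 : 0 < 1 - l := by linarith [hl.2]
  have hc : 0 ≤ (1 + l) / (1 - l) := div_nonneg (by linarith [hl.1]) h3.le
  have b1 : |Real.arctan ((1 + l) / (1 - l) * τ) - Real.arctan (2 * τ / y)| ≤ 2 * x := by
    refine (abs_arctan_sub_le (by positivity) (by positivity)).trans ?_
    rw [show (1 + l) / (1 - l) * τ - 2 * τ / y = ((1 + l) / (1 - l) - 2 / y) * τ by ring, abs_mul,
      abs_of_pos hτ]
    nlinarith
  have b2 : |Real.arctan (2 * τ / y) - Real.arctan (x / y)| ≤ x := by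
    rcases t1.eq_or_lt with h | h
    · rw [← h, sub_self, abs_zero]; exact h0.le
    · have h5 := (arctan_sub_bounds h0.le h hy).2
      rw [abs_of_nonneg (sub_nonneg.mpr (Real.arctan_strictMono.monotone (by gcongr)))]
      refine h5.trans ?_
      rw [← mul_div_assoc, div_le_iff₀ (by positivity)]
      have : (2 * τ - x) * y ≤ 2 * x ^ 2 * y := mul_le_mul_of_nonneg_right t2 hy.le
      nlinarith [mul_nonneg h0.le (sq_nonneg (x - y))]
  have := abs_sub_le (Real.arctan ((1 + l) / (1 - l) * τ)) (Real.arctan (2 * τ / y))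
    (Real.arctan (x / y))
  linarith

lemma abs_arctan_kernel_le_of_nonpos (h1 : -1 < l) (h2 : l ≤ 0) {x : ℝ} (h0 : 0 < x) (hx : x ≤ 1) :
    |Real.arctan ((1 + l) / (1 - l) * Real.tan (x / 2))| ≤ 3 * x := by
  obtain ⟨t1, t2⟩ := tan_half_bounds h0 hx
  have h3 : 0 < 1 - l := by linarith
  have hr0 : 0 ≤ (1 + l) / (1 - l) := div_nonneg (by linarith) h3.le
  have hr1 : (1 + l) / (1 - l) ≤ 1 := by rw [div_le_one h3]; linarith
  have hτ : 0 < Real.tan (x / 2) := by linarith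
  have h := abs_arctan_sub_le (mul_nonneg hr0 hτ.le) le_rfl
  rw [Real.arctan_zero, sub_zero, sub_zero, abs_of_nonneg (mul_nonneg hr0 hτ.le)] at h
  refine h.trans ?_
  nlinarith

lemma arctan_one_sub_sub_le (hl : l ∈ Set.Ioo (0 : ℝ) 1) {x : ℝ} (h0 : 0 < x) :
    |Real.arctan (x / (1 - l)) - Real.arctan (x / (-Real.log l))| ≤ x := by
  have hy := neg_log_pos hl
  have h1 := one_sub_le_neg_log hl
  have h2 := neg_log_mul_le hl
  set y := -Real.log l
  have h3 : 0 < 1 - l := by linarith [hl.2]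
  refine (abs_arctan_sub_le (by positivity) (by positivity)).trans ?_
  have e : x / (1 - l) - x / y = x * ((y - (1 - l)) / ((1 - l) * y)) := by field_simp
  rw [e, abs_mul, abs_of_pos h0, abs_of_nonneg (div_nonneg (by linarith) (by positivity))]
  refine mul_le_of_le_one_right h0.le ?_
  rw [div_le_one (by positivity)]
  nlinarith

end Elementary

/-! ### Principal parts of the variance, of F and of the integral of r -/

section Comparison

variable {ν : Measure ℝ}

/-- The principal part of the variance, with the spectral measure restricted to `(0, 1)`. -/
noncomputable def varMain (ν : Measure ℝ) (s : ℝ) : ℝ :=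
  ∫ l in Set.Ioo (0 : ℝ) 1, expKernel s (-Real.log l) ∂ν

/-- The principal part of the spectral distribution function. -/
noncomputable def arctanMain (ν : Measure ℝ) (x : ℝ) : ℝ :=
  ∫ l in Set.Ioo (0 : ℝ) 1, Real.arctan (x / (-Real.log l)) ∂ν

/-- Both comparisons are instances: f minus the extension of g by zero is bounded, which also yields
integrability of f. -/
lemma abs_integral_sub_setIntegral_le [IsFiniteMeasure ν] (hν : ∀ᵐ l ∂ν, l ∈ Set.Ioo (-1 : ℝ) 1)
    {f g : ℝ → ℝ} {C : ℝ} (hf : AEStronglyMeasurable f ν) (hg : IntegrableOn g (Set.Ioo 0 1) ν)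
    (h1 : ∀ l ∈ Set.Ioo (0 : ℝ) 1, |f l - g l| ≤ C) (h2 : ∀ l, -1 < l → l ≤ 0 → |f l| ≤ C) :
    |∫ l, f l ∂ν - ∫ l in Set.Ioo (0 : ℝ) 1, g l ∂ν| ≤ C * ν.real Set.univ := by
  have hgi : Integrable ((Set.Ioo (0 : ℝ) 1).indicator g) ν := hg.integrable_indicator measurableSet_Ioo
  have hb : ∀ᵐ l ∂ν, ‖f l - (Set.Ioo (0 : ℝ) 1).indicator g l‖ ≤ C := by
    filter_upwards [hν] with l hl
    by_cases h : l ∈ Set.Ioo (0 : ℝ) 1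
    · rw [Set.indicator_of_mem h]; exact h1 l h
    · rw [Set.indicator_of_notMem h, sub_zero]
      refine h2 l hl.1 ?_
      by_contra hc
      exact h ⟨not_le.mp hc, hl.2⟩
  have hd : Integrable (fun l => f l - (Set.Ioo (0 : ℝ) 1).indicator g l) ν :=
    Integrable.of_bound (hf.sub hgi.aestronglyMeasurable) C hb
  have hfi : Integrable f ν := (hd.add hgi).congr (Eventually.of_forall fun l => by simp)
  rw [← integral_indicator measurableSet_Ioo, ← integral_sub hfi hgi]
  exact norm_integral_le_of_norm_le_const hb

lemma measurable_varKernel (n : ℕ) : Measurable (varKernel n) := by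
  unfold varKernel; fun_prop

lemma integrableOn_expKernel [IsFiniteMeasure ν] {s : ℝ} (hs : 0 ≤ s) :
    IntegrableOn (fun l => expKernel s (-Real.log l)) (Set.Ioo 0 1) ν := by
  refine Integrable.of_bound (((measurable_expKernel s).comp
    Real.measurable_log.neg).aestronglyMeasurable) (2 * s ^ 2) ?_
  filter_upwards [ae_restrict_mem measurableSet_Ioo] with l hl
  rw [Real.norm_of_nonneg (expKernel_nonneg _ _)]
  exact expKernel_le hs (neg_log_pos hl)

lemma integrable_arctan {μ : Measure ℝ} [IsFiniteMeasure μ] {f : ℝ → ℝ} (hf : Measurable f) :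
    Integrable (fun l => Real.arctan (f l)) μ := by
  refine Integrable.of_bound (Real.measurable_arctan.comp hf).aestronglyMeasurable (Real.pi / 2)
    (Eventually.of_forall fun l => ?_)
  exact abs_le.mpr ⟨(Real.neg_pi_div_two_lt_arctan _).le, (Real.arctan_lt_pi_div_two _).le⟩

lemma abs_integral_varKernel_sub_le [IsFiniteMeasure ν] (hν : ∀ᵐ l ∂ν, l ∈ Set.Ioo (-1 : ℝ) 1)
    (n : ℕ) : |∫ l, varKernel n l ∂ν - varMain ν n| ≤ 4 * ((n : ℝ) + 1) * ν.real Set.univ :=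
  abs_integral_sub_setIntegral_le hν (measurable_varKernel n).aestronglyMeasurable
    (integrableOn_expKernel n.cast_nonneg) (fun _ hl => varKernel_sub_expKernel_le hl n)
    fun _ h1 h2 => abs_varKernel_le_of_nonpos h1 h2 n

lemma abs_integral_arctan_sub_le [IsFiniteMeasure ν] (hν : ∀ᵐ l ∂ν, l ∈ Set.Ioo (-1 : ℝ) 1)
    {x : ℝ} (h0 : 0 < x) (h1 : x ≤ 1) :
    |∫ l, Real.arctan ((1 + l) / (1 - l) * Real.tan (x / 2)) ∂ν - arctanMain ν x| ≤
      3 * x * ν.real Set.univ :=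
  abs_integral_sub_setIntegral_le hν
    (integrable_arctan (by fun_prop)).aestronglyMeasurable
    (integrable_arctan (by fun_prop)) (fun _ hl => arctan_kernel_sub_le hl h0 h1)
    fun _ hl1 hl2 => abs_arctan_kernel_le_of_nonpos hl1 hl2 h0 h1

lemma integral_inv_sq_add_sq {x a : ℝ} (hx : 0 < x) (ha : 0 < a) (ha1 : a ≤ 1) :
    ∫ y in Set.Ioc a 1, 1 / (x ^ 2 + y ^ 2) = (Real.arctan (x / a) - Real.arctan x) / x := by
  rw [← intervalIntegral.integral_of_le ha1]
  have hd : ∀ y ∈ Set.uIcc a 1, HasDerivAt (fun y => Real.arctan (y / x) / x)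
      (1 / (x ^ 2 + y ^ 2)) y := by
    intro y _
    refine (((hasDerivAt_id y).div_const x).arctan.div_const x).congr_deriv ?_
    simp only [id]
    field_simp
  rw [intervalIntegral.integral_eq_sub_of_hasDerivAt hd
    (Continuous.intervalIntegrable (Continuous.div (by fun_prop) (by fun_prop)
      fun t => by positivity) _ _), show a / x = (x / a)⁻¹ by rw [inv_div],
    one_div, Real.arctan_inv_of_pos hx, Real.arctan_inv_of_pos (by positivity)]
  ring

/-- Writing r(y) as the ν-integral of the indicator of 1 - y < λ < 1 and exchanging integrals leaves
∫ dy/(x²+y²) over (1-λ, 1], which is empty for λ ≤ 0. -/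
lemma integral_rFun [IsFiniteMeasure ν] (hν : ∀ᵐ l ∂ν, l ∈ Set.Ioo (-1 : ℝ) 1)
    {x : ℝ} (hx : 0 < x) :
    ∫ y in (0 : ℝ)..1, rFun ν y / (x ^ 2 + y ^ 2) =
      ∫ l in Set.Ioo (0 : ℝ) 1, (Real.arctan (x / (1 - l)) - Real.arctan x) / x ∂ν := by
  let D : Set (ℝ × ℝ) := {p | 1 - p.1 < p.2 ∧ p.2 < 1}
  have hD : MeasurableSet D :=
    (measurableSet_lt (measurable_const.sub measurable_fst) measurable_snd).inter
      (measurableSet_lt measurable_snd measurable_const)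
  have hm : Measurable (fun p : ℝ × ℝ => 1 / (x ^ 2 + p.1 ^ 2)) := by fun_prop
  have hI : Integrable (D.indicator fun p : ℝ × ℝ => 1 / (x ^ 2 + p.1 ^ 2))
      ((volume.restrict (Set.Ioc 0 1)).prod ν) := by
    refine Integrable.of_bound (hm.indicator hD).aestronglyMeasurable (1 / x ^ 2)
      (Eventually.of_forall fun p => (norm_indicator_le_norm_self _ _).trans ?_)
    rw [Real.norm_of_nonneg (by positivity)]
    gcongr
    nlinarith [sq_nonneg p.1]
  have e1 : ∀ y, rFun ν y / (x ^ 2 + y ^ 2) =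
      ∫ l, (D.indicator fun p : ℝ × ℝ => 1 / (x ^ 2 + p.1 ^ 2)) (y, l) ∂ν := by
    intro y
    have : ∀ l, (D.indicator fun p : ℝ × ℝ => 1 / (x ^ 2 + p.1 ^ 2)) (y, l) =
        (Set.Ioo (1 - y) 1).indicator (fun _ => 1 / (x ^ 2 + y ^ 2)) l := fun l => rfl
    simp only [this]
    rw [integral_indicator_const _ measurableSet_Ioo, rFun, smul_eq_mul, mul_one_div]
  rw [intervalIntegral.integral_of_le zero_le_one]
  simp only [e1]
  rw [integral_integral_swap (f := fun y l => (D.indicator fun p : ℝ × ℝ => 1 / (x ^ 2 + p.1 ^ 2)) (y, l)) hI,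
    ← integral_indicator measurableSet_Ioo]
  refine integral_congr_ae ?_
  filter_upwards [hν] with l hl
  by_cases h : l ∈ Set.Ioo (0 : ℝ) 1
  · rw [Set.indicator_of_mem h, ← integral_inv_sq_add_sq hx (by linarith [h.2]) (by linarith [h.1])]
    have e : ∀ y, (D.indicator fun p : ℝ × ℝ => 1 / (x ^ 2 + p.1 ^ 2)) (y, l) =
        (Set.Ioi (1 - l)).indicator (fun y => 1 / (x ^ 2 + y ^ 2)) y := by
      intro y
      by_cases hy : 1 - l < y
      · rw [Set.indicator_of_mem (show (y, l) ∈ D from ⟨by simp only; linarith, h.2⟩),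
          Set.indicator_of_mem (show y ∈ Set.Ioi (1 - l) from hy)]
      · rw [Set.indicator_of_notMem, Set.indicator_of_notMem (show y ∉ Set.Ioi (1 - l) from hy)]
        rintro ⟨h1, -⟩
        simp only at h1
        exact hy (by linarith)
    simp only [e]
    rw [setIntegral_indicator measurableSet_Ioi]
    congr 2
    ext y
    simp only [Set.mem_inter_iff, Set.mem_Ioc, Set.mem_Ioi]
    constructor
    · rintro ⟨⟨a, b⟩, c⟩; exact ⟨c, b⟩
    · rintro ⟨c, b⟩; exact ⟨⟨by linarith [h.2], b⟩, c⟩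
  · rw [Set.indicator_of_notMem h]
    have hl0 : l ≤ 0 := by
      by_contra hc
      exact h ⟨not_le.mp hc, hl.2⟩
    rw [setIntegral_congr_fun measurableSet_Ioc (g := fun _ => 0), integral_zero]
    intro y hy
    refine Set.indicator_of_notMem ?_ _
    rintro ⟨h1, -⟩
    simp only at h1
    linarith [hy.2]

lemma abs_integral_rFun_sub_le [IsFiniteMeasure ν] (hν : ∀ᵐ l ∂ν, l ∈ Set.Ioo (-1 : ℝ) 1)
    {x : ℝ} (hx : 0 < x) :
    |(∫ y in (0 : ℝ)..1, rFun ν y / (x ^ 2 + y ^ 2)) - arctanMain ν x / x| ≤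
      2 * ν.real Set.univ := by
  have hb : ∀ᵐ l ∂(ν.restrict (Set.Ioo 0 1)), ‖(Real.arctan (x / (1 - l)) - Real.arctan x) / x -
      Real.arctan (x / (-Real.log l)) / x‖ ≤ 2 := by
    filter_upwards [ae_restrict_mem measurableSet_Ioo] with l hl
    have h1 := arctan_one_sub_sub_le hl hx
    have h2 := (arctan_bounds hx).2
    have h3 := Real.arctan_pos.mpr hx
    rw [Real.norm_eq_abs, ← sub_div, abs_div, abs_of_pos hx, div_le_iff₀ hx]
    rw [abs_le] at h1 ⊢
    constructor <;> linarith [h1.1, h1.2]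
  rw [integral_rFun hν hx, arctanMain, ← integral_div, ← integral_sub]
  · refine (norm_integral_le_of_norm_le_const hb).trans ?_
    rw [measureReal_restrict_apply_univ]
    exact mul_le_mul_of_nonneg_left (measureReal_mono (Set.subset_univ _)) zero_le_two
  · exact ((integrable_arctan (by fun_prop)).sub (integrable_const _)).div_const _
  · exact (integrable_arctan (by fun_prop)).div_const _

end Comparison

/-! ### Rescaled spectral measures -/

section Scaling

variable {ν : Measure ℝ}

/-- The spectral measure on `(0, 1)` in the variable `-m log λ`, normalised by `N`. -/
noncomputable def scaledMeasure (ν : Measure ℝ) (m N : ℝ) : Measure ℝ :=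
  ENNReal.ofReal N⁻¹ • (ν.restrict (Set.Ioo 0 1)).map fun l => m * (-Real.log l)

lemma isFiniteMeasure_scaledMeasure [IsFiniteMeasure ν] (m N : ℝ) :
    IsFiniteMeasure (scaledMeasure ν m N) := by
  have := Measure.isFiniteMeasure_map (ν.restrict (Set.Ioo 0 1)) fun l => m * (-Real.log l)
  exact Measure.smul_finite _ ENNReal.ofReal_ne_top

lemma ae_pos_scaledMeasure {m : ℝ} (hm : 0 < m) (N : ℝ) : ∀ᵐ u ∂(scaledMeasure ν m N), 0 < u := by
  refine Measure.ae_smul_measure ?_ _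
  rw [ae_map_iff (by fun_prop) measurableSet_Ioi]
  filter_upwards [ae_restrict_mem measurableSet_Ioo] with l hl
  exact mul_pos hm (neg_log_pos hl)

lemma integral_scaledMeasure {m N : ℝ} (hN : 0 < N) {f : ℝ → ℝ} (hf : Measurable f) :
    ∫ u, f u ∂(scaledMeasure ν m N) =
      N⁻¹ * ∫ l in Set.Ioo (0 : ℝ) 1, f (m * (-Real.log l)) ∂ν := by
  rw [scaledMeasure, integral_smul_measure, integral_map (by fun_prop) hf.aestronglyMeasurable,
    ENNReal.toReal_ofReal (inv_pos.mpr hN).le, smul_eq_mul]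

/-- Homogeneity: K_s(mu) = m^{-2} K_{sm}(u). -/
lemma integral_expKernel_scaledMeasure {m N : ℝ} (hm : 0 < m) (hN : 0 < N) (s : ℝ) :
    ∫ u, expKernel s u ∂(scaledMeasure ν m N) = varMain ν (s * m) / (m ^ 2 * N) := by
  rw [integral_scaledMeasure hN (measurable_expKernel s), varMain]
  have e : ∀ l, expKernel s (m * (-Real.log l)) = (m ^ 2)⁻¹ * expKernel (s * m) (-Real.log l) := by
    intro l
    rw [expKernel, expKernel, mul_pow, ← mul_assoc s m]
    rw [div_eq_mul_inv, div_eq_mul_inv, mul_inv]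
    ring
  simp only [e]
  rw [integral_const_mul]
  field_simp

lemma integral_arctan_scaledMeasure {m N : ℝ} (hN : 0 < N) (s : ℝ) :
    ∫ u, Real.arctan (s / u) ∂(scaledMeasure ν m N) = arctanMain ν (s / m) / N := by
  rw [integral_scaledMeasure hN (by fun_prop), arctanMain, div_eq_inv_mul]
  simp only [div_div]

lemma integrable_expKernel_scaledMeasure [IsFiniteMeasure ν] {m : ℝ} (hm : 0 < m) (N : ℝ) {s : ℝ}
    (hs : 0 ≤ s) : Integrable (expKernel s) (scaledMeasure ν m N) := by
  have := isFiniteMeasure_scaledMeasure (ν := ν) m N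
  refine Integrable.of_bound (measurable_expKernel s).aestronglyMeasurable (2 * s ^ 2) ?_
  filter_upwards [ae_pos_scaledMeasure hm N] with u hu
  rw [Real.norm_of_nonneg (expKernel_nonneg _ _)]
  exact expKernel_le hs hu

lemma integrable_arctan_scaledMeasure [IsFiniteMeasure ν] (m N s : ℝ) :
    Integrable (fun u => Real.arctan (s / u)) (scaledMeasure ν m N) := by
  have := isFiniteMeasure_scaledMeasure (ν := ν) m N
  exact integrable_arctan (by fun_prop)

end Scaling

/-! ### Reformulating regular variation as limits -/

section Regular

variable {α : ℝ} {h : ℝ → ℝ}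

lemma isEquivalent_zero_iff_tendsto_atTop (hh : SlowlyVarying h) {f : ℝ → ℝ} {c : ℝ} (hc : 0 < c) :
    f ~[𝓝[>] 0] (fun x => c * x ^ (2 - α) * h (1 / x)) ↔
      Tendsto (fun t => f (1 / t) / (t ^ (α - 2) * h t)) atTop (𝓝 c) := by
  have hinv : Tendsto (fun t : ℝ => 1 / t) atTop (𝓝[>] 0) := by
    simpa only [one_div] using tendsto_inv_atTop_nhdsGT_zero (𝕜 := ℝ)
  have hinv' : Tendsto (fun t : ℝ => 1 / t) (𝓝[>] 0) atTop := by
    simpa only [one_div] using tendsto_inv_nhdsGT_zero (𝕜 := ℝ)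
  have hne : ∀ᶠ x : ℝ in 𝓝[>] 0, c * x ^ (2 - α) * h (1 / x) ≠ 0 := by
    filter_upwards [self_mem_nhdsWithin] with x hx
    have hx' : (0 : ℝ) < x := hx
    have := hh.pos (1 / x) (one_div_pos.mpr hx')
    have := Real.rpow_pos_of_pos hx' (2 - α)
    positivity
  have hpow : ∀ t : ℝ, 0 < t → (1 / t) ^ (2 - α) = t ^ (α - 2) := fun t ht => by
    rw [one_div, Real.inv_rpow ht.le, ← Real.rpow_neg ht.le, neg_sub]
  rw [isEquivalent_iff_tendsto_one hne]
  constructor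
  · intro H
    have := (H.comp hinv).const_mul c
    rw [mul_one] at this
    refine this.congr' ?_
    filter_upwards [eventually_gt_atTop 0] with t ht
    simp only [Function.comp_apply, Pi.div_apply, one_div_one_div]
    rw [hpow t ht]
    field_simp
  · intro H
    have := (H.comp hinv').div_const c
    rw [div_self hc.ne'] at this
    refine this.congr' ?_
    filter_upwards [self_mem_nhdsWithin] with x hx
    have hx' : (0 : ℝ) < x := hx
    simp only [Function.comp_apply, Pi.div_apply, one_div_one_div]
    rw [← hpow _ (one_div_pos.mpr hx'), one_div_one_div]
    field_simp

lemma isEquivalent_nat_iff_tendsto (hh : SlowlyVarying h) {V : ℕ → ℝ} :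
    V ~[atTop] (fun n : ℕ => (n : ℝ) ^ α * h n) ↔
      Tendsto (fun n : ℕ => V n / ((n : ℝ) ^ α * h n)) atTop (𝓝 1) := by
  refine isEquivalent_iff_tendsto_one ?_
  filter_upwards [eventually_gt_atTop 0] with n hn
  have hn' : (0 : ℝ) < n := Nat.cast_pos.mpr hn
  exact (mul_pos (Real.rpow_pos_of_pos hn' α) (hh.pos _ hn')).ne'

/-- A function of positive index has no positive limit. -/
lemma eq_one_of_tendsto (hh : SlowlyVarying h) {c : ℝ} (hc : 0 < c)
    (H : Tendsto (fun n : ℕ => (n : ℝ) ^ (α - 1) * h n) atTop (𝓝 c)) : α = 1 := by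
  have h2 : Tendsto (fun n : ℕ => 2 * n) atTop atTop :=
    tendsto_id.const_mul_atTop' (by norm_num)
  -- The ratio of the terms at 2n and n tends to 1 by convergence and to 2^{α-1} by slow variation.
  have h3 := (H.comp h2).div H hc.ne'
  rw [div_self hc.ne'] at h3
  have h4 := ((hh.ratio 2 two_pos).comp tendsto_natCast_atTop_atTop).const_mul ((2 : ℝ) ^ (α - 1))
  rw [mul_one] at h4
  have h5 : (2 : ℝ) ^ (α - 1) = 1 := by
    refine tendsto_nhds_unique h4 (h3.congr' ?_)
    filter_upwards [eventually_gt_atTop 0] with n hn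
    have hn' : (0 : ℝ) < n := Nat.cast_pos.mpr hn
    have := Real.rpow_pos_of_pos hn' (α - 1)
    have := hh.pos _ hn'
    simp only [Function.comp_apply, Pi.div_apply]
    push_cast
    rw [Real.mul_rpow zero_le_two hn'.le]
    field_simp
  have h6 := congrArg Real.log h5
  rw [Real.log_rpow two_pos, Real.log_one, mul_eq_zero] at h6
  rcases h6 with h6 | h6
  · linarith
  · exact absurd h6 (Real.log_pos one_lt_two).ne'

lemma SlowlyVarying.tendsto_of_nat (hh : SlowlyVarying h) {c : ℝ}
    (H : Tendsto (fun n : ℕ => h n) atTop (𝓝 c)) : Tendsto h atTop (𝓝 c) := by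
  have h1 := hh.tendsto_ratio_floor.mul (H.comp tendsto_nat_floor_atTop)
  rw [one_mul] at h1
  refine h1.congr' ?_
  filter_upwards [eventually_ge_atTop 1] with t ht
  have : (1 : ℝ) ≤ (⌊t⌋₊ : ℝ) := by exact_mod_cast (Nat.one_le_floor_iff t).mpr ht
  have := hh.pos (⌊t⌋₊ : ℝ) (by linarith)
  simp only [Function.comp_apply]
  field_simp

end Regular

/-! ### The Tauberian theorem and growth when 1/(1-λ) is not integrable -/

section Infinite

variable {ν : Measure ℝ} {α : ℝ} {h : ℝ → ℝ}

lemma arctanMain_mono [IsFiniteMeasure ν] {x y : ℝ} (hxy : x ≤ y) :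
    arctanMain ν x ≤ arctanMain ν y := by
  refine integral_mono_ae (integrable_arctan (by fun_prop)) (integrable_arctan (by fun_prop)) ?_
  filter_upwards [ae_restrict_mem measurableSet_Ioo] with l hl
  have := neg_log_pos hl
  exact Real.arctan_strictMono.monotone (by gcongr)

/-- Passage from integers to real scales for the arctangent transform. -/
lemma tendsto_arctanMain_of_nat [IsFiniteMeasure ν] (hh : SlowlyVarying h) {c : ℝ}
    (H : Tendsto (fun n : ℕ => arctanMain ν (1 / n) / ((n : ℝ) ^ (α - 2) * h n)) atTop (𝓝 c)) :
    Tendsto (fun t : ℝ => arctanMain ν (1 / t) / (t ^ (α - 2) * h t)) atTop (𝓝 c) := by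
  have hfl : Tendsto (fun t : ℝ => ⌊t⌋₊) atTop atTop := tendsto_nat_floor_atTop
  have hr : Tendsto (fun t : ℝ => (⌊t⌋₊ : ℝ) / t) atTop (𝓝 1) := tendsto_nat_floor_div_atTop
  have hr1 : Tendsto (fun t : ℝ => ((⌊t⌋₊ : ℝ) + 1) / t) atTop (𝓝 1) := by
    have := hr.add (tendsto_const_nhds (x := (1 : ℝ)) |>.div_atTop tendsto_id)
    rw [add_zero] at this
    refine this.congr fun t => ?_
    rw [add_div]; rfl
  have hpow : ∀ {q : ℝ → ℝ}, Tendsto q atTop (𝓝 1) →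
      Tendsto (fun t => q t ^ (α - 2)) atTop (𝓝 1) := fun {q} hq => by
    have := hq.rpow_const (p := α - 2) (Or.inl one_ne_zero)
    rwa [Real.one_rpow] at this
  have hh0 := hh.tendsto_ratio_floor.inv₀ one_ne_zero
  rw [inv_one] at hh0
  have hh1 := (hh.tendsto_ratio_nat_succ.comp hfl).mul hh0
  rw [one_mul] at hh1
  -- As t ↦ `arctanMain ν (1 / t)` decreases, its value at t lies between those at ⌊t⌋ + 1 and ⌊t⌋;
  -- the normalisations at the three points are asymptotically equal.
  have hup := ((H.comp hfl).mul (hpow hr)).mul hh0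
  have hlo := (((H.comp (tendsto_add_atTop_nat 1)).comp hfl).mul (hpow hr1)).mul hh1
  rw [mul_one, mul_one] at hup hlo
  have key : ∀ a t : ℝ, 0 < a → 0 < t → ∀ q : ℝ,
      q / (a ^ (α - 2) * h a) * (a / t) ^ (α - 2) * (h a / h t) = q / (t ^ (α - 2) * h t) := by
    intro a t ha ht q
    have h1 := hh.pos a ha
    have h2 := hh.pos t ht
    have h3 := Real.rpow_pos_of_pos ha (α - 2)
    have h4 := Real.rpow_pos_of_pos ht (α - 2)
    rw [Real.div_rpow ha.le ht.le]
    field_simp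
  refine tendsto_of_tendsto_of_tendsto_of_le_of_le' hlo hup ?_ ?_
  · filter_upwards [eventually_ge_atTop 1] with t ht
    have h1 : (1 : ℝ) ≤ (⌊t⌋₊ : ℝ) := by exact_mod_cast (Nat.one_le_floor_iff t).mpr ht
    have ht0 : 0 < t := by linarith
    have hf0 := hh.pos (⌊t⌋₊ : ℝ) (by linarith)
    have e : h ((⌊t⌋₊ : ℝ) + 1) / h (⌊t⌋₊ : ℝ) * (h t / h (⌊t⌋₊ : ℝ))⁻¹ =
        h ((⌊t⌋₊ : ℝ) + 1) / h t := by
      have := hh.pos t ht0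
      field_simp
    simp only [Function.comp_apply]
    rw [e]
    push_cast
    rw [key _ t (by linarith) ht0]
    have := hh.pos t ht0
    have := Real.rpow_pos_of_pos ht0 (α - 2)
    gcongr
    refine arctanMain_mono ?_
    gcongr
    exact (Nat.lt_floor_add_one t).le
  · filter_upwards [eventually_ge_atTop 1] with t ht
    have h1 : (1 : ℝ) ≤ (⌊t⌋₊ : ℝ) := by exact_mod_cast (Nat.one_le_floor_iff t).mpr ht
    have ht0 : 0 < t := by linarith
    simp only [Function.comp_apply]
    rw [inv_div, key _ t (by linarith) ht0]
    have := hh.pos t ht0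
    have := Real.rpow_pos_of_pos ht0 (α - 2)
    gcongr
    refine arctanMain_mono ?_
    gcongr
    exact Nat.floor_le ht0.le

lemma scale_factor {m : ℝ} (hm : 0 < m) (x : ℝ) : m ^ 2 * (m ^ (α - 2) * x) = m ^ α * x := by
  rw [← mul_assoc, ← Real.rpow_two, ← Real.rpow_add hm, add_sub_cancel]

/-- The Tauberian theorem relating the two transforms of the spectral measure. -/
theorem varMain_iff_arctanMain [IsFiniteMeasure ν] (h1 : 1 ≤ α) (h2 : α < 2)
    (hh : SlowlyVarying h) :
    Tendsto (fun n : ℕ => varMain ν n / ((n : ℝ) ^ α * h n)) atTop (𝓝 1) ↔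
      Tendsto (fun t : ℝ => arctanMain ν (1 / t) / (t ^ (α - 2) * h t)) atTop
        (𝓝 (Real.pi / 2 * cConst α)) := by
  -- The shift by one keeps the scale positive at every index.
  let m : ℕ → ℝ := fun i => (i : ℝ) + 1
  have hm : ∀ i, 0 < m i := fun i => by positivity
  have hmT : Tendsto m atTop atTop :=
    tendsto_atTop_add_const_right _ _ tendsto_natCast_atTop_atTop
  have hcast : ∀ i : ℕ, ((i + 1 : ℕ) : ℝ) = m i := fun i => by simp [m]
  let N : ℕ → ℝ := fun i => m i ^ (α - 2) * h (m i)
  have hN : ∀ i, 0 < N i := fun i => mul_pos (Real.rpow_pos_of_pos (hm i) _) (hh.pos _ (hm i))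
  have hexp : ∀ (s : ℝ) (i : ℕ), ∫ u, expKernel s u ∂(scaledMeasure ν (m i) (N i)) =
      varMain ν (s * m i) / (m i ^ α * h (m i)) := fun s i => by
    rw [integral_expKernel_scaledMeasure (hm i) (hN i), scale_factor (hm i)]
  constructor
  · intro H
    refine tendsto_arctanMain_of_nat hh ?_
    rw [← tendsto_add_atTop_iff_nat 1]
    have := tendsto_arctan_of_expKernel (ρ := fun i => scaledMeasure ν (m i) (N i)) h1 h2
      (fun i => ae_pos_scaledMeasure (hm i) _)
      (fun k i => integrable_expKernel_scaledMeasure (hm i) _ k.cast_nonneg) fun k => ?_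
    · refine this.congr fun i => ?_
      rw [integral_arctan_scaledMeasure (hN i), hcast]
    · simp only [hexp]
      rcases Nat.eq_zero_or_pos k with rfl | hk
      · rw [Nat.cast_zero, Real.zero_rpow (by linarith)]
        have : varMain ν 0 = 0 := by simp [varMain, expKernel]
        simp [this]
      · have hk' : (0 : ℝ) < k := Nat.cast_pos.mpr hk
        -- With k an integer, the scale k(i + 1) is again an integer, so the hypothesis along
        -- integers suffices.
        have hkT : Tendsto (fun i : ℕ => k * (i + 1)) atTop atTop :=
          (tendsto_add_atTop_nat 1).const_mul_atTop' hk
        have h3 := ((H.comp hkT).mul ((hh.ratio k hk').comp hmT)).const_mul ((k : ℝ) ^ α)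
        rw [mul_one, mul_one] at h3
        refine h3.congr fun i => ?_
        simp only [Function.comp_apply]
        rw [Nat.cast_mul, hcast, Real.mul_rpow hk'.le (hm i).le]
        have := hh.pos (m i) (hm i)
        have := hh.pos (k * m i) (mul_pos hk' (hm i))
        have := Real.rpow_pos_of_pos hk' α
        have := Real.rpow_pos_of_pos (hm i) α
        field_simp
  · intro H
    rw [← tendsto_add_atTop_iff_nat 1]
    have := tendsto_expKernel_of_arctan (ρ := fun i => scaledMeasure ν (m i) (N i)) h1 h2
      (fun i => ae_pos_scaledMeasure (hm i) _)
      (fun s _ i => integrable_arctan_scaledMeasure _ _ s) fun s hs => ?_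
    · refine this.congr fun i => ?_
      rw [hexp, one_mul, hcast]
    · have hs' : 0 < s⁻¹ := inv_pos.mpr hs
      have h3 := ((H.comp (hmT.const_mul_atTop hs')).mul ((hh.ratio s⁻¹ hs').comp hmT)).mul_const
        (s ^ (2 - α))
      rw [mul_one] at h3
      refine h3.congr fun i => ?_
      rw [integral_arctan_scaledMeasure (hN i)]
      simp only [Function.comp_apply, N]
      have e1 : 1 / (s⁻¹ * m i) = s / m i := by
        have := hm i
        field_simp
      have e2 : s⁻¹ ^ (α - 2) = s ^ (2 - α) := by
        rw [Real.inv_rpow hs.le, ← Real.rpow_neg hs.le, neg_sub]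
      rw [e1, Real.mul_rpow hs'.le (hm i).le, e2]
      have := hh.pos (m i) (hm i)
      have hb := hh.pos (s⁻¹ * m i) (mul_pos hs' (hm i))
      have := Real.rpow_pos_of_pos hs (2 - α)
      have := Real.rpow_pos_of_pos (hm i) (α - 2)
      generalize h (s⁻¹ * m i) = b at hb
      field_simp

/-- Truncated integrals of `1 / y` diverge when `1 / (1 - λ)` is not integrable. -/
lemma exists_truncated_integral_ge [IsFiniteMeasure ν] (hν : ∀ᵐ l ∂ν, l ∈ Set.Ioo (-1 : ℝ) 1)
    (hn : ¬ Integrable (fun l => 1 / (1 - l)) ν) (K : ℝ) :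
    ∃ δ > 0, K < ∫ l in {l | δ ≤ -Real.log l}, 1 / (-Real.log l) ∂(ν.restrict (Set.Ioo 0 1)) := by
  by_contra hc
  push Not at hc
  apply hn
  have hmS : ∀ δ : ℝ, MeasurableSet {l : ℝ | δ ≤ -Real.log l} := fun δ =>
    measurableSet_le measurable_const Real.measurable_log.neg
  have hpos : ∀ n : ℕ, (0 : ℝ) < 1 / ((n : ℝ) + 1) := fun n => by positivity
  have hcov : AECover (ν.restrict (Set.Ioo 0 1)) atTop
      (fun n : ℕ => {l : ℝ | 1 / ((n : ℝ) + 1) ≤ -Real.log l}) := by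
    refine ⟨?_, fun n => hmS _⟩
    filter_upwards [ae_restrict_mem measurableSet_Ioo] with l hl
    exact (tendsto_one_div_add_atTop_nhds_zero_nat (𝕜 := ℝ)).eventually_le_const (neg_log_pos hl)
  have hint : Integrable (fun l => 1 / (-Real.log l)) (ν.restrict (Set.Ioo 0 1)) := by
    refine hcov.integrable_of_integral_bounded_of_nonneg_ae K (fun n => ?_) ?_
      (Eventually.of_forall fun n => hc _ (hpos n))
    · refine Integrable.of_bound (Measurable.aestronglyMeasurable (by fun_prop)) ((n : ℝ) + 1) ?_
      filter_upwards [ae_restrict_mem (hmS _)] with l hl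
      have hl' : 1 / ((n : ℝ) + 1) ≤ -Real.log l := hl
      have h0 := (hpos n).trans_le hl'
      rw [Real.norm_of_nonneg (by positivity)]
      exact (one_div_le (by positivity) h0).mp hl'
    · filter_upwards [ae_restrict_mem measurableSet_Ioo] with l hl
      have := neg_log_pos hl
      positivity
  have hi : Integrable ((Set.Ioo (0 : ℝ) 1).indicator fun l => 1 / (-Real.log l)) ν :=
    (integrable_indicator_iff measurableSet_Ioo).mpr hint
  refine (hi.add (integrable_const 1)).mono' (Measurable.aestronglyMeasurable (by fun_prop)) ?_
  filter_upwards [hν] with l hl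
  have h3 : 0 < 1 - l := by linarith [hl.2]
  rw [Real.norm_of_nonneg (by positivity), Pi.add_apply]
  -- On (0, 1), 1/(1-l) ≤ 1/(-log l) + 1; for l ≤ 0 it is at most 1. Integrability therefore
  -- transfers from the logarithmic form.
  by_cases h : l ∈ Set.Ioo (0 : ℝ) 1
  · rw [Set.indicator_of_mem h]
    have hy := neg_log_pos h
    have h2 := neg_log_mul_le h
    rw [div_add_one hy.ne', div_le_div_iff₀ h3 hy]
    nlinarith
  · rw [Set.indicator_of_notMem h, zero_add, div_le_one h3]
    have : l ≤ 0 := by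
      by_contra hc'
      exact h ⟨not_le.mp hc', hl.2⟩
    linarith

lemma truncated_integral_le [IsFiniteMeasure ν] {δ : ℝ} (hδ : 0 < δ) {f : ℝ → ℝ}
    (hf : IntegrableOn f (Set.Ioo 0 1) ν) (hf0 : ∀ l ∈ Set.Ioo (0 : ℝ) 1, 0 ≤ f l)
    (hle : ∀ l ∈ Set.Ioo (0 : ℝ) 1, δ ≤ -Real.log l → 1 / (-Real.log l) ≤ f l) :
    ∫ l in {l | δ ≤ -Real.log l}, 1 / (-Real.log l) ∂(ν.restrict (Set.Ioo 0 1)) ≤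
      ∫ l in Set.Ioo (0 : ℝ) 1, f l ∂ν := by
  have hmS : MeasurableSet {l : ℝ | δ ≤ -Real.log l} :=
    measurableSet_le measurable_const Real.measurable_log.neg
  have hmem := ae_restrict_mem (μ := ν) (measurableSet_Ioo (a := (0 : ℝ)) (b := 1))
  rw [← integral_indicator hmS]
  refine integral_mono_of_nonneg ?_ hf ?_
  · filter_upwards [hmem] with l hl
    refine Set.indicator_nonneg (fun _ hx => ?_) l
    have : δ ≤ _ := hx
    have : 0 < -Real.log _ := hδ.trans_le this
    positivity
  · filter_upwards [hmem] with l hl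
    by_cases h : l ∈ {l : ℝ | δ ≤ -Real.log l}
    · rw [Set.indicator_of_mem h]; exact hle l hl h
    · rw [Set.indicator_of_notMem h]; exact hf0 l hl

/-- Once ny ≥ 2, K_n(y)/n ≥ 1/y, so the quotient eventually exceeds any truncated integral of 1/y.
-/
lemma tendsto_varMain_div_atTop [IsFiniteMeasure ν] (hν : ∀ᵐ l ∂ν, l ∈ Set.Ioo (-1 : ℝ) 1)
    (hn : ¬ Integrable (fun l => 1 / (1 - l)) ν) :
    Tendsto (fun n : ℕ => varMain ν n / n) atTop atTop := by
  refine tendsto_atTop.mpr fun K => ?_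
  obtain ⟨δ, hδ, hK⟩ := exists_truncated_integral_ge hν hn K
  filter_upwards [tendsto_natCast_atTop_atTop.eventually_ge_atTop (2 / δ),
    eventually_gt_atTop 0] with n h1 h2
  have hn' : (0 : ℝ) < n := Nat.cast_pos.mpr h2
  refine hK.le.trans ?_
  rw [varMain, ← integral_div]
  refine truncated_integral_le hδ ((integrableOn_expKernel hn'.le).div_const _)
    (fun l hl => div_nonneg (expKernel_nonneg _ _) hn'.le) fun l hl hy => ?_
  have hy0 := neg_log_pos hl
  set y := -Real.log l
  have hny : 2 ≤ n * y := by
    rw [div_le_iff₀ hδ] at h1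
    exact h1.trans (by gcongr)
  have he := Real.exp_pos (-(n * y))
  rw [expKernel, div_div, div_le_div_iff₀ hy0 (by positivity)]
  nlinarith

/-- For x < y, arctan(x/y) ≥ x/(2y); the lost factor explains the threshold 2K. -/
lemma tendsto_arctanMain_div_atTop [IsFiniteMeasure ν] (hν : ∀ᵐ l ∂ν, l ∈ Set.Ioo (-1 : ℝ) 1)
    (hn : ¬ Integrable (fun l => 1 / (1 - l)) ν) :
    Tendsto (fun x : ℝ => arctanMain ν x / x) (𝓝[>] 0) atTop := by
  refine tendsto_atTop.mpr fun K => ?_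
  obtain ⟨δ, hδ, hK⟩ := exists_truncated_integral_ge hν hn (2 * K)
  filter_upwards [Ioo_mem_nhdsGT hδ] with x hx
  have hx0 := hx.1
  have key := hK.le.trans (truncated_integral_le (f := fun l => 2 / x * Real.arctan (x / (-Real.log l)))
    hδ ((integrable_arctan (by fun_prop)).const_mul _) (fun l hl => ?_) fun l hl hy => ?_)
  · rw [integral_const_mul] at key
    rw [le_div_iff₀ hx0]
    have : 2 / x * arctanMain ν x * x = 2 * arctanMain ν x := by field_simp
    have := mul_le_mul_of_nonneg_right key hx0.le
    unfold arctanMain at *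
    linarith
  · have := neg_log_pos hl
    have := Real.arctan_pos.mpr (div_pos hx0 this)
    positivity
  · have hy0 := neg_log_pos hl
    set y := -Real.log l
    have h1 := (arctan_bounds (div_pos hx0 hy0)).1
    have h2 := mul_le_mul_of_nonneg_left h1 (show 0 ≤ 2 / x by positivity)
    refine le_trans ?_ h2
    have e : 2 / x * (x / y / (1 + (x / y) ^ 2)) = 2 * y / (y ^ 2 + x ^ 2) := by field_simp
    rw [e, div_le_div_iff₀ hy0 (by positivity)]
    have : x < y := hx.2.trans_le hy
    nlinarith

end Infinite

/-! ### The case where 1/(1-λ) is integrable -/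

section FiniteVariance

variable {ν F : Measure ℝ} {α : ℝ} {h : ℝ → ℝ}

/-- Dominated convergence; the majorant comes from Bernoulli's inequality 1 - l^n ≤ n(1 - l). -/
lemma tendsto_integral_varKernel_div (hν : ∀ᵐ l ∂ν, l ∈ Set.Ioo (-1 : ℝ) 1)
    (hi : Integrable (fun l => 1 / (1 - l)) ν) :
    Tendsto (fun n : ℕ => (∫ l, varKernel n l ∂ν) / n) atTop
      (𝓝 (∫ l, (1 + l) / (1 - l) ∂ν)) := by
  simp only [← integral_div]
  refine tendsto_integral_of_dominated_convergence (fun l => 4 * (1 / (1 - l)))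
    (fun n => ((measurable_varKernel n).div_const _).aestronglyMeasurable) (hi.const_mul 4)
    (fun n => ?_) ?_
  · filter_upwards [hν] with l hl
    have h1 : 0 < 1 - l := by linarith [hl.2]
    rcases Nat.eq_zero_or_pos n with rfl | hn
    · simp only [Nat.cast_zero, div_zero, norm_zero]
      positivity
    have hn' : (0 : ℝ) < n := Nat.cast_pos.mpr hn
    have h2 : 1 - l ^ n ≤ n * (1 - l) := by
      have := one_add_mul_le_pow (show (-2 : ℝ) ≤ l - 1 by linarith [hl.1]) n
      rw [add_sub_cancel] at this
      linarith
    have h3 : 0 ≤ 1 - l ^ n := by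
      refine sub_nonneg.mpr ((le_abs_self _).trans ?_)
      rw [abs_pow]
      exact pow_le_one₀ (abs_nonneg _) (abs_le.mpr ⟨hl.1.le, hl.2.le⟩)
    have e : varKernel n l / n =
        (1 + l) / (1 - l) - l * (2 * ((1 - l ^ n) / (n * (1 - l) ^ 2))) := by
      rw [varKernel]; field_simp
    have h4 : (1 - l ^ n) / (n * (1 - l) ^ 2) ≤ 1 / (1 - l) := by
      rw [div_le_div_iff₀ (by positivity) h1]
      nlinarith
    have h5 : 0 ≤ (1 - l ^ n) / (n * (1 - l) ^ 2) := by positivity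
    have h6 : 0 ≤ (1 + l) / (1 - l) := div_nonneg (by linarith [hl.1]) h1.le
    have h7 : (1 + l) / (1 - l) ≤ 2 * (1 / (1 - l)) := by
      rw [mul_one_div]; gcongr; linarith [hl.2]
    rw [e, Real.norm_eq_abs, abs_le]
    constructor <;> nlinarith [hl.1, hl.2]
  · filter_upwards [hν] with l hl
    have h1 : 1 - l ≠ 0 := by linarith [hl.2]
    have h2 : Tendsto (fun n : ℕ => l ^ n) atTop (𝓝 0) :=
      tendsto_pow_atTop_nhds_zero_of_abs_lt_one (abs_lt.mpr hl)
    have h3 := ((h2.const_sub 1).const_mul (2 * l)).div_const ((1 - l) ^ 2)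
    have h4 := (h3.div_atTop (tendsto_natCast_atTop_atTop (R := ℝ))).const_sub
      ((1 + l) / (1 - l))
    rw [sub_zero] at h4
    refine h4.congr' ?_
    filter_upwards [eventually_gt_atTop 0] with n hn
    have hn' : (n : ℝ) ≠ 0 := Nat.cast_ne_zero.mpr hn.ne'
    rw [varKernel]; field_simp

/-- Dominated convergence; the pointwise limit is half the derivative at 0 of the Poisson primitive,
that is half of `poisson 0 l`. -/
lemma tendsto_integral_arctan_div (hν : ∀ᵐ l ∂ν, l ∈ Set.Ioo (-1 : ℝ) 1)
    (hi : Integrable (fun l => 1 / (1 - l)) ν) :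
    Tendsto (fun x : ℝ => (∫ l, Real.arctan ((1 + l) / (1 - l) * Real.tan (x / 2)) ∂ν) / x)
      (𝓝[>] 0) (𝓝 (1 / 2 * ∫ l, (1 + l) / (1 - l) ∂ν)) := by
  rw [← integral_const_mul]
  simp only [← integral_div]
  refine tendsto_integral_filter_of_dominated_convergence (fun l => 3 * (1 / (1 - l)))
    (Eventually.of_forall fun x => (Measurable.div_const (Real.measurable_arctan.comp
      (by fun_prop)) _).aestronglyMeasurable) ?_ (hi.const_mul 3) ?_
  · filter_upwards [Ioc_mem_nhdsGT one_pos] with x hx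
    filter_upwards [hν] with l hl
    obtain ⟨t1, t2⟩ := tan_half_bounds hx.1 hx.2
    have hx0 := hx.1
    have h1 : 0 < 1 - l := by linarith [hl.2]
    have h6 : 0 < (1 + l) / (1 - l) := div_pos (by linarith [hl.1]) h1
    have h7 : (1 + l) / (1 - l) ≤ 2 * (1 / (1 - l)) := by
      rw [mul_one_div]; gcongr; linarith [hl.2]
    have h8 : 0 < (1 + l) / (1 - l) * Real.tan (x / 2) := mul_pos h6 (by linarith)
    have h9 : Real.tan (x / 2) ≤ 3 / 2 * x := by nlinarith [hx.2]
    rw [Real.norm_of_nonneg (div_nonneg (Real.arctan_pos.mpr h8).le hx0.le), div_le_iff₀ hx0]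
    calc _ ≤ (1 + l) / (1 - l) * Real.tan (x / 2) := (arctan_bounds h8).2
      _ ≤ 2 * (1 / (1 - l)) * (3 / 2 * x) := by gcongr; linarith
      _ = _ := by ring
  · filter_upwards [hν] with l hl
    have hd := (hasDerivAt_arctan_tan hl (t := 0)
      ⟨neg_lt_zero.mpr Real.pi_pos, Real.pi_pos⟩).tendsto_slope_zero_right.const_mul (1 / 2)
    have h1 : 1 - l ≠ 0 := by linarith [hl.2]
    have e : poisson 0 l = (1 + l) / (1 - l) := by
      rw [poisson, Real.cos_zero, show 1 + l ^ 2 - 2 * l * 1 = (1 - l) ^ 2 by ring]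
      field_simp
      ring
    rw [e] at hd
    refine hd.congr fun x => ?_
    simp only [zero_add, zero_div, Real.tan_zero, mul_zero, Real.arctan_zero, sub_zero,
      smul_eq_mul]
    ring

lemma tendsto_div_iff {ι : Type*} {L : Filter ι} {a b : ι → ℝ} {A c : ℝ}
    (ha : Tendsto a L (𝓝 A)) (hA : A ≠ 0) (hc : c ≠ 0) :
    Tendsto (fun i => a i / b i) L (𝓝 c) ↔ Tendsto b L (𝓝 (A / c)) := by
  constructor
  · intro H
    refine (ha.div H hc).congr' ?_
    filter_upwards [ha.eventually_ne hA] with i hi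
    exact div_div_cancel₀ hi
  · intro H
    have := ha.div H (div_ne_zero hA hc)
    rwa [div_div_cancel₀ hA] at this

lemma integral_ratio_pos [IsFiniteMeasure ν] (hν : ∀ᵐ l ∂ν, l ∈ Set.Ioo (-1 : ℝ) 1)
    (hi : Integrable (fun l => 1 / (1 - l)) ν) (h0 : ν ≠ 0) :
    0 < ∫ l, (1 + l) / (1 - l) ∂ν := by
  have hp : ∀ᵐ l ∂ν, 0 < (1 + l) / (1 - l) := hν.mono fun l hl =>
    div_pos (by linarith [hl.1]) (by linarith [hl.2])
  have hint : Integrable (fun l => (1 + l) / (1 - l)) ν := by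
    refine (hi.const_mul 2).mono' (Measurable.aestronglyMeasurable (by fun_prop)) ?_
    filter_upwards [hν, hp] with l hl hl'
    have : 0 < 1 - l := by linarith [hl.2]
    rw [Real.norm_of_nonneg hl'.le, mul_one_div]
    gcongr
    linarith [hl.2]
  refine (integral_nonneg_of_ae (hp.mono fun _ h => h.le)).lt_of_ne fun H => h0 ?_
  rw [eq_comm, integral_eq_zero_iff_of_nonneg_ae (hp.mono fun _ h => h.le) hint] at H
  rw [← ae_eq_bot, ← eventually_false_iff_eq_bot]
  filter_upwards [hp, H] with l h1 h2
  exact h1.ne' h2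

/-- The variance over n and F(x)/x have finite limits, positive unless ν = 0. Each asymptotic
relation then says that t^{α-1}h(t) converges to a positive limit, along integers or reals, which
forces α = 1. -/
lemma integral_varKernel_iff_spectralAsymp_of_integrable [IsFiniteMeasure ν]
    (hν : ∀ᵐ l ∂ν, l ∈ Set.Ioo (-1 : ℝ) 1)
    (hF : F = (volume.restrict (Set.Icc 0 (2 * Real.pi))).withDensity
      (fun t => ENNReal.ofReal (density ν t)))
    (hi : Integrable (fun l => 1 / (1 - l)) ν) (h1 : 1 ≤ α) (h2 : α < 2) (hh : SlowlyVarying h) :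
    (fun n : ℕ => ∫ l, varKernel n l ∂ν) ~[atTop] (fun n : ℕ => (n : ℝ) ^ α * h n) ↔
      SpectralAsymp F α h := by
  have hC := cConst_pos h1 h2
  have hpi := Real.pi_pos
  have hdist := fun {x} hx => distFun_eq_integral_arctan (x := x) hν hF hx
  have hinv : Tendsto (fun t : ℝ => 1 / t) atTop (𝓝[>] 0) := by
    simpa only [one_div] using tendsto_inv_atTop_nhdsGT_zero (𝕜 := ℝ)
  have hsmall : ∀ᶠ t : ℝ in atTop, 1 / t ∈ Set.Ioo 0 Real.pi :=
    hinv.eventually (Ioo_mem_nhdsGT hpi)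
  rw [SpectralAsymp, isEquivalent_nat_iff_tendsto hh,
    isEquivalent_zero_iff_tendsto_atTop hh (by positivity)]
  -- For ν = 0 both sides fail, since the normalised quantities vanish and cannot tend to a positive
  -- constant.
  by_cases h0 : ν = 0
  · subst h0
    simp only [integral_zero_measure] at hdist ⊢
    constructor
    · intro H
      simp only [zero_div] at H
      exact absurd (tendsto_nhds_unique H tendsto_const_nhds) one_ne_zero
    · intro H
      refine absurd (tendsto_nhds_unique H (tendsto_const_nhds.congr' ?_))
        (show 1 / 2 * cConst α ≠ 0 by positivity)
      filter_upwards [hsmall] with t ht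
      rw [hdist ⟨ht.1.le, ht.2⟩, mul_zero, zero_div]
  · have hσ := integral_ratio_pos hν hi h0
    have hV := tendsto_integral_varKernel_div hν hi
    have hG := ((tendsto_integral_arctan_div hν hi).comp hinv).const_mul (1 / Real.pi)
    set σ := ∫ l, (1 + l) / (1 - l) ∂ν
    have eV : (fun n : ℕ => (∫ l, varKernel n l ∂ν) / n / ((n : ℝ) ^ (α - 1) * h n)) =ᶠ[atTop]
        fun n : ℕ => (∫ l, varKernel n l ∂ν) / ((n : ℝ) ^ α * h n) := by
      filter_upwards [eventually_gt_atTop 0] with n hn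
      have hn' : (0 : ℝ) < n := Nat.cast_pos.mpr hn
      rw [div_div, ← mul_assoc, Real.rpow_sub_one hn'.ne', mul_div_cancel₀ _ hn'.ne']
    have eG : (fun t : ℝ => 1 / Real.pi * (((fun x : ℝ =>
        (∫ l, Real.arctan ((1 + l) / (1 - l) * Real.tan (x / 2)) ∂ν) / x) ∘ fun t => 1 / t) t) /
          (t ^ (α - 1) * h t)) =ᶠ[atTop]
        fun t : ℝ => distFun F (1 / t) / (t ^ (α - 2) * h t) := by
      filter_upwards [hsmall, eventually_gt_atTop 0] with t ht ht0
      have := hh.pos t ht0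
      have := Real.rpow_pos_of_pos ht0 (α - 2)
      rw [hdist ⟨ht.1.le, ht.2⟩, show α - 1 = α - 2 + 1 by ring, Real.rpow_add_one ht0.ne']
      simp only [Function.comp_apply]
      generalize ∫ l, Real.arctan ((1 + l) / (1 - l) * Real.tan (1 / t / 2)) ∂ν = I
      field_simp
    rw [← tendsto_congr' eV, ← tendsto_congr' eG, tendsto_div_iff hV hσ.ne' one_ne_zero,
      tendsto_div_iff hG (by positivity) (by positivity), div_one]
    -- Because C(1) = 1/π, the two sides require the same limit of h.
    have hlim : α = 1 → 1 / Real.pi * (1 / 2 * σ) / (1 / 2 * cConst α) = σ := fun h => by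
      rw [h, cConst_one]; field_simp
    constructor
    · intro H
      have ha := eq_one_of_tendsto hh hσ H
      rw [hlim ha]
      subst ha
      simp only [sub_self, Real.rpow_zero, one_mul] at H ⊢
      exact hh.tendsto_of_nat H
    · intro H
      have H' := H.comp (tendsto_natCast_atTop_atTop (R := ℝ))
      have ha := eq_one_of_tendsto hh (by positivity) H'
      rwa [hlim ha] at H'

end FiniteVariance

/-! ### The equivalences of the three asymptotic relations -/

section Equivalences

variable {ν F : Measure ℝ} {α : ℝ} {h : ℝ → ℝ}

lemma isBigO_pi_mul_distFun_sub_arctanMain [IsFiniteMeasure ν]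
    (hν : ∀ᵐ l ∂ν, l ∈ Set.Ioo (-1 : ℝ) 1)
    (hF : F = (volume.restrict (Set.Icc 0 (2 * Real.pi))).withDensity
      (fun t => ENNReal.ofReal (density ν t))) :
    (fun x => Real.pi * distFun F x - arctanMain ν x) =O[𝓝[>] 0] fun x : ℝ => x := by
  refine IsBigO.of_bound (3 * ν.real Set.univ) ?_
  filter_upwards [Ioc_mem_nhdsGT one_pos] with x hx
  have hpi := Real.pi_gt_three
  have := abs_integral_arctan_sub_le hν hx.1 hx.2
  rw [distFun_eq_integral_arctan hν hF ⟨hx.1.le, by linarith [hx.2]⟩, ← mul_assoc,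
    mul_one_div_cancel Real.pi_ne_zero, one_mul, Real.norm_eq_abs, Real.norm_of_nonneg hx.1.le]
  linarith

/-- The comparison errors O(n) and O(x) are negligible against principal parts that outgrow n and x,
so the Tauberian theorem for the principal parts applies. -/
lemma integral_varKernel_iff_spectralAsymp_of_not_integrable [IsFiniteMeasure ν]
    (hν : ∀ᵐ l ∂ν, l ∈ Set.Ioo (-1 : ℝ) 1)
    (hF : F = (volume.restrict (Set.Icc 0 (2 * Real.pi))).withDensity
      (fun t => ENNReal.ofReal (density ν t)))
    (hn : ¬ Integrable (fun l => 1 / (1 - l)) ν) (h1 : 1 ≤ α) (h2 : α < 2)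
    (hh : SlowlyVarying h) :
    (fun n : ℕ => ∫ l, varKernel n l ∂ν) ~[atTop] (fun n : ℕ => (n : ℝ) ^ α * h n) ↔
      SpectralAsymp F α h := by
  have hC := cConst_pos h1 h2
  have hpi := Real.pi_pos
  have hV : (fun n : ℕ => ∫ l, varKernel n l ∂ν) ~[atTop] fun n : ℕ => varMain ν n := by
    refine IsBigO.trans_isLittleO (g := fun n : ℕ => (n : ℝ)) ?_ ?_
    · refine IsBigO.of_bound (8 * ν.real Set.univ) ?_
      filter_upwards [eventually_ge_atTop 1] with n hn'
      have h3 : (1 : ℝ) ≤ n := by exact_mod_cast hn'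
      have h4 := abs_integral_varKernel_sub_le hν n
      have h5 : 0 ≤ ν.real Set.univ := measureReal_nonneg
      rw [Real.norm_of_nonneg (by linarith : (0 : ℝ) ≤ n)]
      refine h4.trans ?_
      nlinarith
    · refine (isLittleO_iff_tendsto' ?_).mpr
        ((tendsto_varMain_div_atTop hν hn).inv_tendsto_atTop.congr fun n => ?_)
      · filter_upwards [(tendsto_varMain_div_atTop hν hn).eventually_gt_atTop 0] with n h3 h4
        rw [h4, zero_div] at h3
        exact absurd h3 (lt_irrefl _)
      · simp
  have hG : (fun x => Real.pi * distFun F x) ~[𝓝[>] 0] fun x => arctanMain ν x := by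
    refine (isBigO_pi_mul_distFun_sub_arctanMain hν hF).trans_isLittleO
      ((isLittleO_iff_tendsto' ?_).mpr
        ((tendsto_arctanMain_div_atTop hν hn).inv_tendsto_atTop.congr fun n => ?_))
    · filter_upwards [(tendsto_arctanMain_div_atTop hν hn).eventually_gt_atTop 0] with n h3 h4
      rw [h4, zero_div] at h3
      exact absurd h3 (lt_irrefl _)
    · simp
  have e1 : SpectralAsymp F α h ↔ (fun x => arctanMain ν x) ~[𝓝[>] 0]
      fun x => Real.pi / 2 * cConst α * x ^ (2 - α) * h (1 / x) := by
    constructor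
    · intro H
      refine hG.symm.trans (((IsEquivalent.refl (u := fun _ : ℝ => Real.pi)).mul H).congr_right
        (Eventually.of_forall fun x => ?_))
      simp only [Pi.mul_apply]; ring
    · intro H
      refine (((IsEquivalent.refl (u := fun _ : ℝ => Real.pi⁻¹)).mul (hG.trans H)).congr_left
        (Eventually.of_forall fun x => ?_)).congr_right (Eventually.of_forall fun x => ?_)
      · simp only [Pi.mul_apply]; field_simp
      · simp only [Pi.mul_apply]; field_simp
  rw [e1, isEquivalent_zero_iff_tendsto_atTop hh (by positivity),
    ← varMain_iff_arctanMain h1 h2 hh, ← isEquivalent_nat_iff_tendsto hh]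
  exact ⟨fun H => hV.symm.trans H, fun H => hV.trans H⟩

/-- The equivalence of the variance and the spectral asymptotics. -/
theorem integral_varKernel_iff_spectralAsymp [IsFiniteMeasure ν]
    (hν : ∀ᵐ l ∂ν, l ∈ Set.Ioo (-1 : ℝ) 1)
    (hF : F = (volume.restrict (Set.Icc 0 (2 * Real.pi))).withDensity
      (fun t => ENNReal.ofReal (density ν t)))
    (h1 : 1 ≤ α) (h2 : α < 2) (hh : SlowlyVarying h) :
    (fun n : ℕ => ∫ l, varKernel n l ∂ν) ~[atTop] (fun n : ℕ => (n : ℝ) ^ α * h n) ↔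
      SpectralAsymp F α h := by
  by_cases hi : Integrable (fun l => 1 / (1 - l)) ν
  · exact integral_varKernel_iff_spectralAsymp_of_integrable hν hF hi h1 h2 hh
  · exact integral_varKernel_iff_spectralAsymp_of_not_integrable hν hF hi h1 h2 hh

/-- The equivalence of the spectral and the transition asymptotics when `h → ∞`. -/
theorem spectralAsymp_iff_transitionAsymp [IsFiniteMeasure ν]
    (hν : ∀ᵐ l ∂ν, l ∈ Set.Ioo (-1 : ℝ) 1)
    (hF : F = (volume.restrict (Set.Icc 0 (2 * Real.pi))).withDensity
      (fun t => ENNReal.ofReal (density ν t)))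
    (h1 : 1 ≤ α) (h2 : α < 2) (hinf : Tendsto h atTop atTop) :
    SpectralAsymp F α h ↔ TransitionAsymp ν α h := by
  have hC := cConst_pos h1 h2
  have hpi := Real.pi_pos
  let T : ℝ → ℝ := fun x => ∫ y in (0 : ℝ)..1, rFun ν y / (x ^ 2 + y ^ 2)
  let R : ℝ → ℝ := fun x => Real.pi / 2 * cConst α * x ^ (1 - α) * h (1 / x)
  let G : ℝ → ℝ := fun x => Real.pi * distFun F x / x
  have hinv : Tendsto (fun x : ℝ => 1 / x) (𝓝[>] 0) atTop := by
    simpa only [one_div] using tendsto_inv_nhdsGT_zero (𝕜 := ℝ)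
  -- Near 0 the power x^{1-α} is at least 1, so h → ∞ suffices even at α = 1.
  have hR : Tendsto R (𝓝[>] 0) atTop := by
    refine tendsto_atTop_mono' _ ?_
      ((hinf.comp hinv).const_mul_atTop (show 0 < Real.pi / 2 * cConst α by positivity))
    filter_upwards [Ioc_mem_nhdsGT one_pos, hinv.eventually (hinf.eventually_ge_atTop 0)]
      with x hx hx'
    have := Real.one_le_rpow_of_pos_of_le_one_of_nonpos hx.1 hx.2 (show 1 - α ≤ 0 by linarith)
    simp only [Function.comp_apply, R]
    exact mul_le_mul_of_nonneg_right (le_mul_of_one_le_right (by positivity) this) hx'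
  have hone : (fun _ : ℝ => (1 : ℝ)) =o[𝓝[>] 0] R :=
    (isLittleO_const_left).mpr (Or.inr (tendsto_norm_atTop_atTop.comp hR))
  have hd : (T - G) =O[𝓝[>] 0] fun _ : ℝ => (1 : ℝ) := by
    have e1 : (fun x => T x - arctanMain ν x / x) =O[𝓝[>] 0] fun _ : ℝ => (1 : ℝ) := by
      refine IsBigO.of_bound (2 * ν.real Set.univ) ?_
      filter_upwards [self_mem_nhdsWithin] with x hx
      rw [norm_one, mul_one]
      exact abs_integral_rFun_sub_le hν hx
    have e2 : (fun x => x⁻¹ * (Real.pi * distFun F x - arctanMain ν x)) =O[𝓝[>] 0]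
        fun _ : ℝ => (1 : ℝ) := by
      refine ((isBigO_refl (fun x : ℝ => x⁻¹) _).mul
        (isBigO_pi_mul_distFun_sub_arctanMain hν hF)).congr' EventuallyEq.rfl ?_
      filter_upwards [self_mem_nhdsWithin] with x hx
      exact inv_mul_cancel₀ (ne_of_gt hx)
    refine (e1.sub e2).congr_left fun x => ?_
    simp only [Pi.sub_apply, G]
    ring
  have hTR : G ~[𝓝[>] 0] R ↔ T ~[𝓝[>] 0] R := by
    have hd' := hd.trans_isLittleO hone
    constructor
    · intro H
      have := H.add_isLittleO hd'
      rwa [add_sub_cancel] at this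
    · intro H
      have := H.sub_isLittleO hd'
      rwa [sub_sub_cancel] at this
  have hGR : SpectralAsymp F α h ↔ G ~[𝓝[>] 0] R := by
    constructor
    · intro H
      refine (((IsEquivalent.refl (u := fun x : ℝ => Real.pi / x)).mul H).congr_left
        (Eventually.of_forall fun x => ?_)).congr_right ?_
      · simp only [Pi.mul_apply, G]; ring
      · filter_upwards [self_mem_nhdsWithin] with x hx
        have hx' : (0 : ℝ) < x := hx
        simp only [Pi.mul_apply, R]
        rw [show 2 - α = 1 - α + 1 by ring, Real.rpow_add_one hx'.ne']
        field_simp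
    · intro H
      refine (((IsEquivalent.refl (u := fun x : ℝ => x / Real.pi)).mul H).congr_left
        ?_).congr_right ?_
      · filter_upwards [self_mem_nhdsWithin] with x hx
        have hx' : (0 : ℝ) < x := hx
        simp only [Pi.mul_apply, G]; field_simp
      · filter_upwards [self_mem_nhdsWithin] with x hx
        have hx' : (0 : ℝ) < x := hx
        simp only [Pi.mul_apply, R]
        rw [show 2 - α = 1 - α + 1 by ring, Real.rpow_add_one hx'.ne']
        field_simp
  rw [hGR, hTR]
  constructor
  · intro H
    refine ⟨fun _ => 0, isBigO_zero _ _, ?_⟩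
    simpa only [add_zero] using H
  -- Whatever bounded term is supplied, it is negligible against the divergent R.
  · rintro ⟨e, he, H⟩
    exact H.trans (IsEquivalent.refl.add_isLittleO (he.trans_isLittleO hone))

end Equivalences

end ReversibleChain

/-! ### The main theorem -/

theorem mainTheorem10 {Ω S : Type*} [MeasurableSpace Ω] [MeasurableSpace S]
    (P : Measure Ω) [IsProbabilityMeasure P] (Q : Kernel S S) [IsMarkovKernel Q]
    (ξ : ℤ → Ω → S) (hξ : ReversibleChain.IsStationaryMarkovChain P Q ξ)
    (π : Measure S) (hπ : π = P.map (ξ 0))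
    (hQ : ReversibleChain.IsSelfAdjointOn Q π)
    (g : S → ℝ) (hg : ReversibleChain.MemL20 π g)
    (X : ℤ → Ω → ℝ) (hX : X = fun n ω => g (ξ n ω))
    (ν : Measure ℝ) (hν : ReversibleChain.IsTransitionSpectralMeasure Q π g ν)
    (hν_one : ν {1} = 0) (hν_neg_one : ν {-1} = 0)
    (F : Measure ℝ) (hF : ReversibleChain.IsSpectralDistribution P X F) :
    (F ≪ volume ∧
      (∀ t : ℝ, Real.sin t ≠ 0 →
        IntegrableOn (ReversibleChain.poisson t) (Set.Icc (-1) 1) ν) ∧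
      IntegrableOn (ReversibleChain.density ν) (Set.Icc 0 (2 * Real.pi)) ∧
      F = (volume.restrict (Set.Icc 0 (2 * Real.pi))).withDensity
        (fun t => ENNReal.ofReal (ReversibleChain.density ν t))) ∧
    ∀ α : ℝ, 1 ≤ α → α < 2 → ∀ h : ℝ → ℝ, ReversibleChain.SlowlyVarying h →
      (ReversibleChain.VarianceAsymp P X α h ↔ ReversibleChain.SpectralAsymp F α h) ∧
      (Tendsto h atTop atTop →
        (ReversibleChain.VarianceAsymp P X α h ↔ ReversibleChain.TransitionAsymp ν α h) ∧
        (ReversibleChain.SpectralAsymp F α h ↔ ReversibleChain.TransitionAsymp ν α h)) := by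
  subst hπ
  have := hν.finite
  have := hF.finite
  have hIoo := ReversibleChain.ae_mem_Ioo_of_no_atoms hν.support hν_one hν_neg_one
  have hcov : ∀ i j, cov[X i, X j; P] = ∫ l, l ^ (i - j).natAbs ∂ν := fun i j => by
    rw [hX]; exact hξ.covariance_eq hg hν i j
  have hXL : ∀ i, MemLp (X i) 2 P := fun i => by
    rw [hX]; exact hξ.memLp hg i
  have hFd := ReversibleChain.eq_withDensity_density hIoo hF.support fun n => by
    rw [← hF.herglotz n, hcov 0 n, zero_sub, Int.natAbs_neg]
  have hvar : ∀ α h, ReversibleChain.VarianceAsymp P X α h ↔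
      (fun n : ℕ => ∫ l, ReversibleChain.varKernel n l ∂ν) ~[atTop]
        (fun n : ℕ => (n : ℝ) ^ α * h n) := fun α h => by
    rw [ReversibleChain.VarianceAsymp]
    simp only [ReversibleChain.variance_eq_integral_varKernel hXL hIoo hcov]
  refine ⟨⟨?_, fun t ht => ReversibleChain.integrableOn_poisson ht,
    ReversibleChain.integrableOn_density hIoo, hFd⟩, fun α h1 h2 h hh => ?_⟩
  · rw [hFd]
    exact (withDensity_absolutelyContinuous _ _).trans Measure.restrict_le_self.absolutelyContinuous
  · have h12 : ReversibleChain.VarianceAsymp P X α h ↔ ReversibleChain.SpectralAsymp F α h :=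
      (hvar α h).trans (ReversibleChain.integral_varKernel_iff_spectralAsymp hIoo hFd h1 h2 hh)
    refine ⟨h12, fun hinf => ?_⟩
    have h23 := ReversibleChain.spectralAsymp_iff_transitionAsymp hIoo hFd h1 h2 hinf
    exact ⟨h12.trans h23, h23⟩
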